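/- Let $d\ge 1$, let $v:\mathbb R^d\to\mathbb C$ and $\omega:\mathbb R^d\to\mathbb R$ be measurable, and let $\mathcal F$ be the bosonic Fock space over $L^2(\mathbb R^d)$. On $L^2(\mathbb R^d)\otimes\mathcal F$ consider $$H=p_x^2+H_f+\int v(k)e^{-ik\cdot x}a_k^\dagger\,dk+\int\overline{v(k)}e^{ik\cdot x}a_k\,dk,\qquad p_x=-i\nabla_x,\quad H_f=\int\omega(k)a_k^\dagger a_k\,dk,$$ and, for $P\in\mathbb R^d$, with $P_f=\int k\,a_k^\dagger a_k\,dk$, the fibers on $\mathcal F$ $$H_P=(P-P_f)^2+H_f+\int v(k)a_k^\dagger\,dk+\int\overline{v(k)}a_k\,dk .$$ Both are understood as the operators of the corresponding quadratic forms on the form domains of $p_x^2+H_f$ and of $(P-P_f)^2+H_f$. Assume that the interaction is given there by absolutely convergent integrals, that the form of $H$ is bounded from below, and that $H$ and all $H_P$ so defined are self-adjoint. Let $E(P)=\inf\operatorname{spec}H_P$. Assume: (1) There is $M\in(0,\infty]$ with $$\frac1M=2\lim_{P\to0}\frac{E(P)-E(0)}{|P|^2}$$ (the dynamic effective mass), and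 there is $C>0$ such that $E(P)\ge E(0)+\dfrac{P^2}{2M(1+CP^2)}$ for all $P\in\mathbb R^d$. (2) There is $P_c>0$ such that for $|P|<P_c$ the operator $H_P$ has a ground state (an eigenvector with eigenvalue $E(P)$), unique up to a factor, and the normalized ground states can be chosen to depend continuously on $P$ in $\mathcal F$. Let $V:\mathbb R^d\to\mathbb R$ be bounded, decaying at infinity, with $\hat V\in L^1(\mathbb R^d)$, such that $p^2+V$ on $L^2(\mathbb R^d)$ has an eigenvector with a negative eigenvalue. For $m\in[1/2,\infty]$ let $\mathcal E(m)=\inf\operatorname{spec}\bigl(\tfrac{p^2}{2m}+V\bigr)$, with $p^2/(2m)=0$ for $m=\infty$. Then the limit $$\lim_{\lambda\downarrow0}\lambda^{-2}\inf\operatorname{spec}\bigl(H+\lambda^2V(\lambda x)-E(0)\bigr)$$ exists, there is exactly one $\widetilde M\in[1/2,\infty]$ (the static effective mass) such that $\mathcal E(\widetilde M)$ is equal to it, and $\widetilde M=M$. -/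

import Mathlib

open MeasureTheory Filter Topology
open scoped ENNReal FourierTransform ComplexConjugate

namespace Polaron

noncomputable section

/-! ### Operators given by their graphs: self-adjointness and spectrum -/

section Operators

variable {K : Type*} [NormedAddCommGroup K] [InnerProductSpace ℂ K]

/-- The graph of the operator `T` associated with a quadratic form `q` with form domain `Q`:
`Ψ ∈ dom T` and `T Ψ = η` iff `Ψ ∈ Q` and `q(χ, Ψ) = ⟨χ, η⟩` for all `χ ∈ Q`. -/
def formGraph (Q : Set K) (q : K → K → ℂ) : Set (K × K) :=
  {z | z.1 ∈ Q ∧ ∀ χ ∈ Q, q χ z.1 = inner ℂ χ z.2}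

/-- `G` is the graph of a (densely defined) self-adjoint operator. -/
def IsSelfAdjointGraph [CompleteSpace K] (G : Set (K × K)) : Prop :=
  ∃ A : K →ₗ.[ℂ] K, IsSelfAdjoint A ∧ (A.graph : Set (K × K)) = G

/-- The resolvent set of the operator `T` with graph `G`: those `z` for which `(T - z) x = y` has
for every `y` exactly one solution `x`, depending on `y` through a bounded operator. -/
def resolventSet (G : Set (K × K)) : Set ℂ :=
  {z | ∃ R : K →L[ℂ] K, ∀ x y : K, (x, y + z • x) ∈ G ↔ x = R y}

/-- The bottom of the spectrum of the operator with graph `G`. -/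
def infSpec (G : Set (K × K)) : ℝ :=
  sInf {t : ℝ | (t : ℂ) ∉ resolventSet G}

end Operators

/-! ### Configuration space, Fock space and the Hilbert space of the particle and the field -/

/-- `ℝ^d`. -/
abbrev E (d : ℕ) : Type := EuclideanSpace ℝ (Fin d)

/-- The boson momenta: a number `n` of bosons and their momenta `k₁, …, kₙ ∈ ℝ^d`. -/
abbrev Config (d : ℕ) : Type := Σ n : ℕ, (Fin n → E d)

variable {d : ℕ}

/-- Lebesgue measure on each `(ℝ^d)^n` (a unit point mass for `n = 0`). -/
def configMeasure (d : ℕ) : Measure (Config d) :=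
  Measure.sum fun n : ℕ =>
    Measure.map (fun K => (⟨n, K⟩ : Config d)) (volume : Measure (Fin n → E d))

/-- Add one boson of momentum `k`. -/
def cons (k : E d) (c : Config d) : Config d := ⟨c.1 + 1, Fin.cons k c.2⟩

/-- Permute the bosons, by a permutation `σ n` in the sector of `n` bosons. -/
def permute (σ : ∀ n : ℕ, Equiv.Perm (Fin n)) (c : Config d) : Config d :=
  ⟨c.1, fun i => c.2 (σ c.1 i)⟩

instance : SFinite (configMeasure d) := by
  unfold configMeasure; infer_instance

theorem measurable_sigmaMk (n : ℕ) :
    Measurable (fun K : Fin n → E d => (⟨n, K⟩ : Config d)) := by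
  intro s hs
  exact MeasurableSpace.measurableSet_iInf.1 hs n

theorem measurable_sigma {β : Type*} [MeasurableSpace β] {f : Config d → β}
    (h : ∀ n, Measurable fun K : Fin n → E d => f ⟨n, K⟩) : Measurable f := by
  intro s hs
  exact MeasurableSpace.measurableSet_iInf.2 fun n => h n hs

theorem measurePreserving_permute (σ : ∀ n : ℕ, Equiv.Perm (Fin n)) :
    MeasurePreserving (permute σ : Config d → Config d) (configMeasure d) (configMeasure d) := by
  have hp : ∀ n, MeasurePreserving (fun K : Fin n → E d => fun i => K (σ n i)) volume volume := by
    intro n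
    have h := volume_measurePreserving_piCongrLeft (fun _ : Fin n => E d) (σ n).symm
    convert h using 1
    ext K i
    simp [MeasurableEquiv.piCongrLeft, Equiv.piCongrLeft]
  have hm : Measurable (permute σ : Config d → Config d) :=
    measurable_sigma fun n => (measurable_sigmaMk n).comp (hp n).measurable
  refine ⟨hm, ?_⟩
  unfold configMeasure
  rw [Measure.map_sum hm.aemeasurable]
  congr 1
  funext n
  rw [Measure.map_map hm (measurable_sigmaMk n)]
  have : (permute σ : Config d → Config d) ∘ (fun K : Fin n → E d => (⟨n, K⟩ : Config d))
      = (fun K : Fin n → E d => (⟨n, K⟩ : Config d)) ∘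
        fun K : Fin n → E d => fun i => K (σ n i) := rfl
  rw [this, ← Measure.map_map (measurable_sigmaMk n) (hp n).measurable, (hp n).map_eq]

/-- The bosonic Fock space over `L²(ℝ^d)`, in the momentum representation: square integrable
`Φ(k₁, …, kₙ)`, `n = 0, 1, 2, …`, that are symmetric under permutations of the bosons. -/
def Fock (d : ℕ) : Submodule ℂ (Lp ℂ 2 (configMeasure d)) :=
  ⨅ σ : ∀ n : ℕ, Equiv.Perm (Fin n),
    LinearMap.eqLocus
      (Lp.compMeasurePreservingₗᵢ ℂ (permute σ) (measurePreserving_permute σ)).toLinearMap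
      LinearMap.id

/-- The measure on the momenta `(p; k₁, …, kₙ)` of the particle and of the bosons. -/
def totalMeasure (d : ℕ) : Measure (E d × Config d) :=
  (volume : Measure (E d)).prod (configMeasure d)

theorem measurePreserving_prod_permute (σ : ∀ n : ℕ, Equiv.Perm (Fin n)) :
    MeasurePreserving (Prod.map id (permute σ) : E d × Config d → E d × Config d)
      (totalMeasure d) (totalMeasure d) :=
  (MeasurePreserving.id _).prod (measurePreserving_permute σ)

/-- `L²(ℝ^d) ⊗ Fock`, in the momentum representation: square integrable `Ψ(p; k₁, …, kₙ)` that are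
symmetric in the bosons. The first variable `p` is the momentum of the particle, so that
`Ψ(p; ·)` is the unitary Fourier transform `(2π)^{-d/2} ∫ e^{-ip·x} Ψ(x; ·) dx` of the
wave function in the position `x` of the particle. -/
def Total (d : ℕ) : Submodule ℂ (Lp ℂ 2 (totalMeasure d)) :=
  ⨅ σ : ∀ n : ℕ, Equiv.Perm (Fin n),
    LinearMap.eqLocus
      (Lp.compMeasurePreservingₗᵢ ℂ (Prod.map id (permute σ))
        (measurePreserving_prod_permute σ)).toLinearMap
      LinearMap.id

instance : CompleteSpace (Fock d) := by
  have h : IsClosed ((Fock d : Submodule ℂ (Lp ℂ 2 (configMeasure d))) :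
      Set (Lp ℂ 2 (configMeasure d))) := by
    simp only [Fock, Submodule.coe_iInf]
    exact isClosed_iInter fun σ => isClosed_eq
      (Lp.compMeasurePreservingₗᵢ ℂ (permute σ) (measurePreserving_permute σ)).continuous
      continuous_id
  exact h.completeSpace_coe

instance : CompleteSpace (Total d) := by
  have h : IsClosed ((Total d : Submodule ℂ (Lp ℂ 2 (totalMeasure d))) :
      Set (Lp ℂ 2 (totalMeasure d))) := by
    simp only [Total, Submodule.coe_iInf]
    exact isClosed_iInter fun σ => isClosed_eq
      (Lp.compMeasurePreservingₗᵢ ℂ (Prod.map id (permute σ))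
        (measurePreserving_prod_permute σ)).continuous
      continuous_id
  exact h.completeSpace_coe

/-- The total momentum `k₁ + ⋯ + kₙ` of the bosons: the operator `P_f` is multiplication by it. -/
def fieldMomentum (c : Config d) : E d := ∑ i, c.2 i

/-- The energy `ω(k₁) + ⋯ + ω(kₙ)`: the operator `H_f` is multiplication by it. -/
def fieldEnergy (ω : E d → ℝ) (c : Config d) : ℝ := ∑ i, ω (c.2 i)

/-! ### External potentials -/

/-- The inverse Fourier transform of an `L²` function `f` of the momentum, in Mathlib's
normalization `∫ e^{2πi p·y} f(p) dp`. The position of the particle is `x = 2π y`. -/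
def position (f : E d → ℂ) : E d → ℂ :=
  open Classical in
  if h : MemLp f 2 (volume : Measure (E d)) then
    ⇑(𝓕⁻ (h.toLp f) : Lp ℂ 2 (volume : Measure (E d)))
  else 0

/-- The form `∫ U(x) conj(χ(x)) ψ(x) dx` of the multiplication operator `U(x)`, for functions
`χ`, `ψ` given as functions `f`, `g` of the momentum. With `x = 2π y` and
`ψ(2π y) = (2π)^{-d/2} (position g)(y)`, the powers of `2π` cancel. -/
def potentialForm (U : E d → ℝ) (f g : E d → ℂ) : ℂ :=
  ∫ y, (U ((2 * Real.pi) • y) : ℂ) * (conj (position f y) * position g y)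

/-! ### The Schrödinger operator `p² / (2m) + V`, `0 < m ≤ ∞` -/

/-- The coefficient `1 / (2m)`, equal to `0` for `m = ∞`. -/
def invTwoMass (m : ℝ≥0∞) : ℝ := ((2 * m)⁻¹).toReal

/-- The form domain of `p² / (2m) + V` for bounded `V`, in the momentum representation. -/
def schrodingerDomain (d : ℕ) (m : ℝ≥0∞) : Set (Lp ℂ 2 (volume : Measure (E d))) :=
  {f | Integrable fun p => invTwoMass m * ‖p‖ ^ 2 * ‖f p‖ ^ 2}

/-- The sesquilinear form of `p² / (2m) + V`. -/
def schrodingerForm (V : E d → ℝ) (m : ℝ≥0∞) (f g : Lp ℂ 2 (volume : Measure (E d))) : ℂ :=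
  (∫ p, ((invTwoMass m * ‖p‖ ^ 2 : ℝ) : ℂ) * (conj (f p) * g p)) + potentialForm V f g

/-- The operator `p² / (2m) + V` on `L²(ℝ^d)`. -/
def schrodingerGraph (V : E d → ℝ) (m : ℝ≥0∞) :
    Set (Lp ℂ 2 (volume : Measure (E d)) × Lp ℂ 2 (volume : Measure (E d))) :=
  formGraph (schrodingerDomain d m) (schrodingerForm V m)

/-- `𝓔(m) = inf spec (p² / (2m) + V)`. -/
def schrodingerEnergy (V : E d → ℝ) (m : ℝ≥0∞) : ℝ := infSpec (schrodingerGraph V m)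

/-- The potentials: bounded, real, decaying at infinity, with integrable Fourier transform, such
that `p² + V` (mass `1/2`) has an eigenvector with a negative eigenvalue. -/
structure IsBindingPotential (V : E d → ℝ) : Prop where
  bounded : ∃ B : ℝ, ∀ x, |V x| ≤ B
  decay : Tendsto V (cocompact (E d)) (𝓝 0)
  fourier_integrable : ∃ W : E d → ℂ, Integrable W ∧
    (fun x => (V x : ℂ)) =ᵐ[volume] (𝓕⁻ W : E d → ℂ)
  bound_state : ∃ e : ℝ, e < 0 ∧ ∃ f : Lp ℂ 2 (volume : Measure (E d)),
    f ≠ 0 ∧ (f, (e : ℂ) • f) ∈ schrodingerGraph V (1 / 2)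

/-! ### The Hamiltonian `H` with an external potential `U` -/

/-- The form domain of `p² + H_f`. -/
def totalDomain (ω : E d → ℝ) : Set (Total d) :=
  {Ψ | Integrable (fun z => (‖z.1‖ ^ 2 + fieldEnergy ω z.2) *
    ‖(Ψ : Lp ℂ 2 (totalMeasure d)) z‖ ^ 2) (totalMeasure d)}

/-- The integrand, as a function of `(k, (p, c))`, of the matrix element between `χ` and `Ψ` of
`∫ v(k) e^{-ik·x} a†_k dk`. The operator `e^{-ik·x}` takes a particle of momentum `p` to momentum
`p - k`, and `a†_k` adds a boson of momentum `k`. -/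
def totalCreation (v : E d → ℂ) (χ Ψ : Total d) (z : E d × (E d × Config d)) : ℂ :=
  (Real.sqrt (z.2.2.1 + 1) : ℂ) * v z.1 *
    (conj ((χ : Lp ℂ 2 (totalMeasure d)) (z.2.1 - z.1, cons z.1 z.2.2)) *
      (Ψ : Lp ℂ 2 (totalMeasure d)) z.2)

/-- The sesquilinear form of
`p² + H_f + ∫ v(k) e^{-ik·x} a†_k dk + ∫ conj(v(k)) e^{ik·x} a_k dk + U(x)`; the fourth term is the
adjoint of the third one. -/
def totalForm (v : E d → ℂ) (ω : E d → ℝ) (U : E d → ℝ) (χ Ψ : Total d) : ℂ :=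
  (∫ z, ((‖z.1‖ ^ 2 + fieldEnergy ω z.2 : ℝ) : ℂ) *
      (conj ((χ : Lp ℂ 2 (totalMeasure d)) z) * (Ψ : Lp ℂ 2 (totalMeasure d)) z)
      ∂(totalMeasure d))
    + (∫ z, totalCreation v χ Ψ z ∂((volume : Measure (E d)).prod (totalMeasure d)))
    + conj (∫ z, totalCreation v Ψ χ z ∂((volume : Measure (E d)).prod (totalMeasure d)))
    + ∫ c, potentialForm U (fun p => (χ : Lp ℂ 2 (totalMeasure d)) (p, c))
        (fun p => (Ψ : Lp ℂ 2 (totalMeasure d)) (p, c)) ∂(configMeasure d)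

/-- The operator `H + U(x)` on `L²(ℝ^d) ⊗ Fock`. -/
def hamiltonian (v : E d → ℂ) (ω : E d → ℝ) (U : E d → ℝ) : Set (Total d × Total d) :=
  formGraph (totalDomain ω) (totalForm v ω U)

/-! ### The fibers `H_P` -/

/-- The form domain of `(P - P_f)² + H_f`. -/
def fiberDomain (ω : E d → ℝ) (P : E d) : Set (Fock d) :=
  {Φ | Integrable (fun c => (‖P - fieldMomentum c‖ ^ 2 + fieldEnergy ω c) *
    ‖(Φ : Lp ℂ 2 (configMeasure d)) c‖ ^ 2) (configMeasure d)}

/-- The integrand, as a function of `(k, c)`, of the matrix element between `χ` and `Φ` of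
`∫ v(k) a†_k dk`. -/
def fiberCreation (v : E d → ℂ) (χ Φ : Fock d) (z : E d × Config d) : ℂ :=
  (Real.sqrt (z.2.1 + 1) : ℂ) * v z.1 *
    (conj ((χ : Lp ℂ 2 (configMeasure d)) (cons z.1 z.2)) *
      (Φ : Lp ℂ 2 (configMeasure d)) z.2)

/-- The sesquilinear form of
`(P - P_f)² + H_f + ∫ v(k) a†_k dk + ∫ conj(v(k)) a_k dk`. -/
def fiberForm (v : E d → ℂ) (ω : E d → ℝ) (P : E d) (χ Φ : Fock d) : ℂ :=
  (∫ c, ((‖P - fieldMomentum c‖ ^ 2 + fieldEnergy ω c : ℝ) : ℂ) *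
      (conj ((χ : Lp ℂ 2 (configMeasure d)) c) * (Φ : Lp ℂ 2 (configMeasure d)) c)
      ∂(configMeasure d))
    + (∫ z, fiberCreation v χ Φ z ∂(totalMeasure d))
    + conj (∫ z, fiberCreation v Φ χ z ∂(totalMeasure d))

/-- The operator `H_P` on Fock space. -/
def fiber (v : E d → ℂ) (ω : E d → ℝ) (P : E d) : Set (Fock d × Fock d) :=
  formGraph (fiberDomain ω P) (fiberForm v ω P)

/-- `E(P) = inf spec H_P`. -/
def fiberEnergy (v : E d → ℂ) (ω : E d → ℝ) (P : E d) : ℝ := infSpec (fiber v ω P)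

/-- The formal expressions define self-adjoint operators `H` and `H_P`, and `H` is bounded from
below: on the form domain of `p² + H_f` the interaction is given by convergent integrals, the form
of `H` is bounded from below there, and the operators of the forms are self-adjoint. -/
structure DefinesHamiltonian (v : E d → ℂ) (ω : E d → ℝ) : Prop where
  measurable_v : Measurable v
  measurable_ω : Measurable ω
  integrable : ∀ χ ∈ totalDomain ω, ∀ Ψ ∈ totalDomain ω,
    Integrable (totalCreation v χ Ψ) ((volume : Measure (E d)).prod (totalMeasure d))
  bounded_below : ∃ C : ℝ, ∀ Ψ ∈ totalDomain ω, C * ‖Ψ‖ ^ 2 ≤ (totalForm v ω 0 Ψ Ψ).re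
  selfAdjoint : IsSelfAdjointGraph (hamiltonian v ω 0)
  selfAdjoint_fiber : ∀ P, IsSelfAdjointGraph (fiber v ω P)

/-! ### The two effective masses -/

/-- `M ∈ (0, ∞]` is the dynamic effective mass: `1 / M = 2 lim_{P → 0} (E(P) - E(0)) / |P|²`. -/
def IsDynamicMass (v : E d → ℂ) (ω : E d → ℝ) (M : ℝ≥0∞) : Prop :=
  0 < M ∧ Tendsto (fun P => 2 * ((fiberEnergy v ω P - fiberEnergy v ω 0) / ‖P‖ ^ 2))
    (𝓝[≠] 0) (𝓝 (M⁻¹).toReal)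

/-- `m ∈ [1/2, ∞]` is the static effective mass defined through the potential `V`: the limit of
`λ⁻² inf spec (H + λ² V(λ x) - E(0))` as `λ → 0` exists and is equal to `𝓔(m)`. -/
def IsStaticMass (v : E d → ℂ) (ω : E d → ℝ) (V : E d → ℝ) (m : ℝ≥0∞) : Prop :=
  1 / 2 ≤ m ∧ Tendsto (fun lam : ℝ =>
      (infSpec (hamiltonian v ω fun x => lam ^ 2 * V (lam • x)) - fiberEnergy v ω 0) / lam ^ 2)
    (𝓝[>] 0) (𝓝 (schrodingerEnergy V m))

/-- `Φ` is a normalized ground state of `H_P`, and the only one up to a factor. -/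
def IsUniqueGroundState (v : E d → ℂ) (ω : E d → ℝ) (P : E d) (Φ : Fock d) : Prop :=
  ‖Φ‖ = 1 ∧ (Φ, (fiberEnergy v ω P : ℂ) • Φ) ∈ fiber v ω P ∧
    ∀ Φ' : Fock d, (Φ', (fiberEnergy v ω P : ℂ) • Φ') ∈ fiber v ω P → ∃ c : ℂ, Φ' = c • Φ

end

end Polaron

/-! The total momentum is conserved, so in the variables (total momentum `P`, boson momenta) the
operator `H` is the direct integral of the fibers `H_P` (`IsFiber.integral_fiberForm`). The
potential shifts the particle momentum and leaves the bosons alone, hence it simply shifts `P`. At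
momenta of order `λ` the problem thus reduces to one body with kinetic energy `E(P) - E(0) ≈ P² /
(2M)`, and measuring momenta in units of `λ` extracts the factor `λ²`.

Lower bound (`HasFourier.exists_le_infSpec_hamiltonian`): fiber by fiber `H_P ≥ E(P) ≥ E(0) + P² /
(2M(1 + CP²))`. For fixed boson momenta what remains is a one-body operator, which after scaling has
kinetic energy `p² / (2M(1 + Cλ²p²))`. Its saturation at high momenta does not matter in the limit,
because the form of the potential is bounded (`HasFourier.exists_cutoff_lower_bound`).

Upper bound (`HasFourier.exists_infSpec_hamiltonian_le`): the trial state has fibers `g(P/λ) Φ_P`,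
with `g` almost minimizing `p² / (2M) + V` and `Φ_P` the ground state of `H_P`. By continuity `Φ_P`
is close to `Φ_0` for small `P`, so the potential energy is almost that of `g`. To obtain a finite
sum of product states, `P ↦ Φ_P` is replaced by a function with finitely many values. The cost is
controlled by `IsUniqueGroundState.fiberForm_le`: the energy of `Φ_P` in `H_{P'}` is quadratic in
`P'`, and the variational principle bounds its gradient at `P' = P` by a multiple of `√(E(P) -
E(0))`, which is `O(λ)`; the error is then a small multiple of `λ²`.

Hence the limit is `𝓔(M)`. It determines the mass because `𝓔` is strictly decreasing
(`HasFourier.schrodingerEnergy_lt`): as the Fourier transform of `V` is integrable, a state of low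
momentum hardly feels `V`, so a bound state carries a definite amount of kinetic energy. Finally `M
≥ 1/2`, by testing `H_P` with `Φ_0`.

All estimates are inequalities between quadratic forms. `IsHermitianForm.infSpec_isGreatest`
converts them into statements about spectra, using only that the operator of the form is
self-adjoint; closedness of the form is not needed. -/

namespace Polaron

/-! ### Operators of Hermitian forms and the variational principle. -/

section Operators

variable {K : Type*} [NormedAddCommGroup K] [InnerProductSpace ℂ K]

/-- `q` is a Hermitian sesquilinear form on the subspace `Q`. -/
structure IsHermitianForm (Q : Submodule ℂ K) (q : K → K → ℂ) : Prop where
  conj_symm : ∀ χ Ψ, conj (q Ψ χ) = q χ Ψ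
  add_right : ∀ χ ∈ Q, ∀ Ψ ∈ Q, ∀ Ψ' ∈ Q, q χ (Ψ + Ψ') = q χ Ψ + q χ Ψ'
  smul_right : ∀ χ ∈ Q, ∀ Ψ ∈ Q, ∀ c : ℂ, q χ (c • Ψ) = c * q χ Ψ

/-- The relation `G` contains its adjoint relation. -/
def ContainsAdjoint (G : Set (K × K)) : Prop :=
  ∀ y w : K, (∀ z ∈ G, inner ℂ z.2 y = inner ℂ z.1 w) → (y, w) ∈ G

namespace IsHermitianForm

variable {Q : Submodule ℂ K} {q : K → K → ℂ} (hq : IsHermitianForm Q q)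
include hq

theorem inner_eq {z y : K × K} (hz : z ∈ formGraph (Q : Set K) q)
    (hy : y ∈ formGraph (Q : Set K) q) : inner ℂ z.2 y.1 = inner ℂ z.1 y.2 := by
  rw [← hy.2 z.1 hz.1, ← inner_conj_symm, ← hz.2 y.1 hy.1, hq.conj_symm]

/-- The graph of the operator of a Hermitian form, as a subspace. -/
def graphSubmodule : Submodule ℂ (K × K) where
  carrier := formGraph (Q : Set K) q
  zero_mem' := ⟨Q.zero_mem, fun χ hχ => by
    have := hq.smul_right χ hχ 0 Q.zero_mem 0
    simpa using this⟩
  add_mem' := fun {a b} ha hb => ⟨Q.add_mem ha.1 hb.1, fun χ hχ => by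
    rw [Prod.fst_add, Prod.snd_add, hq.add_right χ hχ _ ha.1 _ hb.1, ha.2 χ hχ, hb.2 χ hχ,
      inner_add_right]⟩
  smul_mem' := fun c a ha => ⟨Q.smul_mem c ha.1, fun χ hχ => by
    rw [Prod.smul_fst, Prod.smul_snd, hq.smul_right χ hχ _ ha.1, ha.2 χ hχ, inner_smul_right]⟩

/-- Together with symmetry, containing the adjoint means being equal to it, and an adjoint relation
is an intersection of closed conditions. -/
theorem isClosed_graph (hG : ContainsAdjoint (formGraph (Q : Set K) q)) :
    IsClosed (formGraph (Q : Set K) q) := by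
  have : formGraph (Q : Set K) q =
      ⋂ z ∈ formGraph (Q : Set K) q, {y : K × K | inner ℂ z.2 y.1 = inner ℂ z.1 y.2} := by
    ext y
    simp only [Set.mem_iInter, Set.mem_ofPred_eq]
    exact ⟨fun hy z hz => hq.inner_eq hz hy, fun h => hG y.1 y.2 h⟩
  rw [this]
  refine isClosed_biInter fun z _ => isClosed_eq ?_ ?_ <;> fun_prop

/-- With `T` the operator of the form, the form bound gives `(b - t) ‖x‖ ≤ ‖(T - t) x‖`, so `T - t`
is injective with closed range. A vector orthogonal to the range belongs to the kernel of the
adjoint of `T - t`, hence to that of `T - t`, and vanishes. The map `T - t` is considered on the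
graph of `T`, a complete space on which it is continuous. -/
theorem mem_resolventSet [CompleteSpace K] (hG : ContainsAdjoint (formGraph (Q : Set K) q))
    {b t : ℝ} (hb : ∀ Ψ ∈ Q, b * ‖Ψ‖ ^ 2 ≤ (q Ψ Ψ).re) (ht : t < b) :
    (t : ℂ) ∈ resolventSet (formGraph (Q : Set K) q) := by
  set S := hq.graphSubmodule with hS
  have hSm : ∀ z, z ∈ S ↔ z ∈ formGraph (Q : Set K) q := fun z => Iff.rfl
  have hSc : IsClosed (S : Set (K × K)) := hq.isClosed_graph hG
  have : CompleteSpace S := hSc.completeSpace_coe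
  let L : S →L[ℂ] K :=
    (ContinuousLinearMap.snd ℂ K K - (t : ℂ) • ContinuousLinearMap.fst ℂ K K).comp S.subtypeL
  have hL : ∀ z : S, L z = z.1.2 - (t : ℂ) • z.1.1 := fun z => rfl
  have hlow : ∀ z : S, (b - t) * ‖z.1.1‖ ≤ ‖L z‖ := by
    intro z
    have h1 : (inner ℂ z.1.1 (L z)).re = (q z.1.1 z.1.1).re - t * ‖z.1.1‖ ^ 2 := by
      rw [hL, inner_sub_right, inner_smul_right, ← z.2.2 z.1.1 z.2.1, inner_self_eq_norm_sq_to_K]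
      simp [← Complex.ofReal_pow]
    have h2 := hb z.1.1 z.2.1
    have h3 : (inner ℂ z.1.1 (L z)).re ≤ ‖z.1.1‖ * ‖L z‖ :=
      (Complex.re_le_norm _).trans (norm_inner_le_norm _ _)
    rcases (norm_nonneg z.1.1).eq_or_lt with h | h
    · rw [← h]; simp
    · refine le_of_mul_le_mul_left ?_ h
      nlinarith
  have hpos : 0 < b - t := by linarith
  have hanti : AntilipschitzWith (Real.toNNReal (1 + (1 + |t|) / (b - t))) L := by
    refine ContinuousLinearMap.antilipschitz_of_bound _ fun z => ?_
    have hc : 0 ≤ 1 + (1 + |t|) / (b - t) := by positivity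
    rw [Real.coe_toNNReal _ hc]
    have h1 : ‖z.1.1‖ ≤ ‖L z‖ / (b - t) := by
      rw [le_div_iff₀ hpos, mul_comm]; exact hlow z
    have h2 : ‖z.1.2‖ ≤ ‖L z‖ + |t| * ‖z.1.1‖ := by
      have : z.1.2 = L z + (t : ℂ) • z.1.1 := by rw [hL]; abel
      calc ‖z.1.2‖ = ‖L z + (t : ℂ) • z.1.1‖ := by rw [← this]
        _ ≤ _ := (norm_add_le _ _).trans (by rw [norm_smul]; simp)
    have h3 : |t| * ‖z.1.1‖ ≤ |t| * (‖L z‖ / (b - t)) := by gcongr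
    have h4 : 0 ≤ |t| * (‖L z‖ / (b - t)) := by positivity
    have h5 : 0 ≤ ‖L z‖ / (b - t) := by positivity
    have h6 : (1 + (1 + |t|) / (b - t)) * ‖L z‖ =
      ‖L z‖ + ‖L z‖ / (b - t) + |t| * (‖L z‖ / (b - t)) := by ring
    rw [h6]
    have : ‖z‖ = max ‖z.1.1‖ ‖z.1.2‖ := rfl
    rw [this]
    refine max_le ?_ ?_ <;> nlinarith [norm_nonneg (L z)]
  have hker : LinearMap.ker (L : S →ₗ[ℂ] K) = ⊥ := LinearMap.ker_eq_bot.2 hanti.injective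
  have hcl : IsClosed ((LinearMap.range (L : S →ₗ[ℂ] K) : Submodule ℂ K) : Set K) := by
    exact hanti.isClosed_range L.uniformContinuous
  have hran : LinearMap.range (L : S →ₗ[ℂ] K) = ⊤ := by
    have : CompleteSpace (LinearMap.range (L : S →ₗ[ℂ] K) : Submodule ℂ K) :=
      hcl.completeSpace_coe
    rw [← Submodule.orthogonal_eq_bot_iff, Submodule.eq_bot_iff]
    intro y hy
    rw [Submodule.mem_orthogonal] at hy
    have hyG : (y, (t : ℂ) • y) ∈ formGraph (Q : Set K) q := by
      refine hG _ _ fun z hz => ?_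
      have := hy (L ⟨z, hz⟩) ⟨⟨z, hz⟩, rfl⟩
      rw [hL, inner_sub_left, inner_smul_left, sub_eq_zero] at this
      rw [this, inner_smul_right]; simp
    have h0 := hlow ⟨_, hyG⟩
    rw [hL] at h0
    simp only [sub_self, norm_zero] at h0
    have : ‖y‖ ≤ 0 := by nlinarith
    simpa using this
  let e := ContinuousLinearEquiv.ofBijective L hker hran
  refine ⟨(ContinuousLinearMap.fst ℂ K K).comp (S.subtypeL.comp (e.symm : K →L[ℂ] S)), ?_⟩
  intro x y
  have hx : ((ContinuousLinearMap.fst ℂ K K).comp (S.subtypeL.comp (e.symm : K →L[ℂ] S))) y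
      = (e.symm y).1.1 := rfl
  rw [hx]
  constructor
  · intro h
    have : e ⟨_, h⟩ = y := by
      change L ⟨_, h⟩ = y
      rw [hL]; simp
    rw [← this]; simp
  · rintro rfl
    have h := (e.symm y).2
    have h2 : L (e.symm y) = y := e.apply_symm_apply y
    rw [hL] at h2
    have h3 : y + (t : ℂ) • (e.symm y).1.1 = (e.symm y).1.2 := by
      nth_rewrite 1 [← h2]; simp
    rw [h3]; exact h

theorem add_left {χ χ' Ψ : K} (h1 : χ ∈ Q) (h2 : χ' ∈ Q) (h3 : Ψ ∈ Q) :
    q (χ + χ') Ψ = q χ Ψ + q χ' Ψ := by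
  rw [← hq.conj_symm, hq.add_right _ h3 _ h1 _ h2, map_add, hq.conj_symm, hq.conj_symm]

theorem smul_left {χ Ψ : K} (h1 : χ ∈ Q) (h3 : Ψ ∈ Q) (c : ℂ) :
    q (c • χ) Ψ = conj c * q χ Ψ := by
  rw [← hq.conj_symm, hq.smul_right _ h3 _ h1, map_mul, hq.conj_symm]

theorem re_self_add_smul {χ Ψ : K} (h1 : χ ∈ Q) (h2 : Ψ ∈ Q) (t : ℝ) :
    (q (χ + (t : ℂ) • Ψ) (χ + (t : ℂ) • Ψ)).re =
      (q χ χ).re + 2 * t * (q χ Ψ).re + t ^ 2 * (q Ψ Ψ).re := by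
  have h3 := Q.smul_mem (t : ℂ) h2
  rw [hq.add_left h1 h3 (Q.add_mem h1 h3), hq.add_right _ h1 _ h1 _ h3,
    hq.add_right _ h3 _ h1 _ h3, hq.smul_left h2 h1, hq.smul_left h2 h3, hq.smul_right _ h1 _ h2,
    hq.smul_right _ h2 _ h2, ← hq.conj_symm Ψ χ]
  simp [Complex.mul_re]
  ring

/-- The variational principle: for a Hermitian form that is bounded from below and whose operator
is self-adjoint, the bottom of the spectrum is the largest lower bound of the form. -/
theorem infSpec_isGreatest [CompleteSpace K] (hG : ContainsAdjoint (formGraph (Q : Set K) q))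
    (hb : ∃ b : ℝ, ∀ Ψ ∈ Q, b * ‖Ψ‖ ^ 2 ≤ (q Ψ Ψ).re) (hne : ∃ Ψ ∈ Q, Ψ ≠ 0) :
    IsGreatest {b : ℝ | ∀ Ψ ∈ Q, b * ‖Ψ‖ ^ 2 ≤ (q Ψ Ψ).re}
      (infSpec (formGraph (Q : Set K) q)) := by
  set B : Set ℝ := {b : ℝ | ∀ Ψ ∈ Q, b * ‖Ψ‖ ^ 2 ≤ (q Ψ Ψ).re} with hB
  obtain ⟨Ψ₀, hΨ₀, hne⟩ := hne
  have hn : 0 < ‖Ψ₀‖ ^ 2 := by positivity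
  have hbdd : BddAbove B := ⟨(q Ψ₀ Ψ₀).re / ‖Ψ₀‖ ^ 2, fun b hb => by
    rw [le_div_iff₀ hn]; exact hb Ψ₀ hΨ₀⟩
  have hBne : B.Nonempty := hb
  have hclosed : IsClosed B := by
    have : B = ⋂ Ψ ∈ Q, {b : ℝ | b * ‖Ψ‖ ^ 2 ≤ (q Ψ Ψ).re} := by
      ext b; simp [hB]
    rw [this]
    refine isClosed_biInter fun Ψ _ => isClosed_le ?_ ?_ <;> fun_prop
  have hsup : sSup B ∈ B := hclosed.csSup_mem hBne hbdd
  suffices h : infSpec (formGraph (Q : Set K) q) = sSup B by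
    rw [h]; exact ⟨hsup, fun b hb => le_csSup hbdd hb⟩
  refine IsLeast.csInf_eq ⟨?_, ?_⟩
  · rintro ⟨R, hR⟩
    -- Suppose that `R` inverts `T - s` at the best lower bound `s`. Nonnegativity of the form of `T
    -- - s` at `χ - ρ⁻¹ R χ` reads `q_s(χ) ≥ 2 ρ⁻¹ ‖χ‖² - ρ⁻² ⟨Rχ, χ⟩`. With `ρ ≥ ‖R‖` the right
    -- side is at least `ρ⁻¹ ‖χ‖²`, so `s + ρ⁻¹` would be a better lower bound. The summand `1` only
    -- ensures `ρ > 0`.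
    have hkey : sSup B + 1 / (‖R‖ + 1) ∈ B := by
      intro χ hχ
      have hRχ := (hR (R χ) χ).2 rfl
      have h1 : q χ (R χ) = (‖χ‖ ^ 2 : ℝ) + ((sSup B : ℝ) : ℂ) * inner ℂ χ (R χ) := by
        have := hRχ.2 χ hχ
        rw [this, inner_add_right, inner_smul_right, inner_self_eq_norm_sq_to_K]; simp
      have h2 : q (R χ) (R χ) = inner ℂ (R χ) χ + ((sSup B : ℝ) : ℂ) * ((‖R χ‖ ^ 2 : ℝ) : ℂ) := by
        have := hRχ.2 (R χ) hRχ.1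
        rw [this, inner_add_right, inner_smul_right, inner_self_eq_norm_sq_to_K]; simp
      set s := sSup B
      set x := ‖χ‖ ^ 2 with hx
      set ρ := ‖R‖ + 1 with hρ
      have hρ0 : 0 < ρ := by positivity
      have hip : (inner ℂ (R χ) χ).re = (inner ℂ χ (R χ)).re := by
        rw [← inner_conj_symm, Complex.conj_re]
      have hip2 : (inner ℂ χ (R χ)).re ≤ ρ * x := by
        refine (Complex.re_le_norm _).trans ((norm_inner_le_norm _ _).trans ?_)
        have := R.le_opNorm χ
        have h0 := norm_nonneg χ
        have : ‖χ‖ * ‖R χ‖ ≤ ‖χ‖ * (‖R‖ * ‖χ‖) := by gcongr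
        nlinarith [norm_nonneg R]
      have hq1 := congrArg Complex.re h1
      have hq2 := congrArg Complex.re h2
      have hexp := hq.re_self_add_smul hχ hRχ.1 (-1 / ρ)
      have hmem := hsup _ (Q.add_mem hχ (Q.smul_mem ((-1 / ρ : ℝ) : ℂ) hRχ.1))
      have hnrm : ‖χ + ((-1 / ρ : ℝ) : ℂ) • R χ‖ ^ 2 = x + 2 * (-1 / ρ) * (inner ℂ χ (R χ)).re
          + (-1 / ρ) ^ 2 * ‖R χ‖ ^ 2 := by
        have h8 : ‖((-1 / ρ : ℝ) : ℂ)‖ ^ 2 = (-1 / ρ) ^ 2 := by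
          rw [Complex.norm_real, Real.norm_eq_abs, sq_abs]
        rw [@norm_add_sq ℂ, inner_smul_right, norm_smul, mul_pow, h8, ← hx]
        simp [mul_assoc]
      simp only [Complex.add_re, Complex.mul_re, Complex.ofReal_re, Complex.ofReal_im, zero_mul,
        sub_zero] at hq1 hq2
      rw [hnrm, hexp, hq1, hq2, hip] at hmem
      have h4 : (-1 / ρ) ^ 2 * (inner ℂ χ (R χ)).re ≤ (-1 / ρ) ^ 2 * (ρ * x) := by gcongr
      have h5 : (-1 / ρ) ^ 2 * (ρ * x) = 1 / ρ * x := by field_simp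
      have h6 : (s + 1 / ρ) * x = s * x + 1 / ρ * x := by ring
      have h7 : -1 / ρ = - (1 / ρ) := by ring
      rw [h6]
      rw [h5] at h4
      rw [h7] at hmem h4
      generalize 1 / ρ = r at *
      linarith
    have := le_csSup hbdd hkey
    have : 0 < 1 / (‖R‖ + 1) := by positivity
    linarith
  · intro t ht
    by_contra! hlt
    exact ht (hq.mem_resolventSet hG hsup hlt)

end IsHermitianForm

/-- If the operator of a Hermitian form is onto after adding `1`, it contains its adjoint. -/
theorem IsHermitianForm.containsAdjoint_of_surjective {Q : Submodule ℂ K} {q : K → K → ℂ}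
    (hq : IsHermitianForm Q q) (hs : ∀ y, ∃ x, (x, y - x) ∈ formGraph (Q : Set K) q) :
    ContainsAdjoint (formGraph (Q : Set K) q) := by
  intro y w h
  -- Here `(T + 1) x = w + y` and `(T + 1) a = y - x`. Pairing `a` with `y` by the adjoint relation
  -- and with `x` by symmetry gives `‖y - x‖² = 0`.
  obtain ⟨x, hx⟩ := hs (w + y)
  obtain ⟨a, ha⟩ := hs (y - x)
  have h1 := h _ ha
  have h2 := hq.inner_eq ha hx
  simp only [inner_sub_left, inner_sub_right, inner_add_right] at h1 h2
  have h3 : inner ℂ (y - x) (y - x) = (0 : ℂ) := by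
    simp only [inner_sub_left, inner_sub_right]
    linear_combination h1 - h2
  have h4 : y = x := by rwa [inner_self_eq_zero, sub_eq_zero] at h3
  subst h4
  simpa using hx

/-- A bounded Hermitian form `b` is given by a bounded symmetric operator. -/
theorem exists_operator_of_bounded [CompleteSpace K] {b : K → K → ℂ} {N : ℝ}
    (hb : IsHermitianForm (⊤ : Submodule ℂ K) b) (hN : ∀ χ Ψ, ‖b χ Ψ‖ ≤ N * ‖χ‖ * ‖Ψ‖) :
    ∃ B : K → K, (∀ χ Ψ, b χ Ψ = inner ℂ χ (B Ψ)) ∧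
      ∀ χ Ψ, inner ℂ (B χ) Ψ = inner ℂ χ (B Ψ) := by
  have key : ∀ χ : K, ∃ w : K, ∀ Ψ, b χ Ψ = inner ℂ w Ψ := by
    intro χ
    let l : K →L[ℂ] ℂ := LinearMap.mkContinuous
      { toFun := b χ
        map_add' := fun x y => hb.add_right _ trivial _ trivial _ trivial
        map_smul' := fun c x => hb.smul_right _ trivial _ trivial c } (N * ‖χ‖) (hN χ)
    refine ⟨(InnerProductSpace.toDual ℂ K).symm l, fun Ψ => ?_⟩
    rw [InnerProductSpace.toDual_symm_apply]; rfl
  choose B hB using key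
  have h1 : ∀ χ Ψ, b χ Ψ = inner ℂ χ (B Ψ) := fun χ Ψ => by
    rw [← hb.conj_symm, hB, inner_conj_symm]
  exact ⟨B, h1, fun χ Ψ => by rw [← hB, h1]⟩

/-- If a bounded symmetric operator `B` represents `b`, adding `b` replaces `T` by `T + B` on the
same domain, and the adjoint of `T + B` is `T* + B`. -/
theorem ContainsAdjoint.add_bounded [CompleteSpace K] {Q : Set K} {q b : K → K → ℂ} {N : ℝ}
    (hG : ContainsAdjoint (formGraph Q q)) (hb : IsHermitianForm (⊤ : Submodule ℂ K) b)
    (hN : ∀ χ Ψ, ‖b χ Ψ‖ ≤ N * ‖χ‖ * ‖Ψ‖) :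
    ContainsAdjoint (formGraph Q fun χ Ψ => q χ Ψ + b χ Ψ) := by
  obtain ⟨B, hB, hsymm⟩ := exists_operator_of_bounded hb hN
  have hiff : ∀ x w, (x, w) ∈ formGraph Q (fun χ Ψ => q χ Ψ + b χ Ψ) ↔
      (x, w - B x) ∈ formGraph Q q := by
    intro x w
    simp only [formGraph, Set.mem_ofPred_eq, hB, inner_sub_right, eq_sub_iff_add_eq]
  intro y w h
  rw [hiff]
  refine hG _ _ fun z hz => ?_
  have := h (z.1, z.2 + B z.1) ((hiff _ _).2 (by simpa using hz))
  simp only [inner_add_left, hsymm] at this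
  rw [inner_sub_right, ← this]; ring

theorem IsHermitianForm.mono {Q Q' : Submodule ℂ K} {q : K → K → ℂ} (hq : IsHermitianForm Q' q)
    (h : Q ≤ Q') : IsHermitianForm Q q where
  conj_symm := hq.conj_symm
  add_right χ h1 Ψ h2 Ψ' h3 := hq.add_right χ (h h1) Ψ (h h2) Ψ' (h h3)
  smul_right χ h1 Ψ h2 c := hq.smul_right χ (h h1) Ψ (h h2) c

theorem IsHermitianForm.add {Q : Submodule ℂ K} {q b : K → K → ℂ} (hq : IsHermitianForm Q q)
    (hb : IsHermitianForm Q b) : IsHermitianForm Q fun χ Ψ => q χ Ψ + b χ Ψ where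
  conj_symm χ Ψ := by rw [map_add, hq.conj_symm, hb.conj_symm]
  add_right χ h1 Ψ h2 Ψ' h3 := by
    simp only [hq.add_right χ h1 Ψ h2 Ψ' h3, hb.add_right χ h1 Ψ h2 Ψ' h3]; ring
  smul_right χ h1 Ψ h2 c := by
    simp only [hq.smul_right χ h1 Ψ h2 c, hb.smul_right χ h1 Ψ h2 c]; ring

/-- A Hermitian form, restricted to a subspace. -/
theorem IsHermitianForm.restrict {Q : Submodule ℂ K} {q : K → K → ℂ} (hq : IsHermitianForm Q q)
    (S : Submodule ℂ K) :
    IsHermitianForm (Q.comap S.subtype) fun χ Ψ : S => q (χ : K) (Ψ : K) where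
  conj_symm _ _ := hq.conj_symm _ _
  add_right _ h1 _ h2 _ h3 := hq.add_right _ h1 _ h2 _ h3
  smul_right _ h1 _ h2 c := hq.smul_right _ h1 _ h2 c

theorem IsSelfAdjointGraph.containsAdjoint [CompleteSpace K] {G : Set (K × K)}
    (h : IsSelfAdjointGraph G) : ContainsAdjoint G := by
  obtain ⟨A, hA, rfl⟩ := h
  intro y w hyw
  have hd := hA.dense_domain
  have hy : y ∈ A.adjoint.domain := by
    refine LinearPMap.mem_adjoint_domain_of_exists y ⟨w, fun x => ?_⟩
    have := hyw (x, A x) (A.mem_graph x)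
    rw [← inner_conj_symm, ← this, inner_conj_symm]
  have hval : A.adjoint ⟨y, hy⟩ = w := by
    refine LinearPMap.adjoint_apply_eq hd _ fun x => ?_
    have := hyw (x, A x) (A.mem_graph x)
    rw [← inner_conj_symm, ← this, inner_conj_symm]
  have hgr : (y, w) ∈ A.adjoint.graph := by
    rw [← hval]; exact A.adjoint.mem_graph ⟨y, hy⟩
  rw [LinearPMap.isSelfAdjoint_def.1 hA] at hgr
  exact hgr

end Operators

/-! ### Correlations with a family of measure preserving maps -/

section Shift

variable {d : ℕ} {X : Type*} [MeasurableSpace X] {μ : Measure X}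

/-- A jointly measurable family of measure preserving maps, indexed by `ℝ^d`. -/
structure IsShift (T : E d → X → X) (μ : Measure X) : Prop where
  measurable : Measurable (Function.uncurry T)
  preserving : ∀ ξ, MeasurePreserving (T ξ) μ μ

/-- The form `∫ W(ξ) ⟨f, g ∘ T_ξ⟩ dξ`. -/
noncomputable def shiftForm (W : E d → ℂ) (T : E d → X → X) (μ : Measure X) (f g : X → ℂ) : ℂ :=
  ∫ ξ, W ξ * ∫ x, conj (f x) * g (T ξ x) ∂μ

variable {W : E d → ℂ} {T : E d → X → X}

theorem shiftForm_congr (hT : IsShift T μ) {f f' g g' : X → ℂ} (hf : f =ᵐ[μ] f')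
    (hg : g =ᵐ[μ] g') : shiftForm W T μ f g = shiftForm W T μ f' g' := by
  unfold shiftForm
  congr 1; funext ξ; congr 1
  refine integral_congr_ae ?_
  filter_upwards [hf, (hT.preserving ξ).quasiMeasurePreserving.ae hg] with x h1 h2
  rw [h1, h2]

/-- The skew product `(ξ, x) ↦ (ξ, T_ξ x)` preserves the product measure, so null sets pull back to
null sets and `g` need only be known almost everywhere. -/
theorem IsShift.aestronglyMeasurable [SFinite μ] (hT : IsShift T μ) {g : X → ℂ}
    (hg : AEStronglyMeasurable g μ) :
    AEStronglyMeasurable (fun z : E d × X => g (T z.1 z.2)) (volume.prod μ) := by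
  have h1 : MeasurePreserving (fun z : E d × X => (z.1, T z.1 z.2))
      ((volume : Measure (E d)).prod μ) (volume.prod μ) :=
    (MeasurePreserving.id _).skew_product hT.measurable
      (Eventually.of_forall fun ξ => (hT.preserving ξ).map_eq)
  have h2 := Measure.quasiMeasurePreserving_snd.comp h1.quasiMeasurePreserving
  exact hg.comp_quasiMeasurePreserving h2

theorem integrable_conj_mul {f g : X → ℂ} (hf : MemLp f 2 μ) (hg : MemLp g 2 μ) :
    Integrable (fun x => conj (f x) * g x) μ := by
  have h := hf.star.integrable_mul hg
  exact h

theorem inner_eq_integral (f g : Lp ℂ 2 μ) : inner ℂ f g = ∫ x, conj (f x) * g x ∂μ := by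
  rw [L2.inner_def]
  simp [mul_comm]

theorem norm_sq_eq_integral (f : Lp ℂ 2 μ) : ‖f‖ ^ 2 = ∫ x, ‖f x‖ ^ 2 ∂μ := by
  have := inner_self_eq_norm_sq_to_K (𝕜 := ℂ) f
  rw [inner_eq_integral] at this
  have h2 : ∀ x, conj (f x) * f x = ((‖f x‖ ^ 2 : ℝ) : ℂ) := fun x => by
    rw [mul_comm, Complex.mul_conj, Complex.normSq_eq_norm_sq]
  simp only [h2] at this
  rw [integral_complex_ofReal] at this
  have h3 := congrArg Complex.re this
  simp [← Complex.ofReal_pow] at h3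
  exact h3.symm

theorem integrable_norm_sq (f : Lp ℂ 2 μ) : Integrable (fun x => ‖f x‖ ^ 2) μ :=
  (memLp_two_iff_integrable_sq_norm (Lp.aestronglyMeasurable f)).1 (Lp.memLp f)

theorem integral_shift_eq_inner (hT : IsShift T μ) (f g : Lp ℂ 2 μ) (ξ : E d) :
    ∫ x, conj (f x) * g (T ξ x) ∂μ =
      inner ℂ f (Lp.compMeasurePreservingₗᵢ ℂ (T ξ) (hT.preserving ξ) g) := by
  rw [inner_eq_integral]
  refine integral_congr_ae ?_
  filter_upwards [Lp.coeFn_compMeasurePreserving g (hT.preserving ξ)] with x hx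
  have : (Lp.compMeasurePreservingₗᵢ ℂ (T ξ) (hT.preserving ξ) g : X → ℂ) x = g (T ξ x) := hx
  rw [this]

theorem norm_integral_shift_le (hT : IsShift T μ) (f g : Lp ℂ 2 μ) (ξ : E d) :
    ‖∫ x, conj (f x) * g (T ξ x) ∂μ‖ ≤ ‖f‖ * ‖g‖ := by
  rw [integral_shift_eq_inner hT]
  exact (norm_inner_le_norm _ _).trans (by rw [LinearIsometry.norm_map])

/-- By `2|ab| ≤ |a|² + |b|²` and invariance of the measure, the inner integral of the absolute value
is at most `|W(ξ)| (‖f‖² + ‖g‖²)`. This licenses every use of Fubini for the potential. -/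
theorem integrable_shift_prod [SFinite μ] (hT : IsShift T μ) (hW : Integrable W) (f g : Lp ℂ 2 μ) :
    Integrable (fun z : E d × X => W z.1 * (conj (f z.2) * g (T z.1 z.2))) (volume.prod μ) := by
  have hsm : AEStronglyMeasurable (fun z : E d × X => W z.1 * (conj (f z.2) * g (T z.1 z.2)))
      (volume.prod μ) := by
    refine hW.1.comp_fst.mul (AEStronglyMeasurable.mul ?_ (hT.aestronglyMeasurable
      (Lp.aestronglyMeasurable g)))
    exact (Complex.continuous_conj.comp_aestronglyMeasurable (Lp.aestronglyMeasurable f)).comp_snd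
  rw [integrable_prod_iff hsm]
  have hg : ∀ ξ, MemLp (fun x => g (T ξ x)) 2 μ := fun ξ =>
    (Lp.memLp g).comp_measurePreserving (hT.preserving ξ)
  refine ⟨Eventually.of_forall fun ξ => (integrable_conj_mul (Lp.memLp f) (hg ξ)).const_mul (W ξ), ?_⟩
  refine Integrable.mono' (hW.norm.mul_const (‖f‖ ^ 2 + ‖g‖ ^ 2)) hsm.norm.integral_prod_right' ?_
  refine Eventually.of_forall fun ξ => ?_
  simp only [norm_mul, RCLike.norm_conj]
  rw [integral_const_mul, norm_mul, norm_norm]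
  gcongr
  have hg2 := (memLp_two_iff_integrable_sq_norm (hg ξ).1).1 (hg ξ)
  have hgi : ∫ x, ‖g (T ξ x)‖ ^ 2 ∂μ = ‖g‖ ^ 2 := by
    rw [← LinearIsometry.norm_map (Lp.compMeasurePreservingₗᵢ ℂ (T ξ) (hT.preserving ξ)) g,
      norm_sq_eq_integral]
    refine integral_congr_ae ?_
    filter_upwards [Lp.coeFn_compMeasurePreserving g (hT.preserving ξ)] with x hx
    have : (Lp.compMeasurePreservingₗᵢ ℂ (T ξ) (hT.preserving ξ) g : X → ℂ) x = g (T ξ x) := hx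
    rw [this]
  rw [Real.norm_of_nonneg (integral_nonneg fun x => by positivity), norm_sq_eq_integral f, ← hgi,
    ← integral_add (integrable_norm_sq f) hg2]
  refine integral_mono_of_nonneg (Eventually.of_forall fun x => by positivity)
    ((integrable_norm_sq f).add hg2) (Eventually.of_forall fun x => ?_)
  simp only
  nlinarith [sq_nonneg (‖f x‖ - ‖g (T ξ x)‖), sq_nonneg (‖f x‖), sq_nonneg ‖g (T ξ x)‖]

theorem integrable_shift [SFinite μ] (hT : IsShift T μ) (hW : Integrable W) (f g : Lp ℂ 2 μ) :
    Integrable fun ξ => W ξ * ∫ x, conj (f x) * g (T ξ x) ∂μ := by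
  have := (integrable_shift_prod hT hW f g).integral_prod_left
  simpa only [integral_const_mul] using this

theorem norm_shiftForm_le (hT : IsShift T μ) (hW : Integrable W) (f g : Lp ℂ 2 μ) :
    ‖shiftForm W T μ f g‖ ≤ (∫ ξ, ‖W ξ‖) * ‖f‖ * ‖g‖ := by
  unfold shiftForm
  refine (norm_integral_le_integral_norm _).trans ?_
  rw [mul_assoc, ← integral_mul_const]
  refine integral_mono_of_nonneg (Eventually.of_forall fun x => by positivity)
    (hW.norm.mul_const _) (Eventually.of_forall fun ξ => ?_)
  simp only [norm_mul]
  gcongr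
  exact norm_integral_shift_le hT f g ξ

theorem shiftForm_add_right [SFinite μ] (hT : IsShift T μ) (hW : Integrable W) (f g g' : Lp ℂ 2 μ) :
    shiftForm W T μ f ⇑(g + g') = shiftForm W T μ f g + shiftForm W T μ f g' := by
  unfold shiftForm
  rw [← integral_add (integrable_shift hT hW f g) (integrable_shift hT hW f g')]
  congr 1; funext ξ
  rw [integral_shift_eq_inner hT, integral_shift_eq_inner hT, integral_shift_eq_inner hT, map_add,
    inner_add_right, mul_add]

theorem shiftForm_smul_right (hT : IsShift T μ) (f g : Lp ℂ 2 μ) (c : ℂ) :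
    shiftForm W T μ f ⇑(c • g) = c * shiftForm W T μ f g := by
  unfold shiftForm
  rw [← integral_const_mul]
  congr 1; funext ξ
  rw [integral_shift_eq_inner hT, integral_shift_eq_inner hT, map_smul, inner_smul_right]
  ring

end Shift

/-! ### The form of a potential in momentum space -/

section Potential

variable {d : ℕ}

/-- Translation by `a` on the momentum space. -/
noncomputable def translate (a : E d) :
    Lp ℂ 2 (volume : Measure (E d)) →ₗᵢ[ℂ] Lp ℂ 2 (volume : Measure (E d)) :=
  Lp.compMeasurePreservingₗᵢ ℂ (fun p => p - a) (measurePreserving_sub_right volume a)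

theorem coeFn_translate (a : E d) (g : Lp ℂ 2 (volume : Measure (E d))) :
    translate a g =ᵐ[volume] fun p => g (p - a) :=
  Lp.coeFn_compMeasurePreserving g (measurePreserving_sub_right volume a)

/-- Multiplication by the phase `e^{2πi a·y}`. -/
noncomputable def modulate (a : E d) :
    Lp ℂ 2 (volume : Measure (E d)) →L[ℂ] Lp ℂ 2 (volume : Measure (E d)) :=
  (ContinuousLinearMap.mul ℂ ℂ).holderL volume ∞ 2 2
    ((memLp_top_of_bound (f := fun y : E d => ((Real.fourierChar (inner ℝ a y) : Circle) : ℂ)) (by fun_prop) 1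
      (Eventually.of_forall fun y => (Circle.norm_coe _).le)).toLp _)

theorem coeFn_modulate (a : E d) (g : Lp ℂ 2 (volume : Measure (E d))) :
    modulate a g =ᵐ[volume] fun y => ((Real.fourierChar (inner ℝ a y) : Circle) : ℂ) * g y := by
  have h1 := (ContinuousLinearMap.mul ℂ ℂ).coeFn_holder (r := 2) (μ := volume)
    ((memLp_top_of_bound (f := fun y : E d => ((Real.fourierChar (inner ℝ a y) : Circle) : ℂ)) (by fun_prop) 1
      (Eventually.of_forall fun y => (Circle.norm_coe _).le)).toLp _) g
  filter_upwards [h1, MemLp.coeFn_toLp (memLp_top_of_bound (μ := volume)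
    (f := fun y : E d => ((Real.fourierChar (inner ℝ a y) : Circle) : ℂ)) (by fun_prop) 1
      (Eventually.of_forall fun y => (Circle.norm_coe _).le))] with y h2 h3
  rw [h3] at h2
  exact h2

-- Both sides are continuous in `g`, so it suffices to compare them on Schwartz functions, where the
-- Fourier integral converges and a change of variables applies.
open scoped SchwartzMap in
theorem fourierInv_translate (a : E d) (g : Lp ℂ 2 (volume : Measure (E d))) :
    𝓕⁻ (translate a g) = modulate a (𝓕⁻ g) := by
  have hd : DenseRange (SchwartzMap.toLpCLM ℝ ℂ 2 (volume : Measure (E d))) :=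
    SchwartzMap.denseRange_toLpCLM ENNReal.ofNat_ne_top
  have hF : Continuous fun g : Lp ℂ 2 (volume : Measure (E d)) => 𝓕⁻ g :=
    ContinuousFourierInv.continuous_fourierInv
  refine congrFun (hd.equalizer (g := fun g => 𝓕⁻ (translate a g))
    (h := fun g => modulate a (𝓕⁻ g)) (hF.comp (translate a).continuous)
    ((modulate a).continuous.comp hF) ?_) g
  funext φ
  have hφ : SchwartzMap.toLpCLM ℝ ℂ 2 (volume : Measure (E d)) φ = φ.toLp 2 volume := rfl
  simp only [Function.comp_apply, hφ]
  have hg : Function.HasTemperateGrowth (fun p : E d => p - a) := by fun_prop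
  have ha : AntilipschitzWith 1 (fun p : E d => p - a) :=
    (IsometryEquiv.subRight a).isometry.antilipschitz
  set ψ : 𝓢(E d, ℂ) := SchwartzMap.compCLMOfAntilipschitz ℂ hg ha φ with hψ
  have hψφ : ∀ p, ψ p = φ (p - a) := fun p => rfl
  have h1 : translate a (φ.toLp 2 volume) = ψ.toLp 2 volume := by
    refine Lp.ext ?_
    filter_upwards [coeFn_translate a (φ.toLp 2 volume), ψ.coeFn_toLp 2 volume,
      (measurePreserving_sub_right volume a).quasiMeasurePreserving.ae (φ.coeFn_toLp 2 volume)]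
      with p e1 e2 e3
    rw [e1, e2, e3, hψφ]
  rw [h1, SchwartzMap.toLp_fourierInv_eq, SchwartzMap.toLp_fourierInv_eq]
  refine Lp.ext ?_
  filter_upwards [coeFn_modulate a ((𝓕⁻ φ).toLp 2 volume), (𝓕⁻ ψ).coeFn_toLp 2 volume,
    (𝓕⁻ φ).coeFn_toLp 2 volume] with y e1 e2 e3
  rw [e1, e2, e3, SchwartzMap.fourierInv_coe, SchwartzMap.fourierInv_coe, Real.fourierInv_eq,
    Real.fourierInv_eq, ← integral_const_mul]
  rw [← integral_add_right_eq_self _ a]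
  congr 1; funext p
  rw [hψφ, add_sub_cancel_right, inner_add_left, AddChar.map_add_eq_mul]
  simp only [Circle.smul_def, Circle.coe_mul, smul_eq_mul]
  ring

theorem isShift_translate (s : ℝ) :
    IsShift (fun (ξ : E d) (p : E d) => p - s • ξ) (volume : Measure (E d)) where
  measurable := by
    unfold Function.uncurry; fun_prop
  preserving ξ := measurePreserving_sub_right volume _

theorem position_coe (f : Lp ℂ 2 (volume : Measure (E d))) :
    position (f : E d → ℂ) = ⇑(𝓕⁻ f : Lp ℂ 2 (volume : Measure (E d))) := by
  unfold position
  rw [dif_pos (Lp.memLp f), Lp.toLp_coeFn]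

theorem position_toLp {f : E d → ℂ} (hf : MemLp f 2 (volume : Measure (E d))) :
    position f = position (⇑(hf.toLp f)) := by
  rw [position_coe]
  unfold position
  rw [dif_pos hf]

/-- The form of the potential `a V(s x)`, where `V` is the inverse Fourier transform of `W`. -/
theorem potentialForm_eq_shiftForm {U : E d → ℝ} {W : E d → ℂ} {a s : ℝ} (hW : Integrable W)
    (hU : ∀ᵐ x : E d, (U x : ℂ) = a * (𝓕⁻ W : E d → ℂ) (s • x))
    (f g : Lp ℂ 2 (volume : Measure (E d))) :
    potentialForm U f g =
      a * shiftForm W (fun ξ p => p - (2 * Real.pi * s) • ξ) volume f g := by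
  unfold potentialForm
  rw [position_coe, position_coe]
  set F : Lp ℂ 2 (volume : Measure (E d)) := 𝓕⁻ f
  set G : Lp ℂ 2 (volume : Measure (E d)) := 𝓕⁻ g with hG
  have hpi : 2 * Real.pi ≠ 0 := by positivity
  have hU' := (Measure.quasiMeasurePreserving_smul (volume : Measure (E d)) hpi).ae hU
  -- The Fourier integral of `V` is inserted at the position `x = 2π y`. The phase is `e^{2πi ξ·(2πs
  -- y)}`, which is why momenta get shifted by `2πs ξ`.
  have h1 : ∫ y, (U ((2 * Real.pi) • y) : ℂ) * (conj (F y) * G y) =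
      ∫ y, ∫ ξ, (a : ℂ) * (((Real.fourierChar (inner ℝ ξ ((2 * Real.pi * s) • y)) : Circle) : ℂ) *
        (W ξ * (conj (F y) * G y))) := by
    refine integral_congr_ae ?_
    filter_upwards [hU'] with y hy
    rw [hy, Real.fourierInv_eq, integral_const_mul, mul_assoc]
    congr 1
    rw [← integral_mul_const]
    congr 1; funext ξ
    rw [Circle.smul_def, smul_smul, smul_eq_mul, mul_assoc, mul_comm s]
  have hFG : Integrable fun y => conj (F y) * G y := integrable_conj_mul (Lp.memLp F) (Lp.memLp G)
  have hint : Integrable (fun z : E d × E d => (a : ℂ) *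
      (((Real.fourierChar (inner ℝ z.2 ((2 * Real.pi * s) • z.1)) : Circle) : ℂ) *
        (W z.2 * (conj (F z.1) * G z.1)))) (volume.prod volume) := by
    refine Integrable.const_mul ?_ _
    have h0 : Integrable (fun z : E d × E d => (conj (F z.1) * G z.1) * W z.2)
      (volume.prod volume) := hFG.mul_prod hW
    have hb := h0.bdd_mul (c := 1)
      (f := fun z : E d × E d => ((Real.fourierChar (inner ℝ z.2 ((2 * Real.pi * s) • z.1)) : Circle) : ℂ))
      (by fun_prop) (Eventually.of_forall fun z => (Circle.norm_coe _).le)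
    refine hb.congr (Eventually.of_forall fun z => ?_)
    simp only; ring
  rw [h1, integral_integral_swap hint]
  unfold shiftForm
  rw [← integral_const_mul]
  congr 1; funext ξ
  have hsh := integral_shift_eq_inner (isShift_translate (d := d) (2 * Real.pi * s)) f g ξ
  rw [hsh]
  -- Parseval. After it, the phase in the position variable becomes a translation in momentum.
  have hF : ∀ u w : Lp ℂ 2 (volume : Measure (E d)),
      inner ℂ u w = inner ℂ (𝓕⁻ u : Lp ℂ 2 (volume : Measure (E d))) (𝓕⁻ w) := fun u w =>
    ((Lp.fourierTransformₗᵢ (E d) ℂ).symm.inner_map_map u w).symm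
  rw [hF, integral_const_mul]
  congr 1
  change _ = W ξ * inner ℂ F (𝓕⁻ (translate ((2 * Real.pi * s) • ξ) g))
  rw [fourierInv_translate, inner_eq_integral, ← integral_const_mul]
  refine integral_congr_ae ?_
  filter_upwards [coeFn_modulate ((2 * Real.pi * s) • ξ) G] with y hy
  rw [hy, real_inner_smul_left, real_inner_smul_right]
  ring

end Potential

/-! ### Forms of multiplication operators -/

section Weight

variable {X : Type*} [MeasurableSpace X] {μ : Measure X}

/-- The form of the multiplication operator by `h`. -/
noncomputable def weightForm (h : X → ℝ) (μ : Measure X) (f g : Lp ℂ 2 μ) : ℂ :=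
  ∫ x, (h x : ℂ) * (conj (f x) * g x) ∂μ

theorem integrable_weight_mul {h : X → ℝ} (hm : AEStronglyMeasurable h μ) {f g : X → ℂ}
    (hfm : AEStronglyMeasurable f μ) (hgm : AEStronglyMeasurable g μ)
    (hf : Integrable (fun x => h x * ‖f x‖ ^ 2) μ) (hg : Integrable (fun x => h x * ‖g x‖ ^ 2) μ) :
    Integrable (fun x => (h x : ℂ) * (conj (f x) * g x)) μ := by
  refine Integrable.mono' (hf.norm.add hg.norm) ?_ (Eventually.of_forall fun x => ?_)
  · exact (Complex.continuous_ofReal.comp_aestronglyMeasurable hm).mul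
      ((Complex.continuous_conj.comp_aestronglyMeasurable hfm).mul hgm)
  · simp only [norm_mul, Complex.norm_real, RCLike.norm_conj, Pi.add_apply, norm_pow, norm_norm]
    rw [← mul_add]
    gcongr
    nlinarith [sq_nonneg (‖f x‖ - ‖g x‖), sq_nonneg (‖f x‖), sq_nonneg ‖g x‖]

/-- The form domain of the multiplication operator by `h`. -/
def weightDomain {h : X → ℝ} (hm : AEStronglyMeasurable h μ) : Submodule ℂ (Lp ℂ 2 μ) where
  carrier := {f | Integrable (fun x => h x * ‖f x‖ ^ 2) μ}
  zero_mem' := by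
    refine (integrable_zero X ℝ μ).congr ?_
    filter_upwards [Lp.coeFn_zero ℂ 2 μ] with x hx
    rw [hx]; simp
  add_mem' := fun {f g} hf hg => by
    refine Integrable.mono' (((Integrable.norm hf).add (Integrable.norm hg)).const_mul 2)
      (hm.mul ((Lp.aestronglyMeasurable _).norm.pow 2)) ?_
    filter_upwards [Lp.coeFn_add f g] with x hx
    simp only [hx, Pi.add_apply, norm_mul, norm_pow, norm_norm]
    have h1 : ‖f x + g x‖ ^ 2 ≤ 2 * (‖f x‖ ^ 2 + ‖g x‖ ^ 2) := by
      have := norm_add_le (f x) (g x)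
      nlinarith [sq_nonneg (‖f x‖ - ‖g x‖), norm_nonneg (f x + g x)]
    calc ‖h x‖ * ‖f x + g x‖ ^ 2 ≤ ‖h x‖ * (2 * (‖f x‖ ^ 2 + ‖g x‖ ^ 2)) := by gcongr
      _ = _ := by ring
  smul_mem' := fun c f hf => by
    refine (Integrable.const_mul hf (‖c‖ ^ 2)).congr ?_
    filter_upwards [Lp.coeFn_smul c f] with x hx
    simp only [hx, Pi.smul_apply, norm_smul]
    ring

theorem isHermitianForm_weightForm {h : X → ℝ} (hm : AEStronglyMeasurable h μ) :
    IsHermitianForm (weightDomain hm) (weightForm h μ) where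
  conj_symm χ Ψ := by
    unfold weightForm
    rw [← integral_conj]
    congr 1; funext x
    simp [mul_comm]
  add_right χ h1 Ψ h2 Ψ' h3 := by
    unfold weightForm
    rw [← integral_add
      (integrable_weight_mul hm (Lp.aestronglyMeasurable _) (Lp.aestronglyMeasurable _) h1 h2)
      (integrable_weight_mul hm (Lp.aestronglyMeasurable _) (Lp.aestronglyMeasurable _) h1 h3)]
    refine integral_congr_ae ?_
    filter_upwards [Lp.coeFn_add Ψ Ψ'] with x hx
    simp only [hx, Pi.add_apply]; ring
  smul_right χ h1 Ψ h2 c := by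
    unfold weightForm
    rw [← integral_const_mul]
    refine integral_congr_ae ?_
    filter_upwards [Lp.coeFn_smul c Ψ] with x hx
    simp only [hx, Pi.smul_apply, smul_eq_mul]; ring

theorem conj_mul_self_eq (z : ℂ) : conj z * z = ((‖z‖ ^ 2 : ℝ) : ℂ) := by
  rw [mul_comm, Complex.mul_conj, Complex.normSq_eq_norm_sq]

theorem weightForm_self (h : X → ℝ) (f : Lp ℂ 2 μ) :
    weightForm h μ f f = ((∫ x, h x * ‖f x‖ ^ 2 ∂μ : ℝ) : ℂ) := by
  unfold weightForm
  rw [← integral_complex_ofReal]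
  congr 1; funext x
  rw [conj_mul_self_eq]; push_cast; rfl

/-- Adding `1` to the multiplication operator makes it onto: multiplication by `1 / (1 + h)` is a
bounded inverse that maps into the form domain. -/
theorem containsAdjoint_weightForm {h : X → ℝ} (hm : AEStronglyMeasurable h μ)
    (h0 : ∀ x, 0 ≤ h x) :
    ContainsAdjoint (formGraph (weightDomain hm : Set (Lp ℂ 2 μ)) (weightForm h μ)) := by
  refine (isHermitianForm_weightForm hm).containsAdjoint_of_surjective fun y => ?_
  have hpos : ∀ x, 0 < 1 + h x := fun x => by linarith [h0 x]
  have hxm : MemLp (fun x => (((1 + h x)⁻¹ : ℝ) : ℂ) * y x) 2 μ := by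
    refine (Lp.memLp y).mono ?_ (Eventually.of_forall fun x => ?_)
    · exact (Complex.continuous_ofReal.comp_aestronglyMeasurable
        ((aestronglyMeasurable_const.add hm).inv₀)).mul (Lp.aestronglyMeasurable y)
    · rw [norm_mul, Complex.norm_real, Real.norm_of_nonneg (inv_nonneg.2 (hpos x).le)]
      exact mul_le_of_le_one_left (norm_nonneg _) (inv_le_one_of_one_le₀ (by linarith [h0 x]))
  have hx := hxm.coeFn_toLp
  refine ⟨hxm.toLp _, ?_, fun χ hχ => ?_⟩
  · change Integrable _ μ
    refine Integrable.mono' (integrable_norm_sq y)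
      (hm.mul ((Lp.aestronglyMeasurable _).norm.pow 2)) ?_
    filter_upwards [hx] with x hx
    simp only [hx, norm_mul, norm_pow, Complex.norm_real, Real.norm_eq_abs, abs_norm,
      abs_of_nonneg (h0 x), abs_of_pos (inv_pos.2 (hpos x)), mul_pow]
    rw [← mul_assoc]
    refine mul_le_of_le_one_left (sq_nonneg ‖y x‖) ?_
    rw [inv_pow, ← div_eq_mul_inv, div_le_one (pow_pos (hpos x) 2)]
    nlinarith [h0 x]
  · rw [inner_eq_integral]
    refine integral_congr_ae ?_
    filter_upwards [hx, Lp.coeFn_sub y (hxm.toLp _)] with x hx hs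
    simp only [hs, Pi.sub_apply, hx]
    have : (1 + (h x : ℂ)) ≠ 0 := by
      have := (hpos x).ne'
      exact_mod_cast this
    push_cast
    field_simp
    ring

end Weight

/-! ### Restriction of a square integrable function to a set -/

section Restrict

variable {X : Type*} [MeasurableSpace X] {μ : Measure X}

/-- The function `1_s f`. -/
noncomputable def cut {s : Set X} (hs : MeasurableSet s) (f : Lp ℂ 2 μ) : Lp ℂ 2 μ :=
  ((Lp.memLp f).indicator hs).toLp _

theorem coeFn_cut {s : Set X} (hs : MeasurableSet s) (f : Lp ℂ 2 μ) :
    cut hs f =ᵐ[μ] s.indicator f := MemLp.coeFn_toLp _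

theorem cut_add_cut_compl {s : Set X} (hs : MeasurableSet s) (f : Lp ℂ 2 μ) :
    cut hs f + cut hs.compl f = f := by
  refine Lp.ext ?_
  filter_upwards [Lp.coeFn_add (cut hs f) (cut hs.compl f), coeFn_cut hs f,
    coeFn_cut hs.compl f] with x h1 h2 h3
  rw [h1, Pi.add_apply, h2, h3]
  exact Set.indicator_self_add_compl_apply s f x

theorem norm_sq_cut {s : Set X} (hs : MeasurableSet s) (f : Lp ℂ 2 μ) :
    ‖cut hs f‖ ^ 2 = ∫ x in s, ‖f x‖ ^ 2 ∂μ := by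
  rw [norm_sq_eq_integral, ← integral_indicator hs]
  refine integral_congr_ae ?_
  filter_upwards [coeFn_cut hs f] with x hx
  rw [hx]
  by_cases h : x ∈ s <;> simp [h]

theorem norm_sq_cut_add {s : Set X} (hs : MeasurableSet s) (f : Lp ℂ 2 μ) :
    ‖cut hs f‖ ^ 2 + ‖cut hs.compl f‖ ^ 2 = ‖f‖ ^ 2 := by
  rw [norm_sq_cut, norm_sq_cut, norm_sq_eq_integral f]
  exact integral_add_compl hs (integrable_norm_sq f)

theorem norm_cut_le {s : Set X} (hs : MeasurableSet s) (f : Lp ℂ 2 μ) : ‖cut hs f‖ ≤ ‖f‖ := by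
  have := norm_sq_cut_add hs f
  nlinarith [norm_nonneg f, norm_nonneg (cut hs f), sq_nonneg ‖cut hs.compl f‖]

end Restrict

/-! ### The Schrödinger operator -/

section Schrodinger

variable {d : ℕ}

/-- The form of the potential with Fourier transform `W` for functions of the momentum. -/
noncomputable def pot (W : E d → ℂ) (f g : Lp ℂ 2 (volume : Measure (E d))) : ℂ :=
  shiftForm W (fun ξ p => p - (2 * Real.pi) • ξ) volume f g

/-- The form of `p²`. -/
noncomputable def kin (f : Lp ℂ 2 (volume : Measure (E d))) : ℝ := ∫ p, ‖p‖ ^ 2 * ‖f p‖ ^ 2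

theorem kin_nonneg (f : Lp ℂ 2 (volume : Measure (E d))) : 0 ≤ kin f :=
  integral_nonneg fun p => by positivity

/-- `W` is the Fourier transform of `V`. -/
structure HasFourier (V : E d → ℝ) (W : E d → ℂ) : Prop where
  integrable : Integrable W
  eq : (fun x => (V x : ℂ)) =ᵐ[volume] (𝓕⁻ W : E d → ℂ)

variable {V : E d → ℝ} {W : E d → ℂ}

theorem HasFourier.potentialForm_eq (h : HasFourier V W)
    (f g : Lp ℂ 2 (volume : Measure (E d))) : potentialForm V f g = pot W f g := by
  have := potentialForm_eq_shiftForm (U := V) (a := 1) (s := 1) h.integrable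
    (by filter_upwards [h.eq] with x hx; simpa using hx) f g
  simpa [pot] using this

/-- Symmetry is read off in position space, where `V` is real; linearity and boundedness come from
the representation by shifts. -/
theorem HasFourier.isHermitianForm (h : HasFourier V W) :
    IsHermitianForm (⊤ : Submodule ℂ (Lp ℂ 2 (volume : Measure (E d)))) (pot W) where
  conj_symm χ Ψ := by
    rw [← h.potentialForm_eq, ← h.potentialForm_eq]
    unfold potentialForm
    rw [← integral_conj]
    congr 1; funext x
    simp [mul_comm]
  add_right χ _ Ψ _ Ψ' _ := shiftForm_add_right (isShift_translate _) h.integrable χ Ψ Ψ'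
  smul_right χ _ Ψ _ c := shiftForm_smul_right (isShift_translate _) χ Ψ c

theorem HasFourier.norm_pot_le (h : HasFourier V W) (f g : Lp ℂ 2 (volume : Measure (E d))) :
    ‖pot W f g‖ ≤ (∫ ξ, ‖W ξ‖) * ‖f‖ * ‖g‖ :=
  norm_shiftForm_le (isShift_translate _) h.integrable f g

theorem aestronglyMeasurable_kinetic (m : ℝ≥0∞) :
    AEStronglyMeasurable (fun p : E d => invTwoMass m * ‖p‖ ^ 2) volume := by fun_prop

theorem invTwoMass_nonneg (m : ℝ≥0∞) : 0 ≤ invTwoMass m := ENNReal.toReal_nonneg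

theorem HasFourier.schrodingerForm_eq (h : HasFourier V W) (m : ℝ≥0∞) :
    schrodingerForm V m =
      fun f g => weightForm (fun p => invTwoMass m * ‖p‖ ^ 2) volume f g + pot W f g := by
  funext f g
  rw [← h.potentialForm_eq]; rfl

theorem HasFourier.schrodingerForm_self (h : HasFourier V W) (m : ℝ≥0∞)
    (f : Lp ℂ 2 (volume : Measure (E d))) :
    (schrodingerForm V m f f).re = invTwoMass m * kin f + (pot W f f).re := by
  rw [h.schrodingerForm_eq]
  beta_reduce
  rw [weightForm_self, Complex.add_re, Complex.ofReal_re, kin,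
    ← integral_const_mul]
  simp only [mul_assoc]

/-- The kinetic energy is a nonnegative multiplication operator and the potential a bounded
symmetric perturbation, so the variational principle applies. -/
theorem HasFourier.schrodingerEnergy_isGreatest (h : HasFourier V W) (m : ℝ≥0∞)
    (hne : ∃ f ∈ schrodingerDomain d m, f ≠ 0) :
    IsGreatest {b : ℝ | ∀ f ∈ schrodingerDomain d m,
      b * ‖f‖ ^ 2 ≤ invTwoMass m * kin f + (pot W f f).re} (schrodingerEnergy V m) := by
  have hm := aestronglyMeasurable_kinetic (d := d) m
  have hq := (isHermitianForm_weightForm hm).add (h.isHermitianForm.mono le_top)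
  have hG := (containsAdjoint_weightForm hm (fun p => mul_nonneg (invTwoMass_nonneg m)
    (sq_nonneg ‖p‖))).add_bounded h.isHermitianForm h.norm_pot_le
  have hself := h.schrodingerForm_self m
  rw [h.schrodingerForm_eq] at hself
  have := hq.infSpec_isGreatest hG ⟨-(∫ ξ, ‖W ξ‖), fun f _ => ?_⟩ hne
  · simp only [hself] at this
    unfold schrodingerEnergy schrodingerGraph
    rw [h.schrodingerForm_eq]
    exact this
  · rw [hself]
    have h1 := mul_nonneg (invTwoMass_nonneg m) (kin_nonneg f)
    have h2 := (abs_le.1 ((Complex.abs_re_le_norm _).trans (h.norm_pot_le f f))).1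
    nlinarith

end Schrodinger

/-! ### One-particle estimates: strict monotonicity in the mass, momentum cutoffs. -/

section OneParticle

variable {d : ℕ} {V : E d → ℝ} {W : E d → ℂ}

theorem HasFourier.pot_add_re (h : HasFourier V W) (f g : Lp ℂ 2 (volume : Measure (E d))) :
    (pot W (f + g) (f + g)).re = (pot W f f).re + 2 * (pot W f g).re + (pot W g g).re := by
  have := h.isHermitianForm.re_self_add_smul (χ := f) (Ψ := g) trivial trivial 1
  simpa using this

theorem HasFourier.abs_pot_re_le (h : HasFourier V W) (f g : Lp ℂ 2 (volume : Measure (E d))) :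
    |(pot W f g).re| ≤ (∫ ξ, ‖W ξ‖) * ‖f‖ * ‖g‖ :=
  (Complex.abs_re_le_norm _).trans (h.norm_pot_le f g)

theorem integral_norm_nonneg (W : E d → ℂ) : 0 ≤ ∫ ξ, ‖W ξ‖ :=
  integral_nonneg fun _ => norm_nonneg _

/-- An integrable function has small integral over small balls. -/
theorem exists_ball_integral_le (hd : 1 ≤ d) (hW : Integrable W) {ε : ℝ} (hε : 0 < ε) :
    ∃ r : ℝ, 0 < r ∧ ∫ ξ in Metric.closedBall (0 : E d) r, ‖W ξ‖ ≤ ε := by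
  have : Nonempty (Fin d) := ⟨⟨0, hd⟩⟩
  have hvol : Tendsto (fun n : ℕ => volume (Metric.closedBall (0 : E d) (1 / ((n : ℝ) + 1))))
      atTop (𝓝 0) := by
    have h1 : ⋂ n : ℕ, Metric.closedBall (0 : E d) (1 / ((n : ℝ) + 1)) = {0} := by
      ext x
      simp only [Set.mem_iInter, mem_closedBall_zero_iff, Set.mem_singleton_iff]
      constructor
      · intro hx
        have := ge_of_tendsto' tendsto_one_div_add_atTop_nhds_zero_nat hx
        simpa using this
      · rintro rfl n
        rw [norm_zero]; positivity
    have h2 := tendsto_measure_iInter_atTop (μ := (volume : Measure (E d)))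
      (s := fun n : ℕ => Metric.closedBall (0 : E d) (1 / ((n : ℝ) + 1)))
      (fun n => measurableSet_closedBall.nullMeasurableSet)
      (fun a b hab => Metric.closedBall_subset_closedBall (by gcongr))
      ⟨0, measure_closedBall_lt_top.ne⟩
    rw [h1] at h2
    -- This is where `d ≥ 1` enters: the limit of the shrinking balls is a point, which must be a
    -- null set.
    have : Nontrivial (E d) := by infer_instance
    simpa [Function.comp_def] using h2
  have h3 := hW.norm.tendsto_setIntegral_nhds_zero hvol
  obtain ⟨n, hn⟩ := (h3.eventually (ge_mem_nhds hε)).exists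
  exact ⟨1 / ((n : ℝ) + 1), by positivity, hn⟩

/-- A function concentrated at small momenta does not feel the potential. -/
theorem HasFourier.exists_pot_le (h : HasFourier V W) (hd : 1 ≤ d) {ε : ℝ} (hε : 0 < ε) :
    ∃ r : ℝ, 0 < r ∧ ∀ f : Lp ℂ 2 (volume : Measure (E d)),
      (∀ᵐ p, r ≤ ‖p‖ → f p = 0) → |(pot W f f).re| ≤ ε * ‖f‖ ^ 2 := by
  obtain ⟨r, hr, hWr⟩ := exists_ball_integral_le hd h.integrable hε
  refine ⟨r, hr, fun f hf => ?_⟩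
  refine (Complex.abs_re_le_norm _).trans ?_
  have hT := isShift_translate (d := d) (2 * Real.pi)
  unfold pot shiftForm
  -- If `f` lives in `‖p‖ < r`, then `f` and its shift by `2πξ` can overlap only when `2π‖ξ‖ < 2r`;
  -- hence only `‖ξ‖ ≤ r` contributes.
  have hpi : 2 ≤ 2 * Real.pi := by linarith [Real.pi_gt_three]
  have h0 : ∀ ξ : E d, ξ ∉ Metric.closedBall (0 : E d) r →
      ∫ p, conj (f p) * f (p - (2 * Real.pi) • ξ) = 0 := by
    intro ξ hξ
    rw [mem_closedBall_zero_iff, not_le] at hξ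
    rw [← integral_zero (E d) ℂ]
    refine integral_congr_ae ?_
    filter_upwards [hf, (hT.preserving ξ).quasiMeasurePreserving.ae hf] with p h1 h2
    by_cases hp : r ≤ ‖p‖
    · rw [h1 hp]; simp
    · rw [h2 ?_, mul_zero]
      have h3 : ‖(2 * Real.pi) • ξ‖ ≤ ‖p‖ + ‖p - (2 * Real.pi) • ξ‖ := by
        have := norm_sub_le p (p - (2 * Real.pi) • ξ)
        simpa using this
      rw [norm_smul, Real.norm_of_nonneg (by positivity)] at h3
      nlinarith
  calc ‖∫ ξ, W ξ * ∫ p, conj (f p) * f (p - (2 * Real.pi) • ξ)‖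
      = ‖∫ ξ in Metric.closedBall (0 : E d) r,
          W ξ * ∫ p, conj (f p) * f (p - (2 * Real.pi) • ξ)‖ := by
        rw [setIntegral_eq_integral_of_forall_compl_eq_zero]
        intro ξ hξ
        rw [h0 ξ hξ, mul_zero]
    _ ≤ ∫ ξ in Metric.closedBall (0 : E d) r, ‖W ξ‖ * ‖f‖ ^ 2 := by
        refine (norm_integral_le_integral_norm _).trans ?_
        refine integral_mono_of_nonneg (Eventually.of_forall fun ξ => norm_nonneg _)
          (h.integrable.norm.mul_const _).integrableOn (Eventually.of_forall fun ξ => ?_)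
        simp only [norm_mul]
        rw [sq]
        gcongr
        exact norm_integral_shift_le hT f f ξ
    _ ≤ _ := by
        rw [integral_mul_const]
        gcongr

theorem ae_cut_eq_zero {s : Set (E d)} (hs : MeasurableSet s)
    (f : Lp ℂ 2 (volume : Measure (E d))) : ∀ᵐ p, p ∉ s → cut hs f p = 0 := by
  filter_upwards [coeFn_cut hs f] with p hp h
  rw [hp]; simp [h]

/-- A function bound by the potential has some kinetic energy. -/
theorem HasFourier.exists_le_kin (h : HasFourier V W) (hd : 1 ≤ d) {e : ℝ} (he : e < 0) :
    ∃ κ : ℝ, 0 < κ ∧ ∀ f : Lp ℂ 2 (volume : Measure (E d)),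
      Integrable (fun p => ‖p‖ ^ 2 * ‖f p‖ ^ 2) → (pot W f f).re ≤ e * ‖f‖ ^ 2 →
      κ * ‖f‖ ^ 2 ≤ kin f := by
  obtain ⟨r, hr, hsmall⟩ := h.exists_pot_le hd (ε := -e / 2) (by linarith)
  set N := ∫ ξ, ‖W ξ‖ with hN
  have hN0 : 0 ≤ N := integral_norm_nonneg W
  -- The part of `f` below momentum `r` supplies at most half of the binding energy `-e`. The rest
  -- involves the part `f2` above `r`: the cross terms cost `2N‖f‖‖f2‖` and the diagonal one
  -- `N‖f‖‖f2‖`. So `‖f2‖ ≥ c‖f‖`, and `f2` has kinetic energy at least `r²‖f2‖²`. The summand `1`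
  -- keeps the denominator positive.
  set c := (-e / 2) / (3 * N + 1) with hc
  have hc0 : 0 < c := div_pos (by linarith) (by linarith)
  refine ⟨r ^ 2 * c ^ 2, by positivity, fun f hf hpot => ?_⟩
  have hs : MeasurableSet (Metric.ball (0 : E d) r) := measurableSet_ball
  set f1 := cut hs f
  set f2 := cut hs.compl f
  have hsum : f1 + f2 = f := cut_add_cut_compl hs f
  have h1 : |(pot W f1 f1).re| ≤ -e / 2 * ‖f1‖ ^ 2 := by
    refine hsmall f1 ?_
    filter_upwards [ae_cut_eq_zero hs f] with p hp hrp
    exact hp (by simpa using hrp)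
  have h2 := h.abs_pot_re_le f1 f2
  have h3 := h.abs_pot_re_le f2 f2
  have h4 := h.pot_add_re f1 f2
  rw [hsum] at h4
  have hf1 : ‖f1‖ ≤ ‖f‖ := norm_cut_le hs f
  have hf2 : ‖f2‖ ≤ ‖f‖ := norm_cut_le hs.compl f
  have hkin : r ^ 2 * ‖f2‖ ^ 2 ≤ kin f := by
    rw [norm_sq_cut hs.compl, ← integral_const_mul, kin]
    refine le_trans ?_ (setIntegral_le_integral hf (Eventually.of_forall fun p => by positivity)
      (s := (Metric.ball (0 : E d) r)ᶜ))
    refine setIntegral_mono_on ((integrable_norm_sq f).const_mul _).integrableOn hf.integrableOn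
      hs.compl fun p hp => ?_
    have : r ≤ ‖p‖ := by simpa using hp
    gcongr
  have h1' := (abs_le.1 h1).1
  have h2' := (abs_le.1 h2).1
  have h3' := (abs_le.1 h3).1
  have hF := norm_nonneg f
  have hF1 := norm_nonneg f1
  have hF2 := norm_nonneg f2
  have e1 : -e / 2 * ‖f1‖ ^ 2 ≤ -e / 2 * ‖f‖ ^ 2 := by
    have : 0 ≤ -e / 2 := by linarith
    gcongr
  have e2 : N * ‖f1‖ * ‖f2‖ ≤ N * ‖f‖ * ‖f2‖ := by gcongr
  have e3 : N * ‖f2‖ * ‖f2‖ ≤ N * ‖f‖ * ‖f2‖ := by gcongr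
  have key : (-e / 2) * ‖f‖ ^ 2 ≤ (3 * N + 1) * (‖f‖ * ‖f2‖) := by
    nlinarith [mul_nonneg hF hF2]
  have key2 : c * ‖f‖ ≤ ‖f2‖ := by
    rcases hF.eq_or_lt with h0 | h0
    · rw [← h0, mul_zero]; exact hF2
    · rw [hc, div_mul_eq_mul_div, div_le_iff₀ (by linarith)]
      refine le_of_mul_le_mul_right ?_ h0
      nlinarith
  calc r ^ 2 * c ^ 2 * ‖f‖ ^ 2 = r ^ 2 * (c * ‖f‖) ^ 2 := by ring
    _ ≤ r ^ 2 * ‖f2‖ ^ 2 := by gcongr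
    _ ≤ _ := hkin

theorem invTwoMass_half : invTwoMass (1 / 2) = 1 := by
  unfold invTwoMass
  rw [one_div, ENNReal.mul_inv_cancel (by norm_num) (by norm_num)]
  simp

theorem invTwoMass_lt {m m' : ℝ≥0∞} (hm : 1 / 2 ≤ m) (h : m < m') :
    invTwoMass m' < invTwoMass m := by
  unfold invTwoMass
  have hm0 : m ≠ 0 := fun h0 => by simp [h0] at hm
  have h2 : 2 * m < 2 * m' := by
    rw [ENNReal.mul_lt_mul_iff_right (by norm_num) (by norm_num)]; exact h
  rw [ENNReal.toReal_lt_toReal]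
  · exact ENNReal.inv_lt_inv.2 h2
  · exact ENNReal.inv_ne_top.2 (by simpa using (pos_of_gt h).ne')
  · exact ENNReal.inv_ne_top.2 (by simpa using hm0)

/-- A square integrable function with finite kinetic energy is in the form domain. -/
theorem mem_schrodingerDomain {f : Lp ℂ 2 (volume : Measure (E d))} (m : ℝ≥0∞)
    (hf : Integrable (fun p => ‖p‖ ^ 2 * ‖f p‖ ^ 2)) : f ∈ schrodingerDomain d m := by
  refine (hf.const_mul (invTwoMass m)).congr (Eventually.of_forall fun p => ?_)
  simp only; ring

theorem integrable_of_mem_schrodingerDomain {f : Lp ℂ 2 (volume : Measure (E d))} {m : ℝ≥0∞}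
    (hf : f ∈ schrodingerDomain d m) (hm : invTwoMass m ≠ 0) :
    Integrable (fun p => ‖p‖ ^ 2 * ‖f p‖ ^ 2) := by
  refine (Integrable.const_mul hf (invTwoMass m)⁻¹).congr (Eventually.of_forall fun p => ?_)
  simp only; field_simp

/-- The energy is strictly decreasing in the mass. -/
theorem HasFourier.schrodingerEnergy_lt (h : HasFourier V W) (hd : 1 ≤ d)
    (hneg : ∃ e < 0, ∃ f ∈ schrodingerDomain d (1 / 2), f ≠ 0 ∧
      kin f + (pot W f f).re ≤ e * ‖f‖ ^ 2)
    {m m' : ℝ≥0∞} (hm : 1 / 2 ≤ m) (hmm : m < m') :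
    schrodingerEnergy V m' < schrodingerEnergy V m := by
  obtain ⟨e, he, f₀, hf₀, hf₀0, hf₀e⟩ := hneg
  have hint₀ := integrable_of_mem_schrodingerDomain hf₀ (by rw [invTwoMass_half]; norm_num)
  have hG := h.schrodingerEnergy_isGreatest m ⟨f₀, mem_schrodingerDomain m hint₀, hf₀0⟩
  have hG' := h.schrodingerEnergy_isGreatest m' ⟨f₀, mem_schrodingerDomain m' hint₀, hf₀0⟩
  have hlt := invTwoMass_lt hm hmm
  have hle : invTwoMass m ≤ 1 := by
    rcases hm.eq_or_lt with h1 | h1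
    · rw [← h1, invTwoMass_half]
    · exact (invTwoMass_lt le_rfl h1).le.trans invTwoMass_half.le
  have hmpos : 0 < invTwoMass m := (invTwoMass_nonneg m').trans_lt hlt
  set ε := schrodingerEnergy V m with hε
  have hεe : ε ≤ e := by
    have h1 := hG.1 f₀ (mem_schrodingerDomain m hint₀)
    have h2 : 0 < ‖f₀‖ ^ 2 := by positivity
    have h3 := mul_le_mul_of_nonneg_right hle (kin_nonneg f₀)
    refine le_of_mul_le_mul_right ?_ h2
    linarith
  obtain ⟨κ, hκ, hkin⟩ := h.exists_le_kin hd (e := e / 2) (by linarith)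
  set δ := invTwoMass m - invTwoMass m' with hδ
  have hδ0 : 0 < δ := sub_pos.2 hlt
  by_contra! hcon
  -- A minimizer need not be available, so `f` is taken within `τ` of the infimum for the mass `m`.
  -- The first bound keeps its energy below `e / 2`, so that it has kinetic energy at least `κ‖f‖²`.
  -- Passing to `m'` then gains `δκ`, and the second bound makes this exceed the error `τ`.
  set τ := min (-e / 2) (δ * κ / 2) with hτ
  have hτ0 : 0 < τ := lt_min (by linarith) (by positivity)
  have hτ1 : τ ≤ -e / 2 := min_le_left _ _
  have hτ2 : τ ≤ δ * κ / 2 := min_le_right _ _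
  have hnot : ¬ ∀ f ∈ schrodingerDomain d m,
      (ε + τ) * ‖f‖ ^ 2 ≤ invTwoMass m * kin f + (pot W f f).re := fun hall => by
    have : ε + τ ≤ ε := hG.2 hall
    linarith
  push Not at hnot
  obtain ⟨f, hf, hfe⟩ := hnot
  have hint := integrable_of_mem_schrodingerDomain hf hmpos.ne'
  have hn : 0 ≤ ‖f‖ ^ 2 := by positivity
  have h1 := mul_nonneg hmpos.le (kin_nonneg f)
  have h2 : (ε + τ) * ‖f‖ ^ 2 ≤ e / 2 * ‖f‖ ^ 2 := by
    have : ε + τ ≤ e / 2 := by linarith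
    gcongr
  have h3 := hkin f hint (by linarith)
  have h4 := hG'.1 f (mem_schrodingerDomain m' hint)
  have h5 : ε * ‖f‖ ^ 2 ≤ schrodingerEnergy V m' * ‖f‖ ^ 2 := by gcongr
  have h6 : δ * (κ * ‖f‖ ^ 2) ≤ δ * kin f := by gcongr
  have h7 : τ * ‖f‖ ^ 2 ≤ δ * κ / 2 * ‖f‖ ^ 2 := by gcongr
  have h8 : 0 ≤ δ * κ * ‖f‖ ^ 2 := by positivity
  have h9 : δ * kin f = invTwoMass m * kin f - invTwoMass m' * kin f := by rw [hδ]; ring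
  linarith

theorem integrable_of_bounded_support {R : ℝ} {f : Lp ℂ 2 (volume : Measure (E d))}
    (hf : ∀ᵐ p, R ≤ ‖p‖ → f p = 0) {w : E d → ℝ} (hw : AEStronglyMeasurable w volume) {B : ℝ}
    (hB : ∀ p, ‖p‖ < R → ‖w p‖ ≤ B) : Integrable (fun p => w p * ‖f p‖ ^ 2) := by
  refine Integrable.mono' ((integrable_norm_sq f).const_mul B)
    (hw.mul ((Lp.aestronglyMeasurable f).norm.pow 2)) ?_
  filter_upwards [hf] with p hp
  simp only [norm_mul, norm_pow, norm_norm]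
  by_cases h : R ≤ ‖p‖
  · rw [hp h]; simp
  · have := hB p (not_le.1 h)
    gcongr

theorem integrable_kin_of_bounded_support {R : ℝ} {f : Lp ℂ 2 (volume : Measure (E d))}
    (hf : ∀ᵐ p, R ≤ ‖p‖ → f p = 0) : Integrable (fun p => ‖p‖ ^ 2 * ‖f p‖ ^ 2) := by
  refine integrable_of_bounded_support hf (by fun_prop) (B := R ^ 2) fun p hp => ?_
  rw [norm_pow, norm_norm]; gcongr

theorem ae_cut_ball_eq_zero (R : ℝ) (f : Lp ℂ 2 (volume : Measure (E d))) :
    ∀ᵐ p, R ≤ ‖p‖ → cut (measurableSet_ball (x := (0 : E d)) (ε := R)) f p = 0 := by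
  filter_upwards [ae_cut_eq_zero measurableSet_ball f] with p hp h
  exact hp (by simpa using h)

/-- Approximate minimizers of bounded support. -/
theorem HasFourier.exists_approx_minimizer (h : HasFourier V W) (m : ℝ≥0∞)
    (hne : ∃ f ∈ schrodingerDomain d m, f ≠ 0) {η : ℝ} (hη : 0 < η) :
    ∃ (R : ℝ) (g : Lp ℂ 2 (volume : Measure (E d))), 0 < R ∧ (∀ᵐ p, R ≤ ‖p‖ → g p = 0) ∧
      invTwoMass m * kin g + (pot W g g).re < (schrodingerEnergy V m + η) * ‖g‖ ^ 2 := by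
  have hG := h.schrodingerEnergy_isGreatest m hne
  set ε := schrodingerEnergy V m
  have hnot : ¬ ∀ f ∈ schrodingerDomain d m,
      (ε + η) * ‖f‖ ^ 2 ≤ invTwoMass m * kin f + (pot W f f).re := fun hall => by
    have : ε + η ≤ ε := hG.2 hall
    linarith
  push Not at hnot
  obtain ⟨f, hf, hfe⟩ := hnot
  set N := ∫ ξ, ‖W ξ‖
  have hN0 : 0 ≤ N := integral_norm_nonneg W
  let y : ℕ → ℝ := fun n => ‖cut (measurableSet_ball (x := (0 : E d)) (ε := (n : ℝ))).compl f‖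
  have hy : Tendsto y atTop (𝓝 0) := by
    have h1 : Tendsto (fun n : ℕ => ∫ p in Metric.ball (0 : E d) (n : ℝ), ‖f p‖ ^ 2) atTop
        (𝓝 (∫ p, ‖f p‖ ^ 2)) :=
      (aecover_ball tendsto_natCast_atTop_atTop).integral_tendsto_of_countably_generated
        (integrable_norm_sq f)
    have h2 : ∀ n, y n = √((∫ p, ‖f p‖ ^ 2) - ∫ p in Metric.ball (0 : E d) (n : ℝ), ‖f p‖ ^ 2) := by
      intro n
      have := norm_sq_cut_add (measurableSet_ball (x := (0 : E d)) (ε := (n : ℝ))) f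
      rw [norm_sq_cut, norm_sq_eq_integral f] at this
      rw [← this, add_sub_cancel_left, Real.sqrt_sq (norm_nonneg _)]
    simp only [funext h2]
    have h3 := (h1.const_sub (∫ p, ‖f p‖ ^ 2)).sqrt
    simpa using h3
  -- With `y n` the norm of the part of `f` beyond radius `n`, truncation raises the potential
  -- energy by at most `3N‖f‖ y n`, lowers the squared norm by `(y n)²`, and does not raise the
  -- kinetic term.
  have hlim : Tendsto (fun n => invTwoMass m * kin f + (pot W f f).re + 3 * N * ‖f‖ * y n
      - (ε + η) * (‖f‖ ^ 2 - y n ^ 2)) atTop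
      (𝓝 (invTwoMass m * kin f + (pot W f f).re + 3 * N * ‖f‖ * 0
        - (ε + η) * (‖f‖ ^ 2 - 0 ^ 2))) :=
    ((hy.const_mul _).const_add _).sub (((hy.pow 2).const_sub _).const_mul _)
  have hev := hlim.eventually (gt_mem_nhds (show _ < (0 : ℝ) by simpa using hfe))
  obtain ⟨n, hn, hn1⟩ := (hev.and (eventually_ge_atTop 1)).exists
  set R : ℝ := (n : ℝ)
  have hR : 0 < R := by
    have : (1 : ℝ) ≤ n := by exact_mod_cast hn1
    exact lt_of_lt_of_le one_pos this
  have hs : MeasurableSet (Metric.ball (0 : E d) R) := measurableSet_ball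
  refine ⟨R, cut hs f, hR, ae_cut_ball_eq_zero R f, ?_⟩
  set f1 := cut hs f
  have hyn : y n = ‖cut hs.compl f‖ := rfl
  set f2 := cut hs.compl f
  have hsum : f1 + f2 = f := cut_add_cut_compl hs f
  have h2 := (abs_le.1 (h.abs_pot_re_le f1 f2)).1
  have h3 := (abs_le.1 (h.abs_pot_re_le f2 f2)).1
  have h4 := h.pot_add_re f1 f2
  rw [hsum] at h4
  have hf1 : ‖f1‖ ≤ ‖f‖ := norm_cut_le hs f
  have hf2 : ‖f2‖ ≤ ‖f‖ := norm_cut_le hs.compl f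
  have e2 : N * ‖f1‖ * ‖f2‖ ≤ N * ‖f‖ * ‖f2‖ := by gcongr
  have e3 : N * ‖f2‖ * ‖f2‖ ≤ N * ‖f‖ * ‖f2‖ := by gcongr
  have hkin : invTwoMass m * kin f1 ≤ invTwoMass m * kin f := by
    -- When the coefficient vanishes (infinite mass), the form domain is all of `L²` and `kin f` may
    -- be the default value `0` of a divergent integral; the factor `0` makes this harmless.
    by_cases hm : invTwoMass m = 0
    · rw [hm]; simp
    · refine mul_le_mul_of_nonneg_left ?_ (invTwoMass_nonneg m)
      have hint := integrable_of_mem_schrodingerDomain hf hm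
      refine integral_mono_ae (integrable_kin_of_bounded_support (ae_cut_ball_eq_zero R f)) hint ?_
      filter_upwards [coeFn_cut hs f] with p hp
      rw [hp]
      gcongr
      exact norm_indicator_le_norm_self _ _
  have hnorm := norm_sq_cut_add hs f
  change ‖f1‖ ^ 2 + ‖f2‖ ^ 2 = _ at hnorm
  have : ‖f1‖ ^ 2 = ‖f‖ ^ 2 - y n ^ 2 := by rw [hyn]; linarith
  rw [this]
  rw [hyn] at hn ⊢
  nlinarith

set_option maxHeartbeats 800000 in
/-- Bounding the kinetic energy at high momenta changes the ground state energy only little. -/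
theorem HasFourier.exists_cutoff_lower_bound (h : HasFourier V W) (m : ℝ≥0∞)
    (hne : ∃ f ∈ schrodingerDomain d m, f ≠ 0) {η : ℝ} (hη : 0 < η) :
    ∃ δ₀ : ℝ, 0 < δ₀ ∧ ∀ δ : ℝ, 0 < δ → δ ≤ δ₀ → ∀ f : Lp ℂ 2 (volume : Measure (E d)),
      (schrodingerEnergy V m - η) * ‖f‖ ^ 2 ≤
        invTwoMass m * (∫ p, ‖p‖ ^ 2 / (1 + δ * ‖p‖ ^ 2) * ‖f p‖ ^ 2) + (pot W f f).re := by
  have hG := h.schrodingerEnergy_isGreatest m hne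
  set ε := schrodingerEnergy V m
  set a := invTwoMass m with ha
  have ha0 : 0 ≤ a := invTwoMass_nonneg m
  rcases ha0.eq_or_lt with haz | hapos
  -- Without a kinetic term (infinite mass) there is nothing to cut off.
  · refine ⟨1, one_pos, fun δ _ _ f => ?_⟩
    have hf : f ∈ schrodingerDomain d m := by
      change Integrable _ _
      simp [← ha, ← haz]
    have := hG.1 f hf
    rw [← haz] at this ⊢
    nlinarith [sq_nonneg ‖f‖]
  set N := ∫ ξ, ‖W ξ‖
  have hN0 : 0 ≤ N := integral_norm_nonneg W
  -- `L` is the kinetic energy per unit of squared norm that the part above momentum `R` must have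
  -- to pay for its share of `ε`, for its own potential energy, and for its cross term with the low
  -- part. The radius `R` is chosen so that `a R² / 2 ≥ L`.
  set L := |ε| + N + 2 * N ^ 2 / η with hL
  have hL0 : 0 ≤ L := by positivity
  set R := √(2 * L / a) + 1 with hRdef
  have hR : 0 < R := by positivity
  have hRL : L ≤ a * R ^ 2 / 2 := by
    have h1 : 2 * L / a ≤ R ^ 2 := by
      calc 2 * L / a = √(2 * L / a) ^ 2 := (Real.sq_sqrt (by positivity)).symm
        _ ≤ R ^ 2 := by gcongr; linarith
    rw [div_le_iff₀ hapos] at h1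
    linarith
  -- The first bound on `δ` keeps the cut-off kinetic energy at least `R² / 2` beyond `R`; the
  -- second makes the loss `a δ R⁴` inside the ball at most `η / 2`.
  refine ⟨min (1 / R ^ 2) (η / (2 * a * R ^ 4)), lt_min (by positivity) (by positivity),
    fun δ hδ hδ0 f => ?_⟩
  have hδ1 : δ * R ^ 2 ≤ 1 := by
    have := hδ0.trans (min_le_left _ _)
    rwa [le_div_iff₀ (by positivity)] at this
  have hδ2 : a * δ * R ^ 4 ≤ η / 2 := by
    have := hδ0.trans (min_le_right _ _)
    rw [le_div_iff₀ (by positivity)] at this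
    linarith
  have hs : MeasurableSet (Metric.ball (0 : E d) R) := measurableSet_ball
  set f1 := cut hs f with hf1def
  set f2 := cut hs.compl f with hf2def
  have hsum : f1 + f2 = f := cut_add_cut_compl hs f
  have h2 := (abs_le.1 (h.abs_pot_re_le f1 f2)).1
  have h3 := (abs_le.1 (h.abs_pot_re_le f2 f2)).1
  have h4 := h.pot_add_re f1 f2
  rw [hsum] at h4
  have hnorm := norm_sq_cut_add hs f
  change ‖f1‖ ^ 2 + ‖f2‖ ^ 2 = _ at hnorm
  have hpos : ∀ p : E d, 0 < 1 + δ * ‖p‖ ^ 2 := fun p => by positivity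
  have hintT : Integrable fun p => ‖p‖ ^ 2 / (1 + δ * ‖p‖ ^ 2) * ‖f p‖ ^ 2 := by
    refine Integrable.mono' ((integrable_norm_sq f).const_mul (1 / δ))
      (AEStronglyMeasurable.mul (Measurable.aestronglyMeasurable (by fun_prop))
        ((Lp.aestronglyMeasurable f).norm.pow 2)) (Eventually.of_forall fun p => ?_)
    rw [norm_mul, Real.norm_of_nonneg (by positivity), Real.norm_of_nonneg (by positivity)]
    gcongr ?_ * _
    rw [div_le_div_iff₀ (hpos p) hδ]
    nlinarith
  have hint1 : Integrable fun p => ‖p‖ ^ 2 * ‖f1 p‖ ^ 2 :=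
    integrable_kin_of_bounded_support (ae_cut_ball_eq_zero R f)
  have hint2 : Integrable fun p => ‖p‖ ^ 2 * ‖f1 p‖ ^ 2 - δ * R ^ 4 * ‖f1 p‖ ^ 2 :=
    hint1.sub ((integrable_norm_sq f1).const_mul _)
  have hfe := hG.1 f1 (mem_schrodingerDomain m hint1)
  have hT : kin f1 - δ * R ^ 4 * ‖f1‖ ^ 2 + R ^ 2 / 2 * ‖f2‖ ^ 2 ≤
      ∫ p, ‖p‖ ^ 2 / (1 + δ * ‖p‖ ^ 2) * ‖f p‖ ^ 2 := by
    rw [norm_sq_eq_integral f1, norm_sq_eq_integral f2, kin, ← integral_const_mul,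
      ← integral_const_mul, ← integral_sub hint1 ((integrable_norm_sq f1).const_mul _),
      ← integral_add hint2 ((integrable_norm_sq f2).const_mul _)]
    refine integral_mono_ae (hint2.add ((integrable_norm_sq f2).const_mul _)) hintT ?_
    filter_upwards [coeFn_cut hs f, coeFn_cut hs.compl f] with p hp1 hp2
    simp only [← hf1def, ← hf2def] at hp1 hp2
    simp only [hp1, hp2]
    by_cases hp : p ∈ Metric.ball (0 : E d) R
    · have hp' : ‖p‖ < R := by simpa using hp
      rw [Set.indicator_of_mem hp, Set.indicator_of_notMem
        (show p ∉ (Metric.ball (0 : E d) R)ᶜ from not_not.2 hp)]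
      simp only [norm_zero]
      rw [zero_pow two_ne_zero, mul_zero, add_zero, ← sub_mul]
      gcongr ?_ * _
      rw [le_div_iff₀ (hpos p)]
      have h5 : ‖p‖ ^ 4 ≤ R ^ 4 := by gcongr
      have h6 : ‖p‖ ^ 2 ≤ R ^ 2 := by gcongr
      have h7 : 0 ≤ δ * (R ^ 4 - ‖p‖ ^ 4) := mul_nonneg hδ.le (by linarith)
      have h8 : 0 ≤ δ * R ^ 4 * (δ * ‖p‖ ^ 2) := by positivity
      nlinarith
    · have hp' : R ≤ ‖p‖ := by simpa using hp
      rw [Set.indicator_of_notMem hp, Set.indicator_of_mem (show p ∈ (Metric.ball 0 R)ᶜ from hp)]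
      simp only [norm_zero]
      rw [zero_pow two_ne_zero, mul_zero, mul_zero, sub_zero, zero_add]
      gcongr ?_ * _
      rw [le_div_iff₀ (hpos p)]
      have h6 : R ^ 2 ≤ ‖p‖ ^ 2 := by gcongr
      nlinarith [mul_le_mul_of_nonneg_right hδ1 (sq_nonneg ‖p‖)]
  have hT' := mul_le_mul_of_nonneg_left hT ha0
  set x := ‖f1‖
  set y := ‖f2‖
  have hx : 0 ≤ x := norm_nonneg _
  have hy : 0 ≤ y := norm_nonneg _
  -- Young's inequality, weighted so that the low-momentum part is charged only `η / 2`; the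
  -- coefficient of `y²` is the last term of `L`.
  have hcross : 2 * (N * x * y) ≤ η / 2 * x ^ 2 + 2 * N ^ 2 / η * y ^ 2 := by
    have h5 : 0 ≤ (η * x - 2 * N * y) ^ 2 / (2 * η) := by positivity
    have h6 : (η * x - 2 * N * y) ^ 2 / (2 * η) =
        η / 2 * x ^ 2 + 2 * N ^ 2 / η * y ^ 2 - 2 * (N * x * y) := by
      field_simp; ring
    linarith
  have hLy : L * y ^ 2 ≤ a * R ^ 2 / 2 * y ^ 2 := by gcongr
  have hLe : L * y ^ 2 = |ε| * y ^ 2 + N * y ^ 2 + 2 * N ^ 2 / η * y ^ 2 := by rw [hL]; ring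
  have hεy : ε * y ^ 2 ≤ |ε| * y ^ 2 := by gcongr; exact le_abs_self ε
  have hδx : a * δ * R ^ 4 * x ^ 2 ≤ η / 2 * x ^ 2 := by gcongr
  have hηy : 0 ≤ η * y ^ 2 := by positivity
  have hηx : 0 ≤ η * x ^ 2 := by positivity
  have hδx' : a * (δ * R ^ 4 * x ^ 2) ≤ η / 2 * x ^ 2 := by linarith
  have h2' : -(N * x * y) ≤ (pot W f1 f2).re := h2
  have h3' : -(N * y * y) ≤ (pot W f2 f2).re := h3
  rw [← hnorm, h4]
  linarith

end OneParticle

/-! ### Scaling of momenta. -/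

section Dilation

variable {d : ℕ} {V : E d → ℝ} {W : E d → ℂ}

/-- The form of the potential `V(s x)`. -/
noncomputable def potScaled (W : E d → ℂ) (s : ℝ) (f g : Lp ℂ 2 (volume : Measure (E d))) : ℂ :=
  shiftForm W (fun ξ p => p - (2 * Real.pi * s) • ξ) volume f g

/-- The Jacobian of `p ↦ s p`. -/
noncomputable def jac (d : ℕ) (s : ℝ) : ℝ := |(s ^ Module.finrank ℝ (E d))⁻¹|

theorem jac_pos {s : ℝ} (hs : 0 < s) : 0 < jac d s := by
  unfold jac; positivity

theorem memLp_dilate {s : ℝ} (hs : 0 < s) (f : Lp ℂ 2 (volume : Measure (E d))) :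
    MemLp (fun p => f (s • p)) 2 (volume : Measure (E d)) := by
  have hq := Measure.quasiMeasurePreserving_smul (volume : Measure (E d)) hs.ne'
  refine (memLp_two_iff_integrable_sq_norm
    ((Lp.aestronglyMeasurable f).comp_quasiMeasurePreserving hq)).2 ?_
  exact (integrable_norm_sq f).comp_smul hs.ne'

/-- The function `p ↦ f(s p)`. -/
noncomputable def dilate {s : ℝ} (hs : 0 < s) (f : Lp ℂ 2 (volume : Measure (E d))) :
    Lp ℂ 2 (volume : Measure (E d)) :=
  (memLp_dilate hs f).toLp _

theorem coeFn_dilate {s : ℝ} (hs : 0 < s) (f : Lp ℂ 2 (volume : Measure (E d))) :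
    dilate hs f =ᵐ[volume] fun p => f (s • p) := MemLp.coeFn_toLp _

theorem integral_dilate {s : ℝ} (hs : 0 < s) (f : Lp ℂ 2 (volume : Measure (E d)))
    (w : E d → ℝ) :
    ∫ p, w p * ‖dilate hs f p‖ ^ 2 = jac d s * ∫ p, w (s⁻¹ • p) * ‖f p‖ ^ 2 := by
  have h := Measure.integral_comp_smul (volume : Measure (E d))
    (fun p => w (s⁻¹ • p) * ‖f p‖ ^ 2) s
  rw [smul_eq_mul] at h
  unfold jac
  rw [← h]
  refine integral_congr_ae ?_
  filter_upwards [coeFn_dilate hs f] with p hp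
  rw [hp, smul_smul, inv_mul_cancel₀ hs.ne', one_smul]

theorem norm_sq_dilate {s : ℝ} (hs : 0 < s) (f : Lp ℂ 2 (volume : Measure (E d))) :
    ‖dilate hs f‖ ^ 2 = jac d s * ‖f‖ ^ 2 := by
  have := integral_dilate hs f (fun _ => 1)
  simp only [one_mul] at this
  rw [norm_sq_eq_integral, norm_sq_eq_integral, this]

/-- Shifting `f(s ·)` by `2πξ` amounts to shifting `f` by `2πsξ`. The Jacobian is the same as for
the norm and for the kinetic energy, so it drops out of all energy inequalities. -/
theorem pot_dilate {s : ℝ} (hs : 0 < s) (f g : Lp ℂ 2 (volume : Measure (E d))) :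
    pot W (dilate hs f) (dilate hs g) = jac d s * potScaled W s f g := by
  unfold pot potScaled
  rw [shiftForm_congr (isShift_translate (2 * Real.pi)) (coeFn_dilate hs f) (coeFn_dilate hs g)]
  unfold shiftForm
  rw [← integral_const_mul]
  congr 1; funext ξ
  have h := Measure.integral_comp_smul (volume : Measure (E d))
    (fun p => conj (f p) * g (p - (2 * Real.pi * s) • ξ)) s
  rw [Complex.real_smul] at h
  have h2 : ∀ p : E d, s • (p - (2 * Real.pi) • ξ) = s • p - (2 * Real.pi * s) • ξ := fun p => by
    rw [smul_sub, smul_smul, mul_comm s]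
  simp only [h2, h]
  unfold jac
  ring

theorem dilate_dilate_inv {s : ℝ} (hs : 0 < s) (f : Lp ℂ 2 (volume : Measure (E d))) :
    dilate hs (dilate (inv_pos.2 hs) f) = f := by
  refine Lp.ext ?_
  have hq := Measure.quasiMeasurePreserving_smul (volume : Measure (E d)) hs.ne'
  filter_upwards [coeFn_dilate hs (dilate (inv_pos.2 hs) f),
    hq.ae (coeFn_dilate (inv_pos.2 hs) f)] with p h1 h2
  rw [h1, h2, smul_smul, inv_mul_cancel₀ hs.ne', one_smul]

/-- In momenta measured in units of `s`, the saturated kinetic energy with constant `C` is `s²`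
times the one with constant `C s²`. The cutoff bound applies once `C s² ≤ δ₀`. -/
theorem HasFourier.exists_scaled_lower_bound (h : HasFourier V W) (m : ℝ≥0∞)
    (hne : ∃ f ∈ schrodingerDomain d m, f ≠ 0) {C : ℝ} (hC : 0 < C) {η : ℝ} (hη : 0 < η) :
    ∃ s₀ : ℝ, 0 < s₀ ∧ ∀ s : ℝ, 0 < s → s ≤ s₀ → ∀ f : Lp ℂ 2 (volume : Measure (E d)),
      s ^ 2 * (schrodingerEnergy V m - η) * ‖f‖ ^ 2 ≤
        (∫ p, invTwoMass m * (‖p‖ ^ 2 / (1 + C * ‖p‖ ^ 2)) * ‖f p‖ ^ 2)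
          + s ^ 2 * (potScaled W s f f).re := by
  obtain ⟨δ₀, hδ₀, hlow⟩ := h.exists_cutoff_lower_bound m hne hη
  refine ⟨√(δ₀ / C), by positivity, fun s hs hs0 f => ?_⟩
  have hδ : C * s ^ 2 ≤ δ₀ := by
    have h1 : s ^ 2 ≤ √(δ₀ / C) ^ 2 := by gcongr
    rw [Real.sq_sqrt (by positivity), le_div_iff₀ hC] at h1
    linarith
  have hb := hlow (C * s ^ 2) (by positivity) hδ (dilate hs f)
  rw [norm_sq_dilate, pot_dilate, integral_dilate] at hb
  have hint : ∫ p, ‖s⁻¹ • p‖ ^ 2 / (1 + C * s ^ 2 * ‖s⁻¹ • p‖ ^ 2) * ‖f p‖ ^ 2 =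
      (s ^ 2)⁻¹ * ∫ p, ‖p‖ ^ 2 / (1 + C * ‖p‖ ^ 2) * ‖f p‖ ^ 2 := by
    rw [← integral_const_mul]
    congr 1; funext p
    rw [norm_smul, mul_pow, Real.norm_of_nonneg (inv_pos.2 hs).le]
    have : 0 < 1 + C * ‖p‖ ^ 2 := by positivity
    field_simp
  rw [hint, Complex.re_ofReal_mul] at hb
  have hj := jac_pos (d := d) hs
  have hint2 : (∫ p, invTwoMass m * (‖p‖ ^ 2 / (1 + C * ‖p‖ ^ 2)) * ‖f p‖ ^ 2) =
      invTwoMass m * ∫ p, ‖p‖ ^ 2 / (1 + C * ‖p‖ ^ 2) * ‖f p‖ ^ 2 := by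
    rw [← integral_const_mul]
    simp only [mul_assoc]
  rw [hint2]
  set I := ∫ p, ‖p‖ ^ 2 / (1 + C * ‖p‖ ^ 2) * ‖f p‖ ^ 2
  refine le_of_mul_le_mul_left ?_ hj
  have hs2 : 0 < s ^ 2 := by positivity
  calc jac d s * (s ^ 2 * (schrodingerEnergy V m - η) * ‖f‖ ^ 2)
      = s ^ 2 * ((schrodingerEnergy V m - η) * (jac d s * ‖f‖ ^ 2)) := by ring
    _ ≤ s ^ 2 * (invTwoMass m * (jac d s * ((s ^ 2)⁻¹ * I)) + jac d s * (potScaled W s f f).re) := by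
        gcongr
    _ = _ := by field_simp

end Dilation

/-! ### Measurability on the space of configurations -/

section Config

variable {d : ℕ}

open Classical in
/-- The momenta of a configuration of `n` bosons. -/
noncomputable def momenta (n : ℕ) (c : Config d) : Fin n → E d :=
  if h : c.1 = n then h ▸ c.2 else 0

theorem momenta_mk (n : ℕ) (K : Fin n → E d) : momenta n ⟨n, K⟩ = K := by simp [momenta]

theorem mk_momenta {n : ℕ} {c : Config d} (h : c.1 = n) : (⟨n, momenta n c⟩ : Config d) = c := by
  obtain ⟨m, K⟩ := c
  subst h
  rw [momenta_mk]

theorem measurable_momenta (n : ℕ) : Measurable (momenta n : Config d → Fin n → E d) := by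
  refine measurable_sigma fun m => ?_
  by_cases h : m = n
  · subst h
    simpa only [momenta_mk] using! measurable_id
  · have : (fun K : Fin m → E d => momenta n ⟨m, K⟩) = fun _ => 0 := by
      funext K; simp [momenta, h]
    rw [this]; exact measurable_const

theorem measurable_number : Measurable (Sigma.fst : Config d → ℕ) :=
  measurable_sigma fun _ => measurable_const

/-- The countably many sets with a fixed boson number are measurable, and on each of them the
configuration is a measurable function of the momenta. This handles products with the disjoint union
of sectors. -/
theorem measurable_of_sectors {A β : Type*} [MeasurableSpace A] [MeasurableSpace β]
    {f : A × Config d → β}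
    (h : ∀ n, Measurable fun z : A × (Fin n → E d) => f (z.1, ⟨n, z.2⟩)) : Measurable f := by
  intro s hs
  have : f ⁻¹' s = ⋃ n : ℕ, ({z : A × Config d | z.2.1 = n} ∩
      (fun z : A × Config d => f (z.1, ⟨n, momenta n z.2⟩)) ⁻¹' s) := by
    ext z
    simp only [Set.mem_preimage, Set.mem_iUnion, Set.mem_inter_iff, Set.mem_ofPred_eq]
    constructor
    · intro hz
      exact ⟨z.2.1, rfl, by rwa [mk_momenta rfl]⟩
    · rintro ⟨n, hn, hz⟩
      rwa [mk_momenta hn] at hz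
  rw [this]
  refine MeasurableSet.iUnion fun n => MeasurableSet.inter ?_ ?_
  · exact (measurable_number.comp measurable_snd) (measurableSet_singleton n)
  · have h2 : Measurable fun z : A × Config d => (z.1, momenta n z.2) :=
      measurable_fst.prodMk ((measurable_momenta n).comp measurable_snd)
    exact ((h n).comp h2) hs

theorem measurable_fin_cons (n : ℕ) :
    Measurable fun z : E d × (Fin n → E d) => (Fin.cons z.1 z.2 : Fin (n + 1) → E d) := by
  refine measurable_pi_lambda _ fun i => ?_
  refine Fin.cases ?_ (fun j => ?_) i
  · simpa using measurable_fst
  · simpa using! (measurable_pi_apply j).comp measurable_snd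

theorem measurable_cons : Measurable fun z : E d × Config d => cons z.1 z.2 :=
  measurable_of_sectors fun n => (measurable_sigmaMk (n + 1)).comp (measurable_fin_cons n)

theorem measurable_fieldMomentum : Measurable (fieldMomentum : Config d → E d) := by
  refine measurable_sigma fun n => ?_
  change Measurable fun K : Fin n → E d => ∑ i : Fin n, K i
  fun_prop

theorem measurable_fieldEnergy {ω : E d → ℝ} (hω : Measurable ω) :
    Measurable (fieldEnergy ω : Config d → ℝ) := by
  refine measurable_sigma fun n => ?_
  change Measurable fun K : Fin n → E d => ∑ i : Fin n, ω (K i)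
  fun_prop

theorem fieldMomentum_cons (k : E d) (c : Config d) :
    fieldMomentum (cons k c) = k + fieldMomentum c := by
  unfold fieldMomentum cons
  rw [Fin.sum_univ_succ]
  rfl

theorem fieldMomentum_permute (σ : ∀ n : ℕ, Equiv.Perm (Fin n)) (c : Config d) :
    fieldMomentum (permute σ c) = fieldMomentum c :=
  Equiv.sum_comp (σ c.1) c.2

theorem measurableEmbedding_sigmaMk (n : ℕ) :
    MeasurableEmbedding (fun K : Fin n → E d => (⟨n, K⟩ : Config d)) := by
  refine MeasurableEmbedding.of_measurable_inverse (measurable_sigmaMk n) ?_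
    (measurable_momenta n) (momenta_mk n)
  have : Set.range (fun K : Fin n → E d => (⟨n, K⟩ : Config d)) = Sigma.fst ⁻¹' {n} := by
    ext c
    simp only [Set.mem_range, Set.mem_preimage, Set.mem_singleton_iff]
    constructor
    · rintro ⟨K, rfl⟩; rfl
    · intro h; exact ⟨momenta n c, mk_momenta h⟩
  rw [this]
  exact measurable_number (measurableSet_singleton n)

theorem ae_config_iff {p : Config d → Prop} :
    (∀ᵐ c ∂(configMeasure d), p c) ↔
      ∀ n, ∀ᵐ K ∂(volume : Measure (Fin n → E d)), p ⟨n, K⟩ := by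
  unfold configMeasure
  rw [Measure.ae_sum_iff]
  simp only [(measurableEmbedding_sigmaMk _).ae_map_iff]

/-- Adding a boson carries the measure of sector `n` exactly to that of sector `n + 1`. The vacuum
is not reached, so the map does not preserve the whole measure but only pulls null sets back to null
sets. -/
theorem quasiMeasurePreserving_cons :
    Measure.QuasiMeasurePreserving (fun z : E d × Config d => cons z.1 z.2)
      (totalMeasure d) (configMeasure d) := by
  refine ⟨measurable_cons, ?_⟩
  unfold totalMeasure
  nth_rewrite 1 [configMeasure]
  rw [Measure.prod_sum_right, Measure.map_sum measurable_cons.aemeasurable]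
  refine Measure.absolutelyContinuous_sum_left fun n => ?_
  have h1 : (volume : Measure (E d)).prod
      (Measure.map (fun K : Fin n → E d => (⟨n, K⟩ : Config d)) volume) =
      Measure.map (Prod.map id fun K : Fin n → E d => (⟨n, K⟩ : Config d))
        (volume.prod volume) := by
    rw [← Measure.map_prod_map _ _ measurable_id (measurable_sigmaMk n), Measure.map_id]
  have h2 : MeasurePreserving (fun z : E d × (Fin n → E d) => (Fin.cons z.1 z.2 : Fin (n + 1) → E d))
      (volume.prod volume) volume := by
    have h := (volume_preserving_piFinSuccAbove (fun _ : Fin (n + 1) => E d) 0).symm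
    have h' : ⇑(MeasurableEquiv.piFinSuccAbove (fun _ : Fin (n + 1) => E d) 0).symm =
        fun z : E d × (Fin n → E d) => (Fin.cons z.1 z.2 : Fin (n + 1) → E d) := by
      funext z
      exact Fin.insertNth_zero' z.1 z.2
    rw [h'] at h
    exact h
  rw [h1, Measure.map_map measurable_cons (measurable_id.prodMap (measurable_sigmaMk n))]
  have h3 : (fun z : E d × Config d => cons z.1 z.2) ∘
      (Prod.map id fun K : Fin n → E d => (⟨n, K⟩ : Config d)) =
      (fun K : Fin (n + 1) → E d => (⟨n + 1, K⟩ : Config d)) ∘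
        fun z : E d × (Fin n → E d) => (Fin.cons z.1 z.2 : Fin (n + 1) → E d) := rfl
  rw [h3, ← Measure.map_map (measurable_sigmaMk (n + 1)) h2.measurable, h2.map_eq]
  exact Measure.absolutelyContinuous_of_le (Measure.le_sum _ (n + 1))

theorem fieldEnergy_nonneg {ω : E d → ℝ} (hω : ∀ᵐ k, 0 ≤ ω k) :
    ∀ᵐ c ∂(configMeasure d), 0 ≤ fieldEnergy ω c := by
  rw [ae_config_iff]
  intro n
  have h : ∀ i : Fin n, ∀ᵐ K : Fin n → E d, 0 ≤ ω (K i) := fun i =>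
    (Measure.quasiMeasurePreserving_eval (fun _ => (volume : Measure (E d))) i).ae hω
  filter_upwards [eventually_all.2 h] with K hK
  exact Finset.sum_nonneg fun i _ => hK i

/-! ### Symmetric functions -/

/-- The permutation that acts by `τ` in the sector of `n` bosons only. -/
def sectorPerm (z : Σ n : ℕ, Equiv.Perm (Fin n)) : ∀ n : ℕ, Equiv.Perm (Fin n) :=
  Function.update (fun _ => 1) z.1 z.2

theorem permute_sectorPerm (σ : ∀ n : ℕ, Equiv.Perm (Fin n)) (c : Config d) :
    permute (sectorPerm ⟨c.1, σ c.1⟩) c = permute σ c := by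
  simp [permute, sectorPerm]

/-- There are uncountably many families `σ`, but at a given point only the permutation in one sector
acts. The pairs (sector, permutation) are countable, so the quantifier over `σ` may be moved inside
"almost everywhere". -/
theorem ae_forall_permute {X : Type*} [MeasurableSpace X] {μ : Measure X} (number : X → ℕ)
    (act : (∀ n : ℕ, Equiv.Perm (Fin n)) → X → X)
    (hact : ∀ σ x, act (sectorPerm ⟨number x, σ (number x)⟩) x = act σ x) {f : X → ℂ}
    (hf : ∀ σ, ∀ᵐ x ∂μ, f (act σ x) = f x) : ∀ᵐ x ∂μ, ∀ σ, f (act σ x) = f x := by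
  have h : ∀ z : Σ n : ℕ, Equiv.Perm (Fin n), ∀ᵐ x ∂μ, f (act (sectorPerm z) x) = f x :=
    fun z => hf _
  filter_upwards [ae_all_iff.2 h] with x hx σ
  rw [← hact, hx]

theorem mem_Fock_iff {f : Lp ℂ 2 (configMeasure d)} :
    f ∈ Fock d ↔ ∀ᵐ c ∂(configMeasure d), ∀ σ, f (permute σ c) = f c := by
  have key : ∀ σ, Lp.compMeasurePreservingₗᵢ ℂ (permute σ) (measurePreserving_permute σ) f = f ↔
      ∀ᵐ c ∂(configMeasure d), f (permute σ c) = f c := fun σ => by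
    have h := Lp.coeFn_compMeasurePreserving f (measurePreserving_permute (d := d) σ)
    change Lp.compMeasurePreserving _ _ f = f ↔ _
    constructor
    · intro e
      rw [e] at h
      filter_upwards [h] with c hc
      exact hc.symm
    · intro e
      refine Lp.ext ?_
      filter_upwards [h, e] with c h1 h2
      rw [h1]; exact h2
  simp only [Fock, Submodule.mem_iInf, LinearMap.mem_eqLocus]
  constructor
  · intro hf
    exact ae_forall_permute Sigma.fst permute permute_sectorPerm fun σ => (key σ).1 (hf σ)
  · intro hf σ
    exact (key σ).2 (hf.mono fun c hc => hc σ)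

theorem mem_Total_iff {f : Lp ℂ 2 (totalMeasure d)} :
    f ∈ Total d ↔ ∀ᵐ z ∂(totalMeasure d), ∀ σ, f (z.1, permute σ z.2) = f z := by
  have key : ∀ σ, Lp.compMeasurePreservingₗᵢ ℂ (Prod.map id (permute σ))
      (measurePreserving_prod_permute σ) f = f ↔
      ∀ᵐ z ∂(totalMeasure d), f (z.1, permute σ z.2) = f z := fun σ => by
    have h := Lp.coeFn_compMeasurePreserving f (measurePreserving_prod_permute (d := d) σ)
    change Lp.compMeasurePreserving _ _ f = f ↔ _
    constructor
    · intro e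
      rw [e] at h
      filter_upwards [h] with c hc
      exact hc.symm
    · intro e
      refine Lp.ext ?_
      filter_upwards [h, e] with c h1 h2
      rw [h1]; exact h2
  simp only [Total, Submodule.mem_iInf, LinearMap.mem_eqLocus]
  constructor
  · intro hf
    refine ae_forall_permute (fun z : E d × Config d => z.2.1) (fun σ z => (z.1, permute σ z.2))
      (fun σ z => ?_) fun σ => (key σ).1 (hf σ)
    rw [permute_sectorPerm]
  · intro hf σ
    exact (key σ).2 (hf.mono fun c hc => hc σ)

end Config

/-! ### Creation and annihilation terms -/

section Creation

variable {X Y : Type*} [MeasurableSpace X] [MeasurableSpace Y] {μ : Measure X} {ν : Measure Y}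

/-- The form of a creation operator and its adjoint. -/
noncomputable def creationForm (u : Y → ℂ) (a b : Y → X) (ν : Measure Y) (χ Ψ : Lp ℂ 2 μ) : ℂ :=
  (∫ y, u y * (conj (χ (a y)) * Ψ (b y)) ∂ν) + conj (∫ y, u y * (conj (Ψ (a y)) * χ (b y)) ∂ν)

/-- Here `a` and `b` stand for the states after and before an emission, so that the full Hamiltonian
and its fibers are treated at once. The second summand is the conjugate of the first with the
arguments exchanged, whence symmetry. -/
theorem isHermitianForm_creationForm {Q : Submodule ℂ (Lp ℂ 2 μ)} {u : Y → ℂ} {a b : Y → X}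
    (ha : Measure.QuasiMeasurePreserving a ν μ) (hb : Measure.QuasiMeasurePreserving b ν μ)
    (hint : ∀ χ ∈ Q, ∀ Ψ ∈ Q, Integrable (fun y => u y * (conj (χ (a y)) * Ψ (b y))) ν) :
    IsHermitianForm Q (creationForm u a b ν) where
  conj_symm χ Ψ := by
    unfold creationForm
    rw [map_add, Complex.conj_conj, add_comm]
  add_right χ h1 Ψ h2 Ψ' h3 := by
    unfold creationForm
    have e1 : ∫ y, u y * (conj (χ (a y)) * (Ψ + Ψ' : Lp ℂ 2 μ) (b y)) ∂ν =
        (∫ y, u y * (conj (χ (a y)) * Ψ (b y)) ∂ν) + ∫ y, u y * (conj (χ (a y)) * Ψ' (b y)) ∂ν := by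
      rw [← integral_add (hint χ h1 Ψ h2) (hint χ h1 Ψ' h3)]
      refine integral_congr_ae ?_
      filter_upwards [hb.ae (Lp.coeFn_add Ψ Ψ')] with y hy
      simp only [hy, Pi.add_apply]; ring
    have e2 : ∫ y, u y * (conj ((Ψ + Ψ' : Lp ℂ 2 μ) (a y)) * χ (b y)) ∂ν =
        (∫ y, u y * (conj (Ψ (a y)) * χ (b y)) ∂ν) + ∫ y, u y * (conj (Ψ' (a y)) * χ (b y)) ∂ν := by
      rw [← integral_add (hint Ψ h2 χ h1) (hint Ψ' h3 χ h1)]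
      refine integral_congr_ae ?_
      filter_upwards [ha.ae (Lp.coeFn_add Ψ Ψ')] with y hy
      simp only [hy, Pi.add_apply, map_add]; ring
    rw [e1, e2, map_add]; ring
  smul_right χ h1 Ψ h2 c := by
    unfold creationForm
    have e1 : ∫ y, u y * (conj (χ (a y)) * (c • Ψ : Lp ℂ 2 μ) (b y)) ∂ν =
        c * ∫ y, u y * (conj (χ (a y)) * Ψ (b y)) ∂ν := by
      rw [← integral_const_mul]
      refine integral_congr_ae ?_
      filter_upwards [hb.ae (Lp.coeFn_smul c Ψ)] with y hy
      simp only [hy, Pi.smul_apply, smul_eq_mul]; ring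
    have e2 : ∫ y, u y * (conj ((c • Ψ : Lp ℂ 2 μ) (a y)) * χ (b y)) ∂ν =
        conj c * ∫ y, u y * (conj (Ψ (a y)) * χ (b y)) ∂ν := by
      rw [← integral_const_mul]
      refine integral_congr_ae ?_
      filter_upwards [ha.ae (Lp.coeFn_smul c Ψ)] with y hy
      simp only [hy, Pi.smul_apply, smul_eq_mul, map_mul]; ring
    rw [e1, e2, map_mul, Complex.conj_conj]; ring

end Creation

section Forms

variable {d : ℕ}

/-! ### Changes of variables -/

instance : SFinite (totalMeasure d) := by unfold totalMeasure; infer_instance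

/-- The total momentum as the first variable: `(P, c) ↦ (P - P_f(c), c)`. -/
def shear (z : E d × Config d) : E d × Config d := (z.1 - fieldMomentum z.2, z.2)

/-- The inverse of `shear`: `(p, c) ↦ (p + P_f(c), c)`. -/
def unshear (z : E d × Config d) : E d × Config d := (z.1 + fieldMomentum z.2, z.2)

theorem shear_unshear (z : E d × Config d) : shear (unshear z) = z := by simp [shear, unshear]

theorem unshear_shear (z : E d × Config d) : unshear (shear z) = z := by simp [shear, unshear]

theorem measurePreserving_fiberwise {g : Config d → E d → E d}
    (hg : Measurable (Function.uncurry g)) (hp : ∀ c, MeasurePreserving (g c) volume volume) :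
    MeasurePreserving (fun z : E d × Config d => (g z.2 z.1, z.2)) (totalMeasure d)
      (totalMeasure d) := by
  have h : MeasurePreserving (fun z : Config d × E d => (z.1, g z.1 z.2))
      ((configMeasure d).prod volume) ((configMeasure d).prod volume) :=
    (MeasurePreserving.id _).skew_product hg (Eventually.of_forall fun c => (hp c).map_eq)
  exact Measure.measurePreserving_swap.comp (h.comp Measure.measurePreserving_swap)

theorem measurePreserving_shear :
    MeasurePreserving (shear : E d × Config d → E d × Config d) (totalMeasure d)
      (totalMeasure d) := by
  refine measurePreserving_fiberwise (g := fun c p => p - fieldMomentum c) ?_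
    fun c => measurePreserving_sub_right volume _
  exact measurable_snd.sub (measurable_fieldMomentum.comp measurable_fst)

theorem measurePreserving_unshear :
    MeasurePreserving (unshear : E d × Config d → E d × Config d) (totalMeasure d)
      (totalMeasure d) := by
  refine measurePreserving_fiberwise (g := fun c p => p + fieldMomentum c) ?_
    fun c => measurePreserving_add_right volume _
  exact measurable_snd.add (measurable_fieldMomentum.comp measurable_fst)

/-- The shear as a measurable equivalence. -/
def shearEquiv (d : ℕ) : E d × Config d ≃ᵐ E d × Config d where
  toFun := shear
  invFun := unshear
  left_inv := unshear_shear
  right_inv := shear_unshear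
  measurable_toFun := measurePreserving_shear.measurable
  measurable_invFun := measurePreserving_unshear.measurable

/-- `(P, (k, c)) ↦ (k, (P - P_f(c), c))`, as a measurable equivalence. -/
def reorderEquiv (d : ℕ) : E d × (E d × Config d) ≃ᵐ E d × (E d × Config d) :=
  MeasurableEquiv.prodAssoc.symm.trans <|
    (MeasurableEquiv.prodCongr MeasurableEquiv.prodComm (MeasurableEquiv.refl _)).trans <|
    MeasurableEquiv.prodAssoc.trans <|
    MeasurableEquiv.prodCongr (MeasurableEquiv.refl _) (shearEquiv d)

theorem reorderEquiv_apply (P k : E d) (c : Config d) :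
    reorderEquiv d (P, (k, c)) = (k, (P - fieldMomentum c, c)) := rfl

theorem measurePreserving_reorder :
    MeasurePreserving (reorderEquiv d) ((volume : Measure (E d)).prod (totalMeasure d))
      ((volume : Measure (E d)).prod (totalMeasure d)) := by
  have h1 := (measurePreserving_prodAssoc (volume : Measure (E d)) (volume : Measure (E d))
    (configMeasure d)).symm
  have h2 : MeasurePreserving (Prod.map Prod.swap id)
      (((volume : Measure (E d)).prod (volume : Measure (E d))).prod (configMeasure d))
      (((volume : Measure (E d)).prod (volume : Measure (E d))).prod (configMeasure d)) :=
    Measure.measurePreserving_swap.prod (MeasurePreserving.id _)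
  have h3 := measurePreserving_prodAssoc (volume : Measure (E d)) (volume : Measure (E d))
    (configMeasure d)
  have h4 : MeasurePreserving (Prod.map id shear)
      ((volume : Measure (E d)).prod (totalMeasure d))
      ((volume : Measure (E d)).prod (totalMeasure d)) :=
    (MeasurePreserving.id _).prod measurePreserving_shear
  exact h4.comp (h3.comp (h2.comp h1))

/-- The momenta after the emission of a boson: `(k, (p, c)) ↦ (p - k, (k, c))`. -/
def emit (z : E d × (E d × Config d)) : E d × Config d := (z.2.1 - z.1, cons z.1 z.2.2)

/-- Conservation of total momentum: in the coordinates `(P, k, c)` an emission adds `k` to the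
bosons and leaves `P` alone. The decomposition into fibers rests on this identity. -/
theorem emit_reorder (P k : E d) (c : Config d) :
    emit (reorderEquiv d (P, (k, c))) = shear (P, cons k c) := by
  rw [reorderEquiv_apply]
  simp only [emit, shear, fieldMomentum_cons, Prod.mk.injEq, and_true]
  rw [sub_sub, add_comm (fieldMomentum c)]

/-- Up to measure preserving changes of variables, emission is the addition of a boson at fixed
total momentum. -/
theorem quasiMeasurePreserving_emit :
    Measure.QuasiMeasurePreserving (emit : E d × (E d × Config d) → E d × Config d)
      ((volume : Measure (E d)).prod (totalMeasure d)) (totalMeasure d) := by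
  have h1 : Measure.QuasiMeasurePreserving
      (Prod.map id fun z : E d × Config d => cons z.1 z.2)
      ((volume : Measure (E d)).prod (totalMeasure d))
      ((volume : Measure (E d)).prod (configMeasure d)) :=
    QuasiMeasurePreserving.prodMap (MeasurePreserving.id _).quasiMeasurePreserving quasiMeasurePreserving_cons
  have h2 := (measurePreserving_shear.quasiMeasurePreserving.comp h1).comp
    (measurePreserving_reorder (d := d)).symm.quasiMeasurePreserving
  convert! h2 using 1
  funext z
  obtain ⟨⟨P, k, c⟩, rfl⟩ := (reorderEquiv d).surjective z
  simp [emit_reorder]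

/-! ### The forms as Hermitian forms -/

/-- The coupling of the state with `n` bosons to the emission of a boson of momentum `k`. -/
noncomputable def coupling (v : E d → ℂ) (k : E d) (c : Config d) : ℂ :=
  (Real.sqrt (c.1 + 1) : ℂ) * v k

theorem fiberForm_eq (v : E d → ℂ) (ω : E d → ℝ) (P : E d) :
    fiberForm v ω P = fun χ Φ : Fock d =>
      weightForm (fun c => ‖P - fieldMomentum c‖ ^ 2 + fieldEnergy ω c) (configMeasure d) χ Φ +
      creationForm (fun z : E d × Config d => coupling v z.1 z.2) (fun z => cons z.1 z.2) Prod.snd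
        (totalMeasure d) (χ : Lp ℂ 2 (configMeasure d)) Φ := by
  funext χ Φ
  exact add_assoc _ _ _

theorem totalForm_zero_eq (v : E d → ℂ) (ω : E d → ℝ) :
    totalForm v ω 0 = fun χ Ψ : Total d =>
      weightForm (fun z => ‖z.1‖ ^ 2 + fieldEnergy ω z.2) (totalMeasure d) χ Ψ +
      creationForm (fun z : E d × (E d × Config d) => coupling v z.1 z.2.2) emit Prod.snd
        ((volume : Measure (E d)).prod (totalMeasure d)) (χ : Lp ℂ 2 (totalMeasure d)) Ψ := by
  funext χ Ψ
  unfold totalForm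
  simp only [potentialForm, Pi.zero_apply, Complex.ofReal_zero, zero_mul, integral_zero, add_zero]
  exact add_assoc _ _ _

theorem totalForm_eq_add (v : E d → ℂ) (ω : E d → ℝ) (U : E d → ℝ) (χ Ψ : Total d) :
    totalForm v ω U χ Ψ = totalForm v ω 0 χ Ψ +
      ∫ c, potentialForm U (fun p => (χ : Lp ℂ 2 (totalMeasure d)) (p, c))
        (fun p => (Ψ : Lp ℂ 2 (totalMeasure d)) (p, c)) ∂(configMeasure d) := by
  unfold totalForm
  simp [potentialForm]

theorem aestronglyMeasurable_totalWeight {ω : E d → ℝ} (hω : Measurable ω) :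
    AEStronglyMeasurable (fun z : E d × Config d => ‖z.1‖ ^ 2 + fieldEnergy ω z.2)
      (totalMeasure d) := by
  have := measurable_fieldEnergy hω
  exact Measurable.aestronglyMeasurable (by fun_prop)

theorem aestronglyMeasurable_fiberWeight {ω : E d → ℝ} (hω : Measurable ω) (P : E d) :
    AEStronglyMeasurable (fun c : Config d => ‖P - fieldMomentum c‖ ^ 2 + fieldEnergy ω c)
      (configMeasure d) := by
  have := measurable_fieldEnergy hω
  have := measurable_fieldMomentum (d := d)
  exact Measurable.aestronglyMeasurable (by fun_prop)

end Forms

/-! ### The potential on the space of the particle and the field. -/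

section TotalPotential

variable {d : ℕ} {V : E d → ℝ} {W : E d → ℂ}

/-- Translation of the momentum of the particle. -/
noncomputable def totalShift (s : ℝ) (ξ : E d) (z : E d × Config d) : E d × Config d :=
  (z.1 - (2 * Real.pi * s) • ξ, z.2)

theorem isShift_totalShift (s : ℝ) : IsShift (totalShift s) (totalMeasure d) where
  measurable := by
    unfold Function.uncurry totalShift
    fun_prop
  preserving ξ := by
    refine measurePreserving_fiberwise (g := fun _ p => p - (2 * Real.pi * s) • ξ) ?_
      fun c => measurePreserving_sub_right volume _
    exact measurable_snd.sub_const _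

theorem memLp_two_of_sq {X : Type*} [MeasurableSpace X] {μ : Measure X} {f : X → ℂ}
    (hf : AEStronglyMeasurable f μ) (h : Integrable (fun x => ‖f x‖ ^ 2) μ) : MemLp f 2 μ :=
  (memLp_two_iff_integrable_sq_norm hf).2 h

theorem ae_memLp_snd {A B : Type*} [MeasurableSpace A] [MeasurableSpace B] {μ : Measure A}
    {ν : Measure B} [SFinite μ] [SFinite ν] {f : A × B → ℂ} (hf : MemLp f 2 (μ.prod ν)) :
    ∀ᵐ b ∂ν, MemLp (fun a => f (a, b)) 2 μ := by
  have h1 := ((memLp_two_iff_integrable_sq_norm hf.1).1 hf).prod_left_ae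
  have h2 := (hf.1.prod_swap).prodMk_left
  filter_upwards [h1, h2] with b hb1 hb2
  exact memLp_two_of_sq hb2 hb1

theorem ae_memLp_fst {A B : Type*} [MeasurableSpace A] [MeasurableSpace B] {μ : Measure A}
    {ν : Measure B} [SFinite μ] [SFinite ν] {f : A × B → ℂ} (hf : MemLp f 2 (μ.prod ν)) :
    ∀ᵐ a ∂μ, MemLp (fun b => f (a, b)) 2 ν := by
  have h1 := ((memLp_two_iff_integrable_sq_norm hf.1).1 hf).prod_right_ae
  have h2 := hf.1.prodMk_left
  filter_upwards [h1, h2] with a ha1 ha2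
  exact memLp_two_of_sq ha2 ha1

theorem measurePreserving_regroup :
    MeasurePreserving (fun w : (E d × Config d) × E d => (w.1.1, (w.2, w.1.2)))
      ((totalMeasure d).prod volume) ((volume : Measure (E d)).prod (totalMeasure d)) := by
  have h1 := measurePreserving_prodAssoc (volume : Measure (E d)) (configMeasure d)
    (volume : Measure (E d))
  have h2 : MeasurePreserving (Prod.map id Prod.swap)
      ((volume : Measure (E d)).prod ((configMeasure d).prod (volume : Measure (E d))))
      ((volume : Measure (E d)).prod (totalMeasure d)) :=
    (MeasurePreserving.id _).prod Measure.measurePreserving_swap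
  exact h2.comp h1

/-- The form of a translation covariant potential can be computed fiber by fiber. -/
theorem integral_shiftForm_fiber (hW : Integrable W) (s : ℝ) (χ Ψ : Lp ℂ 2 (totalMeasure d)) :
    Integrable (fun c => shiftForm W (fun ξ p => p - (2 * Real.pi * s) • ξ) volume
      (fun p => χ (p, c)) (fun p => Ψ (p, c))) (configMeasure d) ∧
    ∫ c, shiftForm W (fun ξ p => p - (2 * Real.pi * s) • ξ) volume
      (fun p => χ (p, c)) (fun p => Ψ (p, c)) ∂(configMeasure d) =
      shiftForm W (totalShift s) (totalMeasure d) χ Ψ := by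
  have hT := isShift_totalShift (d := d) s
  have hint := integrable_shift_prod hT hW χ Ψ
  have hr : Integrable (fun w : (E d × Config d) × E d =>
      W w.1.1 * (conj (χ (w.2, w.1.2)) * Ψ (w.2 - (2 * Real.pi * s) • w.1.1, w.1.2)))
      ((totalMeasure d).prod volume) :=
    (measurePreserving_regroup (d := d)).integrable_comp_of_integrable hint
  have hr2 : Integrable (fun w : E d × Config d =>
      W w.1 * ∫ p, conj (χ (p, w.2)) * Ψ (p - (2 * Real.pi * s) • w.1, w.2))
      (totalMeasure d) := by
    simpa only [integral_const_mul] using hr.integral_prod_left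
  refine ⟨hr2.integral_prod_right, ?_⟩
  unfold shiftForm
  rw [integral_integral_swap (f := fun c ξ => W ξ *
    ∫ p, conj (χ (p, c)) * Ψ (p - (2 * Real.pi * s) • ξ, c)) hr2.swap]
  congr 1; funext ξ
  rw [integral_const_mul]
  congr 1
  have hg : MemLp (fun z => Ψ (totalShift s ξ z)) 2 (totalMeasure d) :=
    (Lp.memLp Ψ).comp_measurePreserving (hT.preserving ξ)
  have h := integral_prod_symm _ (integrable_conj_mul (Lp.memLp χ) hg)
  exact h.symm

theorem HasFourier.ae_scaled_potential (h : HasFourier V W) {s : ℝ} (hs : s ≠ 0) :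
    ∀ᵐ x : E d, ((s ^ 2 * V (s • x) : ℝ) : ℂ) = ((s ^ 2 : ℝ) : ℂ) * (𝓕⁻ W : E d → ℂ) (s • x) := by
  filter_upwards [(Measure.quasiMeasurePreserving_smul (volume : Measure (E d)) hs).ae h.eq]
    with x hx
  rw [Complex.ofReal_mul, hx]

/-- The form of the scaled potential on the Hilbert space of the particle and the field. -/
theorem HasFourier.integral_potentialForm (h : HasFourier V W) {s : ℝ} (hs : s ≠ 0)
    (χ Ψ : Lp ℂ 2 (totalMeasure d)) :
    ∫ c, potentialForm (fun x => s ^ 2 * V (s • x)) (fun p => χ (p, c)) (fun p => Ψ (p, c))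
      ∂(configMeasure d) =
      ((s ^ 2 : ℝ) : ℂ) * shiftForm W (totalShift s) (totalMeasure d) χ Ψ := by
  rw [← (integral_shiftForm_fiber h.integrable s χ Ψ).2, ← integral_const_mul]
  refine integral_congr_ae ?_
  filter_upwards [ae_memLp_snd (Lp.memLp χ), ae_memLp_snd (Lp.memLp Ψ)] with c h1 h2
  have hp : ∀ {f g : E d → ℂ} (hf : MemLp f 2 volume) (hg : MemLp g 2 volume) (U : E d → ℝ),
      potentialForm U f g = potentialForm U (hf.toLp f) (hg.toLp g) := fun hf hg U => by
    unfold potentialForm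
    rw [position_toLp hf, position_toLp hg]
  rw [hp h1 h2, potentialForm_eq_shiftForm h.integrable (h.ae_scaled_potential hs)]
  congr 1
  exact shiftForm_congr (isShift_translate _) h1.coeFn_toLp h2.coeFn_toLp

/-- The form of the potential on the Hilbert space of the particle and the field. -/
noncomputable def totalPot (W : E d → ℂ) (s : ℝ) (χ Ψ : Total d) : ℂ :=
  ((s ^ 2 : ℝ) : ℂ) * shiftForm W (totalShift s) (totalMeasure d)
    (χ : Lp ℂ 2 (totalMeasure d)) (Ψ : Lp ℂ 2 (totalMeasure d))

theorem HasFourier.totalForm_eq (h : HasFourier V W) (v : E d → ℂ) (ω : E d → ℝ) {s : ℝ}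
    (hs : s ≠ 0) : totalForm v ω (fun x => s ^ 2 * V (s • x)) =
      fun χ Ψ => totalForm v ω 0 χ Ψ + totalPot W s χ Ψ := by
  funext χ Ψ
  rw [totalForm_eq_add, h.integral_potentialForm hs]
  rfl

theorem conj_potentialForm (U : E d → ℝ) (f g : E d → ℂ) :
    conj (potentialForm U f g) = potentialForm U g f := by
  unfold potentialForm
  rw [← integral_conj]
  congr 1; funext y
  simp [mul_comm]

theorem HasFourier.isHermitianForm_totalPot (h : HasFourier V W) {s : ℝ} (hs : s ≠ 0) :
    IsHermitianForm (⊤ : Submodule ℂ (Total d)) (totalPot W s) where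
  conj_symm χ Ψ := by
    unfold totalPot
    rw [← h.integral_potentialForm hs, ← h.integral_potentialForm hs, ← integral_conj]
    simp only [conj_potentialForm]
  add_right χ _ Ψ _ Ψ' _ := by
    unfold totalPot
    rw [Submodule.coe_add, shiftForm_add_right (isShift_totalShift s) h.integrable, mul_add]
  smul_right χ _ Ψ _ c := by
    unfold totalPot
    rw [Submodule.coe_smul, shiftForm_smul_right (isShift_totalShift s)]
    ring

theorem HasFourier.norm_totalPot_le (h : HasFourier V W) (s : ℝ) (χ Ψ : Total d) :
    ‖totalPot W s χ Ψ‖ ≤ (s ^ 2 * ∫ ξ, ‖W ξ‖) * ‖χ‖ * ‖Ψ‖ := by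
  unfold totalPot
  rw [norm_mul, Complex.norm_real, Real.norm_of_nonneg (sq_nonneg s), mul_assoc, mul_assoc]
  gcongr
  rw [← mul_assoc]
  exact norm_shiftForm_le (isShift_totalShift s) h.integrable _ _

end TotalPotential

/-! ### The form domain of the Hamiltonian and the sign of the dispersion relation. -/

section Positivity

variable {d : ℕ} {v : E d → ℂ} {ω : E d → ℝ}

theorem toLp_mem_Total {f : E d × Config d → ℂ} (hf : MemLp f 2 (totalMeasure d))
    (hs : ∀ σ, ∀ᵐ z ∂(totalMeasure d), f (z.1, permute σ z.2) = f z) : hf.toLp f ∈ Total d := by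
  rw [mem_Total_iff]
  refine ae_forall_permute (fun z : E d × Config d => z.2.1) (fun σ z => (z.1, permute σ z.2))
      (fun σ z => ?_) fun σ => ?_
  · rw [permute_sectorPerm]
  · filter_upwards [hs σ, hf.coeFn_toLp,
      (measurePreserving_prod_permute σ).quasiMeasurePreserving.ae hf.coeFn_toLp] with z h1 h2 h3
    rw [h2, ← h1]; exact h3

theorem toLp_mem_Fock {f : Config d → ℂ} (hf : MemLp f 2 (configMeasure d))
    (hs : ∀ᵐ c ∂(configMeasure d), ∀ σ, f (permute σ c) = f c) : hf.toLp f ∈ Fock d := by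
  rw [mem_Fock_iff]
  refine ae_forall_permute Sigma.fst permute permute_sectorPerm fun σ => ?_
  filter_upwards [hs, hf.coeFn_toLp,
    (measurePreserving_permute σ).quasiMeasurePreserving.ae hf.coeFn_toLp] with z h1 h2 h3
  rw [h2, ← h1 σ, ← h3]

/-- The form domain of `p² + H_f`, as a subspace. -/
noncomputable def totalSubmodule (hω : Measurable ω) : Submodule ℂ (Total d) :=
  (weightDomain (aestronglyMeasurable_totalWeight hω)).comap (Total d).subtype

theorem DefinesHamiltonian.isHermitianForm (hH : DefinesHamiltonian v ω) :
    IsHermitianForm (totalSubmodule hH.measurable_ω) (totalForm v ω 0) := by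
  rw [totalForm_zero_eq]
  refine ((isHermitianForm_weightForm
    (aestronglyMeasurable_totalWeight hH.measurable_ω)).restrict (Total d)).add ?_
  have hQ : ∀ f ∈ (totalSubmodule hH.measurable_ω).map (Total d).subtype, ∃ Ψ : Total d,
      Ψ ∈ totalDomain ω ∧ (Ψ : Lp ℂ 2 (totalMeasure d)) = f := by
    rintro f ⟨Ψ, hΨ, rfl⟩
    exact ⟨Ψ, hΨ, rfl⟩
  have := (isHermitianForm_creationForm (Q := (totalSubmodule hH.measurable_ω).map
    (Total d).subtype) (u := fun z : E d × (E d × Config d) => coupling v z.1 z.2.2)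
    quasiMeasurePreserving_emit Measure.quasiMeasurePreserving_snd ?_).restrict (Total d)
  · refine this.mono fun Ψ hΨ => ?_
    exact ⟨Ψ, hΨ, rfl⟩
  · intro f hf g hg
    obtain ⟨χ, hχ, rfl⟩ := hQ f hf
    obtain ⟨Ψ, hΨ, rfl⟩ := hQ g hg
    exact hH.integrable χ hχ Ψ hΨ

/-- `N` bosons with momenta in `A`. -/
def bosonsIn (N : ℕ) (A : Set (E d)) : Set (Config d) :=
  (fun K : Fin N → E d => (⟨N, K⟩ : Config d)) '' Set.pi Set.univ fun _ => A

theorem measurableSet_bosonsIn (N : ℕ) {A : Set (E d)} (hA : MeasurableSet A) :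
    MeasurableSet (bosonsIn N A) :=
  (measurableEmbedding_sigmaMk N).measurableSet_image.2 (MeasurableSet.univ_pi fun _ => hA)

theorem configMeasure_bosonsIn (N : ℕ) {A : Set (E d)} (hA : MeasurableSet A) :
    configMeasure d (bosonsIn N A) = volume A ^ N := by
  have hm := measurableSet_bosonsIn N hA
  unfold configMeasure
  rw [Measure.sum_apply _ hm, tsum_eq_single N]
  · rw [Measure.map_apply (measurable_sigmaMk N) hm, bosonsIn,
      Set.preimage_image_eq _ (measurableEmbedding_sigmaMk N).injective, volume_pi, Measure.pi_pi]
    simp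
  · intro n hn
    rw [Measure.map_apply (measurable_sigmaMk n) hm]
    have : (fun K : Fin n → E d => (⟨n, K⟩ : Config d)) ⁻¹' bosonsIn N A = ∅ := by
      ext K
      simp only [bosonsIn, Set.mem_preimage, Set.mem_image, Set.mem_empty_iff_false, iff_false]
      rintro ⟨K', _, h⟩
      exact hn (congrArg Sigma.fst h).symm
    rw [this, measure_empty]

theorem permute_mem_bosonsIn {N : ℕ} {A : Set (E d)} (σ : ∀ n : ℕ, Equiv.Perm (Fin n))
    {c : Config d} : permute σ c ∈ bosonsIn N A ↔ c ∈ bosonsIn N A := by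
  have key : ∀ c : Config d, c ∈ bosonsIn N A ↔ c.1 = N ∧ ∀ i, c.2 i ∈ A := by
    intro c
    constructor
    · rintro ⟨K, hK, rfl⟩
      exact ⟨rfl, fun i => hK i trivial⟩
    · obtain ⟨n, K⟩ := c
      rintro ⟨rfl, h⟩
      exact ⟨K, fun i _ => h i, rfl⟩
  rw [key, key]
  refine and_congr Iff.rfl ⟨fun h i => ?_, fun h i => h _⟩
  have := h ((σ c.1).symm i)
  simpa [permute] using this

/-- A Hamiltonian that is bounded from below has a nonnegative dispersion relation. -/
theorem DefinesHamiltonian.omega_nonneg (hH : DefinesHamiltonian v ω) : ∀ᵐ k, 0 ≤ ω k := by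
  by_contra hneg
  obtain ⟨C, hC⟩ := hH.bounded_below
  have hω := hH.measurable_ω
  -- Bounded sets on which `ω` is bounded and stays away from zero from below; they exhaust `{ω <
  -- 0}`, so one of them has positive measure.
  let A : ℕ → Set (E d) := fun n => {k | -(n : ℝ) ≤ ω k ∧ ω k ≤ -(1 / ((n : ℝ) + 1))} ∩
    Metric.ball 0 n
  have hAm : ∀ n, MeasurableSet (A n) := fun n =>
    ((measurableSet_le measurable_const hω).inter (measurableSet_le hω measurable_const)).inter
      measurableSet_ball
  obtain ⟨n, hn⟩ : ∃ n, volume (A n) ≠ 0 := by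
    by_contra! hall
    refine hneg ?_
    have hnull : volume (⋃ n, A n) = 0 := measure_iUnion_null hall
    rw [ae_iff]
    refine measure_mono_null (fun k hk => ?_) hnull
    have hk' : ω k < 0 := not_le.1 hk
    obtain ⟨n1, h1⟩ := exists_nat_ge (-ω k)
    obtain ⟨n2, h2⟩ := exists_nat_one_div_lt (show 0 < -ω k by linarith)
    obtain ⟨n3, h3⟩ := exists_nat_gt ‖k‖
    refine Set.mem_iUnion.2 ⟨n1 + n2 + n3, ⟨?_, ?_⟩, ?_⟩
    · push_cast
      have : (0 : ℝ) ≤ n2 := by positivity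
      have : (0 : ℝ) ≤ n3 := by positivity
      linarith
    · have : 1 / (((n1 + n2 + n3 : ℕ) : ℝ) + 1) ≤ 1 / ((n2 : ℝ) + 1) := by
        gcongr; omega
      linarith
    · rw [mem_ball_zero_iff]
      push_cast
      have : (0 : ℝ) ≤ n1 := by positivity
      have : (0 : ℝ) ≤ n2 := by positivity
      linarith
  set a := A n with ha
  have hfin : volume a ≠ ∞ :=
    ((measure_mono Set.inter_subset_right).trans_lt measure_ball_lt_top).ne
  set δ : ℝ := 1 / ((n : ℝ) + 1) with hδ
  have hδ0 : 0 < δ := by positivity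
  -- The trial state has exactly `N` bosons, all with momenta in `a`, and a particle momentum of
  -- size less than `1`. Its energy per squared norm is at most `1 - Nδ`, which tends to `-∞` with
  -- `N`.
  have key : ∀ N : ℕ, C ≤ 1 - N * δ := by
    intro N
    set S : Set (E d × Config d) := Metric.ball 0 1 ×ˢ bosonsIn N a with hS
    have hSm : MeasurableSet S := measurableSet_ball.prod (measurableSet_bosonsIn N (hAm n))
    have hSμ : totalMeasure d S = volume (Metric.ball (0 : E d) 1) * volume a ^ N := by
      rw [totalMeasure, Measure.prod_prod, configMeasure_bosonsIn N (hAm n)]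
    have hSfin : totalMeasure d S ≠ ∞ := by
      rw [hSμ]; exact ENNReal.mul_ne_top measure_ball_lt_top.ne (ENNReal.pow_ne_top hfin)
    have hSpos : 0 < (totalMeasure d).real S := by
      refine ENNReal.toReal_pos ?_ hSfin
      rw [hSμ]
      exact mul_ne_zero (Metric.measure_ball_pos _ _ one_pos).ne' (pow_ne_zero _ hn)
    have hf : MemLp (S.indicator fun _ => (1 : ℂ)) 2 (totalMeasure d) :=
      memLp_indicator_const 2 hSm 1 (Or.inr hSfin)
    let Ψ : Total d := ⟨hf.toLp _, toLp_mem_Total hf fun σ => Eventually.of_forall fun z => by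
      have : (z.1, permute σ z.2) ∈ S ↔ z ∈ S := by
        simp only [hS, Set.mem_prod, permute_mem_bosonsIn]
      by_cases h : z ∈ S
      · rw [Set.indicator_of_mem h, Set.indicator_of_mem (this.2 h)]
      · rw [Set.indicator_of_notMem h, Set.indicator_of_notMem fun hc => h (this.1 hc)]⟩
    have hΨ : (Ψ : Lp ℂ 2 (totalMeasure d)) =ᵐ[totalMeasure d] S.indicator fun _ => (1 : ℂ) :=
      hf.coeFn_toLp
    have hsq : ∀ w : E d × Config d → ℝ,
        (fun z => w z * ‖(Ψ : Lp ℂ 2 (totalMeasure d)) z‖ ^ 2) =ᵐ[totalMeasure d]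
          S.indicator w := fun w => by
      filter_upwards [hΨ] with z hz
      rw [hz]
      by_cases h : z ∈ S <;> simp [h]
    have hnorm : ‖Ψ‖ ^ 2 = (totalMeasure d).real S := by
      have h1 : ‖Ψ‖ = ‖(Ψ : Lp ℂ 2 (totalMeasure d))‖ := rfl
      have h2 := integral_congr_ae (hsq fun _ => 1)
      simp only [one_mul] at h2
      rw [h1, norm_sq_eq_integral, h2, integral_indicator_const _ hSm]
      simp
    have hbd : ∀ z ∈ S, -(N * n : ℝ) ≤ fieldEnergy ω z.2 ∧ fieldEnergy ω z.2 ≤ -(N * δ) := by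
      rintro ⟨p, c⟩ ⟨_, K, hK, rfl⟩
      have h1 : ∀ i, -(n : ℝ) ≤ ω (K i) := fun i => (hK i trivial).1.1
      have h2 : ∀ i, ω (K i) ≤ -δ := fun i => (hK i trivial).1.2
      constructor
      · have := Finset.card_nsmul_le_sum Finset.univ (fun i => ω (K i)) _ fun i _ => h1 i
        simpa [fieldEnergy] using this
      · have := Finset.sum_le_card_nsmul Finset.univ (fun i => ω (K i)) _ fun i _ => h2 i
        simpa [fieldEnergy] using this
    have hball : ∀ z ∈ S, ‖z.1‖ ^ 2 ≤ 1 := fun z hz => by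
      have : ‖z.1‖ < 1 := by simpa using hz.1
      nlinarith [norm_nonneg z.1]
    have hon : IntegrableOn (fun z : E d × Config d => ‖z.1‖ ^ 2 + fieldEnergy ω z.2) S
        (totalMeasure d) := by
      refine Measure.integrableOn_of_bounded (M := 1 + N * n) hSfin
        (aestronglyMeasurable_totalWeight hω) ?_
      filter_upwards [ae_restrict_mem hSm] with z hz
      have h1 := hbd z hz
      have h2 := hball z hz
      have h3 : 0 ≤ (N : ℝ) * δ := by positivity
      have h4 : 0 ≤ ‖z.1‖ ^ 2 := by positivity
      have h5 : 0 ≤ (N : ℝ) * n := by positivity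
      rw [Real.norm_eq_abs, abs_le]
      constructor <;> linarith
    have hdom : Ψ ∈ totalDomain ω := by
      change Integrable _ _
      exact ((integrable_indicator_iff hSm).2 hon).congr (hsq _).symm
    -- The interaction changes the boson number by one, so its expectation in a state with exactly
    -- `N` bosons is zero.
    have hcre : ∀ᵐ z ∂((volume : Measure (E d)).prod (totalMeasure d)),
        totalCreation v Ψ Ψ z = 0 := by
      filter_upwards [quasiMeasurePreserving_emit.ae hΨ,
        Measure.quasiMeasurePreserving_snd.ae hΨ] with z h1 h2
      unfold totalCreation
      unfold emit at h1
      rw [h1, h2]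
      by_cases hz : z.2 ∈ S
      · rw [Set.indicator_of_notMem]
        · simp
        · rintro ⟨_, K, _, hK⟩
          obtain ⟨_, K', _, hK'⟩ := hz
          have e1 : N = z.2.2.1 + 1 := congrArg Sigma.fst hK
          have e2 : N = z.2.2.1 := congrArg Sigma.fst hK'
          omega
      · rw [Set.indicator_of_notMem hz]; simp
    have hform : (totalForm v ω 0 Ψ Ψ).re =
        ∫ z in S, (‖z.1‖ ^ 2 + fieldEnergy ω z.2) ∂(totalMeasure d) := by
      rw [totalForm_zero_eq]
      beta_reduce
      have h1 : creationForm (fun z : E d × (E d × Config d) => coupling v z.1 z.2.2) emit Prod.snd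
          ((volume : Measure (E d)).prod (totalMeasure d)) (Ψ : Lp ℂ 2 (totalMeasure d)) Ψ = 0 := by
        have := integral_congr_ae hcre
        rw [integral_zero] at this
        unfold creationForm
        change (∫ z, totalCreation v Ψ Ψ z ∂_) + conj (∫ z, totalCreation v Ψ Ψ z ∂_) = 0
        rw [this]; simp
      rw [h1, add_zero, weightForm_self, Complex.ofReal_re, integral_congr_ae (hsq _),
        integral_indicator hSm]
    have hle : ∫ z in S, (‖z.1‖ ^ 2 + fieldEnergy ω z.2) ∂(totalMeasure d) ≤
        (1 - N * δ) * (totalMeasure d).real S := by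
      have h1 := setIntegral_mono_on (g := fun _ => 1 - N * δ) hon
        (integrableOn_const hSfin) hSm fun z hz => by
          have h1 := hbd z hz
          have h2 := hball z hz
          linarith
      rw [setIntegral_const, smul_eq_mul] at h1
      linarith
    have h1 := hC Ψ hdom
    rw [hform, hnorm] at h1
    exact le_of_mul_le_mul_right (h1.trans hle) hSpos
  obtain ⟨N, hN⟩ := exists_nat_gt ((1 - C) / δ)
  rw [div_lt_iff₀ hδ0] at hN
  linarith [key N]

end Positivity

/-! ### Decomposition with respect to the total momentum. -/

section Disintegration

variable {d : ℕ} {v : E d → ℂ} {ω : E d → ℝ}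

theorem permute_shear (σ : ∀ n : ℕ, Equiv.Perm (Fin n)) (P : E d) (c : Config d) :
    shear (P, permute σ c) = ((shear (P, c)).1, permute σ (shear (P, c)).2) := by
  simp [shear, fieldMomentum_permute]

/-- `F P` is the component of `Ψ` of total momentum `P`. -/
def IsFiber (F : E d → Fock d) (Ψ : Total d) : Prop :=
  ∀ᵐ P : E d, ∀ᵐ c ∂(configMeasure d),
    (F P : Lp ℂ 2 (configMeasure d)) c = (Ψ : Lp ℂ 2 (totalMeasure d)) (shear (P, c))

theorem memLp_shear (Ψ : Total d) :
    MemLp (fun z => (Ψ : Lp ℂ 2 (totalMeasure d)) (shear z)) 2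
      ((volume : Measure (E d)).prod (configMeasure d)) :=
  (Lp.memLp _).comp_measurePreserving measurePreserving_shear

/-- For almost every `P` the slice of `Ψ ∘ shear` at `P` is square integrable and symmetric. The
fibers are chosen pointwise, with `0` on the exceptional set; no measurability of `P ↦ F P` is
needed, because all integrals are computed from `Ψ` itself. -/
theorem exists_isFiber (Ψ : Total d) : ∃ F : E d → Fock d, IsFiber F Ψ := by
  have h1 := ae_memLp_fst (memLp_shear Ψ)
  have h2 : ∀ᵐ P : E d, ∀ᵐ c ∂(configMeasure d), ∀ σ,
      (Ψ : Lp ℂ 2 (totalMeasure d)) (shear (P, permute σ c)) =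
        (Ψ : Lp ℂ 2 (totalMeasure d)) (shear (P, c)) := by
    have := measurePreserving_shear.quasiMeasurePreserving.ae (mem_Total_iff.1 Ψ.2)
    refine (Measure.ae_ae_of_ae_prod this).mono fun P hP => hP.mono fun c hc σ => ?_
    rw [permute_shear]
    exact hc σ
  have h3 : ∀ᵐ P : E d, ∃ φ : Fock d, ∀ᵐ c ∂(configMeasure d),
      (φ : Lp ℂ 2 (configMeasure d)) c = (Ψ : Lp ℂ 2 (totalMeasure d)) (shear (P, c)) := by
    filter_upwards [h1, h2] with P hP1 hP2
    exact ⟨⟨hP1.toLp _, toLp_mem_Fock hP1 hP2⟩, hP1.coeFn_toLp⟩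
  classical
  refine ⟨fun P => if h : ∃ φ : Fock d, ∀ᵐ c ∂(configMeasure d),
      (φ : Lp ℂ 2 (configMeasure d)) c = (Ψ : Lp ℂ 2 (totalMeasure d)) (shear (P, c))
      then h.choose else 0, ?_⟩
  filter_upwards [h3] with P hP
  rw [dif_pos hP]
  exact hP.choose_spec

theorem integral_comp_shear (f : E d × Config d → ℝ) :
    ∫ z, f (shear z) ∂(totalMeasure d) = ∫ z, f z ∂(totalMeasure d) :=
  measurePreserving_shear.integral_comp (shearEquiv d).measurableEmbedding f

theorem integrable_comp_shear {f : E d × Config d → ℝ} (hf : Integrable f (totalMeasure d)) :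
    Integrable (fun z => f (shear z)) (totalMeasure d) :=
  measurePreserving_shear.integrable_comp_of_integrable hf

/-- Integration of a weighted density over the total momentum. -/
theorem IsFiber.integral_weight {F : E d → Fock d} {Ψ : Total d} (hF : IsFiber F Ψ)
    {w : E d × Config d → ℝ}
    (hw : Integrable (fun z => w z * ‖(Ψ : Lp ℂ 2 (totalMeasure d)) z‖ ^ 2) (totalMeasure d)) :
    (∀ᵐ P : E d, Integrable (fun c => w (shear (P, c)) *
      ‖(F P : Lp ℂ 2 (configMeasure d)) c‖ ^ 2) (configMeasure d)) ∧
    Integrable (fun P => ∫ c, w (shear (P, c)) * ‖(F P : Lp ℂ 2 (configMeasure d)) c‖ ^ 2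
      ∂(configMeasure d)) ∧
    ∫ P, ∫ c, w (shear (P, c)) * ‖(F P : Lp ℂ 2 (configMeasure d)) c‖ ^ 2 ∂(configMeasure d) =
      ∫ z, w z * ‖(Ψ : Lp ℂ 2 (totalMeasure d)) z‖ ^ 2 ∂(totalMeasure d) := by
  have h1 := integrable_comp_shear hw
  have hF' : ∀ᵐ P : E d, (fun c => w (shear (P, c)) *
      ‖(Ψ : Lp ℂ 2 (totalMeasure d)) (shear (P, c))‖ ^ 2) =ᵐ[configMeasure d]
      fun c => w (shear (P, c)) * ‖(F P : Lp ℂ 2 (configMeasure d)) c‖ ^ 2 :=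
    hF.mono fun P hP => hP.mono fun c hc => by simp only [hc]
  refine ⟨?_, ?_, ?_⟩
  · filter_upwards [h1.prod_right_ae, hF'] with P hP1 hP2
    exact hP1.congr hP2
  · refine h1.integral_prod_left.congr ?_
    filter_upwards [hF'] with P hP
    exact integral_congr_ae hP
  · rw [← integral_comp_shear]
    refine Eq.trans ?_ (integral_prod _ h1).symm
    refine integral_congr_ae ?_
    filter_upwards [hF'] with P hP
    exact (integral_congr_ae hP).symm

theorem norm_sq_Fock (Φ : Fock d) :
    ‖Φ‖ ^ 2 = ∫ c, ‖(Φ : Lp ℂ 2 (configMeasure d)) c‖ ^ 2 ∂(configMeasure d) :=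
  norm_sq_eq_integral (Φ : Lp ℂ 2 (configMeasure d))

theorem norm_sq_Total (Ψ : Total d) :
    ‖Ψ‖ ^ 2 = ∫ z, ‖(Ψ : Lp ℂ 2 (totalMeasure d)) z‖ ^ 2 ∂(totalMeasure d) :=
  norm_sq_eq_integral (Ψ : Lp ℂ 2 (totalMeasure d))

/-- A weight that depends on the total momentum only. -/
theorem IsFiber.integral_weight_fst {F : E d → Fock d} {Ψ : Total d} (hF : IsFiber F Ψ)
    {w : E d → ℝ}
    (hw : Integrable (fun z => w (unshear z).1 * ‖(Ψ : Lp ℂ 2 (totalMeasure d)) z‖ ^ 2)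
      (totalMeasure d)) :
    Integrable (fun P => w P * ‖F P‖ ^ 2) ∧
    ∫ P, w P * ‖F P‖ ^ 2 =
      ∫ z, w (unshear z).1 * ‖(Ψ : Lp ℂ 2 (totalMeasure d)) z‖ ^ 2 ∂(totalMeasure d) := by
  have h := hF.integral_weight hw
  have e : ∀ P : E d, ∫ c, w (unshear (shear (P, c))).1 *
      ‖(F P : Lp ℂ 2 (configMeasure d)) c‖ ^ 2 ∂(configMeasure d) = w P * ‖F P‖ ^ 2 := fun P => by
    simp only [unshear_shear]
    rw [integral_const_mul, norm_sq_Fock]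
  simp only [e] at h
  exact h.2

theorem IsFiber.norm_sq {F : E d → Fock d} {Ψ : Total d} (hF : IsFiber F Ψ) :
    Integrable (fun P => ‖F P‖ ^ 2) ∧ ‖Ψ‖ ^ 2 = ∫ P, ‖F P‖ ^ 2 := by
  have h := hF.integral_weight_fst (w := fun _ => 1)
    (by simpa using integrable_norm_sq (Ψ : Lp ℂ 2 (totalMeasure d)))
  simp only [one_mul] at h
  exact ⟨h.1, by rw [h.2, norm_sq_Total]⟩

/-- The matrix elements of the creation operators, fiber by fiber. -/
theorem IsFiber.integral_creation {F G : E d → Fock d} {χ Ψ : Total d} (hF : IsFiber F χ)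
    (hG : IsFiber G Ψ)
    (hint : Integrable (totalCreation v χ Ψ) ((volume : Measure (E d)).prod (totalMeasure d))) :
    (∀ᵐ P : E d, Integrable (fiberCreation v (F P) (G P)) (totalMeasure d)) ∧
    Integrable (fun P => ∫ z, fiberCreation v (F P) (G P) z ∂(totalMeasure d)) ∧
    ∫ P, ∫ z, fiberCreation v (F P) (G P) z ∂(totalMeasure d) =
      ∫ z, totalCreation v χ Ψ z ∂((volume : Measure (E d)).prod (totalMeasure d)) := by
  have hmp := measurePreserving_reorder (d := d)
  have h1 := hmp.integrable_comp_of_integrable hint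
  have hae : ∀ᵐ P : E d, (fun z => totalCreation v χ Ψ (reorderEquiv d (P, z))) =ᵐ[totalMeasure d]
      fiberCreation v (F P) (G P) := by
    filter_upwards [hF, hG] with P hP1 hP2
    filter_upwards [quasiMeasurePreserving_cons.ae hP1,
      Measure.quasiMeasurePreserving_snd.ae hP2] with z hz1 hz2
    obtain ⟨k, c⟩ := z
    have e := emit_reorder P k c
    rw [reorderEquiv_apply] at e ⊢
    unfold emit at e
    simp only [totalCreation, fiberCreation]
    rw [e, hz1, hz2]
    rfl
  refine ⟨?_, ?_, ?_⟩
  · filter_upwards [h1.prod_right_ae, hae] with P hP1 hP2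
    exact hP1.congr hP2
  · refine h1.integral_prod_left.congr ?_
    filter_upwards [hae] with P hP
    exact integral_congr_ae hP
  · rw [← hmp.integral_comp (reorderEquiv d).measurableEmbedding]
    refine Eq.trans ?_ (integral_prod _ h1).symm
    refine integral_congr_ae ?_
    filter_upwards [hae] with P hP
    exact (integral_congr_ae hP).symm

theorem IsFiber.ae_mem_fiberDomain {F : E d → Fock d} {Ψ : Total d} (hF : IsFiber F Ψ)
    (hΨ : Ψ ∈ totalDomain ω) : ∀ᵐ P : E d, F P ∈ fiberDomain ω P :=
  (hF.integral_weight (w := fun z => ‖z.1‖ ^ 2 + fieldEnergy ω z.2) hΨ).1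

theorem fiberForm_self (P : E d) (Φ : Fock d) :
    (fiberForm v ω P Φ Φ).re = (∫ c, (‖P - fieldMomentum c‖ ^ 2 + fieldEnergy ω c) *
      ‖(Φ : Lp ℂ 2 (configMeasure d)) c‖ ^ 2 ∂(configMeasure d)) +
      2 * (∫ z, fiberCreation v Φ Φ z ∂(totalMeasure d)).re := by
  rw [fiberForm_eq]
  beta_reduce
  rw [weightForm_self, Complex.add_re, Complex.ofReal_re]
  congr 1
  change ((∫ z, fiberCreation v Φ Φ z ∂_) + conj (∫ z, fiberCreation v Φ Φ z ∂_)).re = _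
  rw [Complex.add_re, Complex.conj_re]; ring

theorem totalForm_self (Ψ : Total d) :
    (totalForm v ω 0 Ψ Ψ).re = (∫ z, (‖z.1‖ ^ 2 + fieldEnergy ω z.2) *
      ‖(Ψ : Lp ℂ 2 (totalMeasure d)) z‖ ^ 2 ∂(totalMeasure d)) +
      2 * (∫ z, totalCreation v Ψ Ψ z ∂((volume : Measure (E d)).prod (totalMeasure d))).re := by
  rw [totalForm_zero_eq]
  beta_reduce
  rw [weightForm_self, Complex.add_re, Complex.ofReal_re]
  congr 1
  change ((∫ z, totalCreation v Ψ Ψ z ∂_) + conj (∫ z, totalCreation v Ψ Ψ z ∂_)).re = _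
  rw [Complex.add_re, Complex.conj_re]; ring

/-- The Hamiltonian is the direct integral of its fibers. -/
theorem IsFiber.integral_fiberForm (hH : DefinesHamiltonian v ω) {F : E d → Fock d} {Ψ : Total d}
    (hF : IsFiber F Ψ) (hΨ : Ψ ∈ totalDomain ω) :
    Integrable (fun P => (fiberForm v ω P (F P) (F P)).re) ∧
      (totalForm v ω 0 Ψ Ψ).re = ∫ P, (fiberForm v ω P (F P) (F P)).re := by
  have h1 := (hF.integral_weight (w := fun z => ‖z.1‖ ^ 2 + fieldEnergy ω z.2) hΨ).2
  have h2 := (hF.integral_creation hF (hH.integrable Ψ hΨ Ψ hΨ)).2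
  simp only [fiberForm_self, totalForm_self]
  have h3 := h2.1.re.const_mul 2
  refine ⟨h1.1.add h3, ?_⟩
  rw [← h1.2, ← h2.2]
  refine Eq.trans ?_ (integral_add h1.1 h3).symm
  congr 1
  rw [integral_const_mul]
  congr 1
  exact (integral_re h2.1).symm

/-! ### States with prescribed fibers -/

theorem memLp_tensor (g : Lp ℂ 2 (volume : Measure (E d))) (Φ : Fock d) :
    MemLp (fun z : E d × Config d =>
      g (unshear z).1 * (Φ : Lp ℂ 2 (configMeasure d)) (unshear z).2) 2 (totalMeasure d) := by
  have h : MemLp (fun z : E d × Config d => g z.1 * (Φ : Lp ℂ 2 (configMeasure d)) z.2) 2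
      (totalMeasure d) := by
    refine memLp_two_of_sq ?_ ?_
    · exact (Lp.aestronglyMeasurable g).comp_fst.mul (Lp.aestronglyMeasurable _).comp_snd
    · have := (integrable_norm_sq g).mul_prod
        (integrable_norm_sq (Φ : Lp ℂ 2 (configMeasure d)))
      refine this.congr (Eventually.of_forall fun z => ?_)
      simp only [norm_mul, mul_pow]
  exact h.comp_measurePreserving measurePreserving_unshear

theorem ae_symm_Fock (Φ : Fock d) : ∀ᵐ c ∂(configMeasure d), ∀ σ,
    (Φ : Lp ℂ 2 (configMeasure d)) (permute σ c) = (Φ : Lp ℂ 2 (configMeasure d)) c :=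
  mem_Fock_iff.1 Φ.2

/-- The state whose component of total momentum `P` is `g(P) Φ`. -/
noncomputable def tensor (g : Lp ℂ 2 (volume : Measure (E d))) (Φ : Fock d) : Total d :=
  ⟨(memLp_tensor g Φ).toLp _, toLp_mem_Total _ fun σ => by
    have h : ∀ᵐ z ∂(totalMeasure d), (Φ : Lp ℂ 2 (configMeasure d)) (permute σ z.2) =
        (Φ : Lp ℂ 2 (configMeasure d)) z.2 :=
      Measure.quasiMeasurePreserving_snd.ae ((ae_symm_Fock Φ).mono fun c hc => hc σ)
    filter_upwards [h] with z hz
    simp only [unshear, fieldMomentum_permute, hz]⟩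

theorem coeFn_tensor (g : Lp ℂ 2 (volume : Measure (E d))) (Φ : Fock d) :
    (tensor g Φ : Lp ℂ 2 (totalMeasure d)) =ᵐ[totalMeasure d] fun z =>
      g (unshear z).1 * (Φ : Lp ℂ 2 (configMeasure d)) (unshear z).2 :=
  (memLp_tensor g Φ).coeFn_toLp

theorem isFiber_tensor (g : Lp ℂ 2 (volume : Measure (E d))) (Φ : Fock d) :
    IsFiber (fun P => g P • Φ) (tensor g Φ) := by
  have h := measurePreserving_shear.quasiMeasurePreserving.ae (coeFn_tensor g Φ)
  refine (Measure.ae_ae_of_ae_prod h).mono fun P hP => ?_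
  filter_upwards [hP, Lp.coeFn_smul (g P) (Φ : Lp ℂ 2 (configMeasure d))] with c h1 h2
  rw [h1, unshear_shear]
  exact h2

theorem IsFiber.add {F G : E d → Fock d} {χ Ψ : Total d} (hF : IsFiber F χ) (hG : IsFiber G Ψ) :
    IsFiber (fun P => F P + G P) (χ + Ψ) := by
  have h := Measure.ae_ae_of_ae_prod (measurePreserving_shear.quasiMeasurePreserving.ae
    (Lp.coeFn_add (χ : Lp ℂ 2 (totalMeasure d)) Ψ))
  filter_upwards [hF, hG, h] with P h1 h2 h3
  filter_upwards [h1, h2, h3,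
    Lp.coeFn_add (F P : Lp ℂ 2 (configMeasure d)) (G P)] with c e1 e2 e3 e4
  rw [Submodule.coe_add, Submodule.coe_add, e3, e4, Pi.add_apply, Pi.add_apply, e1, e2]

theorem IsFiber.sub {F G : E d → Fock d} {χ Ψ : Total d} (hF : IsFiber F χ) (hG : IsFiber G Ψ) :
    IsFiber (fun P => F P - G P) (χ - Ψ) := by
  have h := Measure.ae_ae_of_ae_prod (measurePreserving_shear.quasiMeasurePreserving.ae
    (Lp.coeFn_sub (χ : Lp ℂ 2 (totalMeasure d)) Ψ))
  filter_upwards [hF, hG, h] with P h1 h2 h3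
  filter_upwards [h1, h2, h3,
    Lp.coeFn_sub (F P : Lp ℂ 2 (configMeasure d)) (G P)] with c e1 e2 e3 e4
  rw [Submodule.coe_sub, Submodule.coe_sub, e3, e4, Pi.sub_apply, Pi.sub_apply, e1, e2]

theorem IsFiber.sum {ι : Type*} (s : Finset ι) {F : ι → E d → Fock d} {Ψ : ι → Total d}
    (hF : ∀ i ∈ s, IsFiber (F i) (Ψ i)) :
    IsFiber (fun P => ∑ i ∈ s, F i P) (∑ i ∈ s, Ψ i) := by
  classical
  induction s using Finset.induction_on with
  | empty =>
    simp only [Finset.sum_empty]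
    have h := Measure.ae_ae_of_ae_prod (measurePreserving_shear.quasiMeasurePreserving.ae
      (Lp.coeFn_zero ℂ 2 (totalMeasure d)))
    filter_upwards [h] with P hP
    filter_upwards [hP, Lp.coeFn_zero ℂ 2 (configMeasure d)] with c h1 h2
    rw [Submodule.coe_zero, Submodule.coe_zero, h1, h2]; rfl
  | insert a s ha ih =>
    simp only [Finset.sum_insert ha]
    exact (hF a (Finset.mem_insert_self a s)).add
      (ih fun i hi => hF i (Finset.mem_insert_of_mem hi))

theorem IsFiber.congr {F G : E d → Fock d} {Ψ : Total d} (hF : IsFiber F Ψ)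
    (h : ∀ᵐ P, F P = G P) : IsFiber G Ψ := by
  filter_upwards [hF, h] with P h1 h2
  rw [← h2]; exact h1

end Disintegration

/-! ### The fibers as forms: domains, dependence on the momentum, lower bounds. -/

section Fibers

variable {d : ℕ} {v : E d → ℂ} {ω : E d → ℝ}

/-- Finite expectation of `P_f²` and of `H_f`. -/
def HasMoments (ω : E d → ℝ) (Φ : Fock d) : Prop :=
  Integrable (fun c => ‖fieldMomentum c‖ ^ 2 * ‖(Φ : Lp ℂ 2 (configMeasure d)) c‖ ^ 2)
    (configMeasure d) ∧
  Integrable (fun c => fieldEnergy ω c * ‖(Φ : Lp ℂ 2 (configMeasure d)) c‖ ^ 2)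
    (configMeasure d)

theorem integrable_norm_sq_Fock (Φ : Fock d) :
    Integrable (fun c => ‖(Φ : Lp ℂ 2 (configMeasure d)) c‖ ^ 2) (configMeasure d) :=
  integrable_norm_sq _

theorem norm_sub_sq_le {F : Type*} [SeminormedAddCommGroup F] (a b : F) :
    ‖a - b‖ ^ 2 ≤ 2 * ‖a‖ ^ 2 + 2 * ‖b‖ ^ 2 := by
  have := norm_sub_le a b
  nlinarith [sq_nonneg (‖a‖ - ‖b‖), norm_nonneg (a - b)]

theorem aestronglyMeasurable_norm_sq_Fock (Φ : Fock d) :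
    AEStronglyMeasurable (fun c => ‖(Φ : Lp ℂ 2 (configMeasure d)) c‖ ^ 2) (configMeasure d) :=
  (integrable_norm_sq_Fock Φ).1

theorem HasMoments.integrable_sub {Φ : Fock d} (h : HasMoments ω Φ) (P : E d) :
    Integrable (fun c => ‖P - fieldMomentum c‖ ^ 2 * ‖(Φ : Lp ℂ 2 (configMeasure d)) c‖ ^ 2)
      (configMeasure d) := by
  have hm := measurable_fieldMomentum (d := d)
  refine Integrable.mono' (((integrable_norm_sq_Fock Φ).const_mul (2 * ‖P‖ ^ 2)).add
    (h.1.const_mul 2)) ((Measurable.aestronglyMeasurable (by fun_prop)).mul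
      (aestronglyMeasurable_norm_sq_Fock Φ)) (Eventually.of_forall fun c => ?_)
  rw [Real.norm_of_nonneg (by positivity)]
  have := mul_le_mul_of_nonneg_right (norm_sub_sq_le P (fieldMomentum c))
    (sq_nonneg ‖(Φ : Lp ℂ 2 (configMeasure d)) c‖)
  simp only [Pi.add_apply]
  linarith

theorem HasMoments.mem_fiberDomain {Φ : Fock d} (h : HasMoments ω Φ) (P : E d) :
    Φ ∈ fiberDomain ω P := by
  refine ((h.integrable_sub P).add h.2).congr (Eventually.of_forall fun c => ?_)
  simp only [Pi.add_apply]; ring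

/-- With `ω ≥ 0` the two terms of the weight cannot cancel, so each is integrable by itself.
Together with `HasMoments.mem_fiberDomain` this shows that the form domain does not depend on `P`;
thus a ground state at one momentum is a trial state at every other. -/
theorem hasMoments_of_mem_fiberDomain (hω : Measurable ω) (h0 : ∀ᵐ k, 0 ≤ ω k) {P : E d}
    {Φ : Fock d} (hΦ : Φ ∈ fiberDomain ω P) : HasMoments ω Φ := by
  have hm := measurable_fieldMomentum (d := d)
  have hme := measurable_fieldEnergy hω
  have hE := fieldEnergy_nonneg h0
  have hΦ' : Integrable (fun c => (‖P - fieldMomentum c‖ ^ 2 + fieldEnergy ω c) *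
    ‖(Φ : Lp ℂ 2 (configMeasure d)) c‖ ^ 2) (configMeasure d) := hΦ
  constructor
  · refine Integrable.mono' (((integrable_norm_sq_Fock Φ).const_mul (2 * ‖P‖ ^ 2)).add
      (hΦ'.const_mul 2)) ((Measurable.aestronglyMeasurable (by fun_prop)).mul
        (aestronglyMeasurable_norm_sq_Fock Φ)) ?_
    filter_upwards [hE] with c hc
    rw [Real.norm_of_nonneg (by positivity)]
    have h1 := norm_sub_sq_le P (P - fieldMomentum c)
    rw [sub_sub_cancel] at h1
    have h2 := mul_le_mul_of_nonneg_right h1 (sq_nonneg ‖(Φ : Lp ℂ 2 (configMeasure d)) c‖)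
    have h3 := mul_nonneg hc (sq_nonneg ‖(Φ : Lp ℂ 2 (configMeasure d)) c‖)
    simp only [Pi.add_apply]
    linarith
  · refine Integrable.mono' hΦ' (hme.aestronglyMeasurable.mul
        (aestronglyMeasurable_norm_sq_Fock Φ)) ?_
    filter_upwards [hE] with c hc
    rw [Real.norm_of_nonneg (by positivity)]
    gcongr
    have := sq_nonneg ‖P - fieldMomentum c‖
    linarith

theorem DefinesHamiltonian.hasMoments (hH : DefinesHamiltonian v ω) {P : E d} {Φ : Fock d}
    (hΦ : Φ ∈ fiberDomain ω P) : HasMoments ω Φ :=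
  hasMoments_of_mem_fiberDomain hH.measurable_ω hH.omega_nonneg hΦ

/-- The particle momentum is `P - P_f`. The support of `g` bounds `P`, and the moments of `Φ`
control `P_f²` and `H_f`. -/
theorem tensor_mem_totalDomain (hω : Measurable ω) {R : ℝ}
    {g : Lp ℂ 2 (volume : Measure (E d))} (hg : ∀ᵐ p, R ≤ ‖p‖ → g p = 0) {Φ : Fock d}
    (hΦ : HasMoments ω Φ) : tensor g Φ ∈ totalDomain ω := by
  have hm := measurable_fieldMomentum (d := d)
  have hme := measurable_fieldEnergy hω
  have hi1 : Integrable (fun z : E d × Config d => (‖z.1‖ ^ 2 * ‖g z.1‖ ^ 2) *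
      ‖(Φ : Lp ℂ 2 (configMeasure d)) z.2‖ ^ 2) (totalMeasure d) :=
    (integrable_kin_of_bounded_support hg).mul_prod (integrable_norm_sq_Fock Φ)
  have hi2 : Integrable (fun z : E d × Config d => ‖g z.1‖ ^ 2 *
      (‖fieldMomentum z.2‖ ^ 2 * ‖(Φ : Lp ℂ 2 (configMeasure d)) z.2‖ ^ 2)) (totalMeasure d) :=
    (integrable_norm_sq g).mul_prod hΦ.1
  have hi3 : Integrable (fun z : E d × Config d => ‖g z.1‖ ^ 2 *
      (fieldEnergy ω z.2 * ‖(Φ : Lp ℂ 2 (configMeasure d)) z.2‖ ^ 2)) (totalMeasure d) :=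
    (integrable_norm_sq g).mul_prod hΦ.2
  have hgm : AEStronglyMeasurable (fun z : E d × Config d => ‖g z.1‖ ^ 2) (totalMeasure d) :=
    (integrable_norm_sq g).1.comp_fst
  have hΦm : AEStronglyMeasurable (fun z : E d × Config d =>
      ‖(Φ : Lp ℂ 2 (configMeasure d)) z.2‖ ^ 2) (totalMeasure d) :=
    (aestronglyMeasurable_norm_sq_Fock Φ).comp_snd
  have hi4 : Integrable (fun z : E d × Config d => ‖z.1 - fieldMomentum z.2‖ ^ 2 *
      (‖g z.1‖ ^ 2 * ‖(Φ : Lp ℂ 2 (configMeasure d)) z.2‖ ^ 2)) (totalMeasure d) := by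
    refine Integrable.mono' ((hi1.const_mul 2).add (hi2.const_mul 2))
      ((Measurable.aestronglyMeasurable (by fun_prop)).mul (hgm.mul hΦm))
      (Eventually.of_forall fun z => ?_)
    rw [Real.norm_of_nonneg (by positivity)]
    have := mul_le_mul_of_nonneg_right (norm_sub_sq_le z.1 (fieldMomentum z.2))
      (mul_nonneg (sq_nonneg ‖g z.1‖) (sq_nonneg ‖(Φ : Lp ℂ 2 (configMeasure d)) z.2‖))
    simp only [Pi.add_apply]
    linarith
  have hi5 := (measurePreserving_unshear (d := d)).integrable_comp_of_integrable (hi4.add hi3)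
  change Integrable _ _
  refine hi5.congr ?_
  filter_upwards [coeFn_tensor g Φ] with z hz
  rw [hz]
  simp only [Function.comp_apply, Pi.add_apply, norm_mul, mul_pow, unshear, add_sub_cancel_right]
  ring

/-- The indicator function of a ball, as a square integrable function. -/
noncomputable def ballIndicator (P : E d) (r : ℝ) : Lp ℂ 2 (volume : Measure (E d)) :=
  indicatorConstLp 2 (measurableSet_ball (x := P) (ε := r)) measure_ball_lt_top.ne 1

theorem coeFn_ballIndicator (P : E d) (r : ℝ) :
    ballIndicator P r =ᵐ[volume] (Metric.ball P r).indicator fun _ => (1 : ℂ) :=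
  indicatorConstLp_coeFn

theorem ballIndicator_support (P : E d) (r : ℝ) :
    ∀ᵐ p, ‖P‖ + r ≤ ‖p‖ → ballIndicator P r p = 0 := by
  filter_upwards [coeFn_ballIndicator P r] with p hp h
  rw [hp, Set.indicator_of_notMem]
  rw [mem_ball_iff_norm, not_lt]
  have := norm_sub_norm_le p P
  linarith

/-- Absolute convergence is assumed only for `H`. Applied to product states over a ball of total
momenta it yields convergence in almost every fiber, and the fiber integrand does not depend on `P`,
so one good `P` in the ball suffices. -/
theorem DefinesHamiltonian.integrable_fiberCreation (hH : DefinesHamiltonian v ω) {χ Φ : Fock d}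
    (hχ : HasMoments ω χ) (hΦ : HasMoments ω Φ) :
    Integrable (fiberCreation v χ Φ) (totalMeasure d) := by
  set g := ballIndicator (0 : E d) 1 with hg
  have hdom : ∀ {Φ : Fock d}, HasMoments ω Φ → tensor g Φ ∈ totalDomain ω := fun h =>
    tensor_mem_totalDomain hH.measurable_ω (ballIndicator_support 0 1) h
  have h1 := ((isFiber_tensor g χ).integral_creation (isFiber_tensor g Φ)
    (hH.integrable _ (hdom hχ) _ (hdom hΦ))).1
  have h2 : ∃ᵐ P : E d, P ∈ Metric.ball (0 : E d) 1 := by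
    rw [frequently_ae_iff]
    exact (Metric.measure_ball_pos volume (0 : E d) one_pos).ne'
  obtain ⟨P, hP, hi, hgP⟩ := (h2.and_eventually (h1.and (coeFn_ballIndicator (0 : E d) 1))).exists
  rw [← hg, Set.indicator_of_mem hP] at hgP
  simpa only [hgP, one_smul] using hi

/-- The form domain of `(P - P_f)² + H_f`, as a subspace. -/
noncomputable def fiberSubmodule (hω : Measurable ω) (P : E d) : Submodule ℂ (Fock d) :=
  (weightDomain (aestronglyMeasurable_fiberWeight hω P)).comap (Fock d).subtype

theorem DefinesHamiltonian.isHermitianForm_fiber (hH : DefinesHamiltonian v ω) (P : E d) :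
    IsHermitianForm (fiberSubmodule hH.measurable_ω P) (fiberForm v ω P) := by
  rw [fiberForm_eq]
  refine ((isHermitianForm_weightForm
    (aestronglyMeasurable_fiberWeight hH.measurable_ω P)).restrict (Fock d)).add ?_
  have := (isHermitianForm_creationForm (Q := (fiberSubmodule hH.measurable_ω P).map
    (Fock d).subtype) (u := fun z : E d × Config d => coupling v z.1 z.2)
    quasiMeasurePreserving_cons Measure.quasiMeasurePreserving_snd ?_).restrict (Fock d)
  · refine this.mono fun Ψ hΨ => ?_
    exact ⟨Ψ, hΨ, rfl⟩
  · rintro f ⟨χ, hχ, rfl⟩ g ⟨Ψ, hΨ, rfl⟩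
    exact hH.integrable_fiberCreation (hH.hasMoments (P := P) hχ) (hH.hasMoments (P := P) hΨ)

theorem DefinesHamiltonian.fiberForm_smul (hH : DefinesHamiltonian v ω) {P : E d} {Φ : Fock d}
    (hΦ : HasMoments ω Φ) (a : ℂ) :
    (fiberForm v ω P (a • Φ) (a • Φ)).re = ‖a‖ ^ 2 * (fiberForm v ω P Φ Φ).re := by
  have hq := hH.isHermitianForm_fiber P
  have hm : Φ ∈ fiberSubmodule hH.measurable_ω P := hΦ.mem_fiberDomain P
  rw [hq.smul_right _ (Submodule.smul_mem _ a hm) _ hm, hq.smul_left hm hm, ← mul_assoc,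
    Complex.mul_conj, Complex.normSq_eq_norm_sq, Complex.re_ofReal_mul]

/-- The fibers as functions of the total momentum. -/
theorem HasMoments.exists_fiberForm_eq {Φ : Fock d} (hΦ : HasMoments ω Φ) (P : E d) :
    ∃ w : E d, ∀ P' : E d, (fiberForm v ω P' Φ Φ).re = (fiberForm v ω P Φ Φ).re +
      2 * inner ℝ (P' - P) w + ‖P' - P‖ ^ 2 * ‖Φ‖ ^ 2 := by
  have hm := measurable_fieldMomentum (d := d)
  set n : Config d → ℝ := fun c => ‖(Φ : Lp ℂ 2 (configMeasure d)) c‖ ^ 2 with hn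
  have hni : Integrable n (configMeasure d) := integrable_norm_sq_Fock Φ
  have hw : Integrable (fun c => n c • (P - fieldMomentum c)) (configMeasure d) := by
    refine Integrable.mono' (hni.add (hΦ.integrable_sub P))
      (hni.1.smul (Measurable.aestronglyMeasurable (by fun_prop)))
      (Eventually.of_forall fun c => ?_)
    rw [norm_smul, Real.norm_of_nonneg (sq_nonneg _)]
    simp only [Pi.add_apply]
    have h0 : 0 ≤ n c := sq_nonneg _
    have h1 : ‖P - fieldMomentum c‖ ≤ 1 + ‖P - fieldMomentum c‖ ^ 2 := by
      nlinarith [sq_nonneg (‖P - fieldMomentum c‖ - 1)]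
    have := mul_le_mul_of_nonneg_left h1 h0
    simp only [hn] at *
    linarith
  -- The vector `w` is the expectation of `P - P_f`, half the gradient of the energy with respect to
  -- the momentum.
  refine ⟨∫ c, n c • (P - fieldMomentum c) ∂(configMeasure d), fun P' => ?_⟩
  rw [fiberForm_self, fiberForm_self, ← integral_inner hw, norm_sq_Fock]
  have hdom : Integrable (fun c => (‖P - fieldMomentum c‖ ^ 2 + fieldEnergy ω c) * n c)
    (configMeasure d) := hΦ.mem_fiberDomain P
  have hin : Integrable (fun c => 2 * inner ℝ (P' - P) (n c • (P - fieldMomentum c)))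
    (configMeasure d) := (hw.const_inner (𝕜 := ℝ) (P' - P)).const_mul 2
  have e : ∫ c, (‖P' - fieldMomentum c‖ ^ 2 + fieldEnergy ω c) * n c ∂(configMeasure d) =
      ∫ c, ((‖P - fieldMomentum c‖ ^ 2 + fieldEnergy ω c) * n c +
        2 * inner ℝ (P' - P) (n c • (P - fieldMomentum c))) + ‖P' - P‖ ^ 2 * n c
        ∂(configMeasure d) := by
    congr 1; funext c
    have : P' - fieldMomentum c = (P' - P) + (P - fieldMomentum c) := by abel
    rw [this, norm_add_sq_real, inner_smul_right]
    ring
  have hsum : Integrable (fun c => (‖P - fieldMomentum c‖ ^ 2 + fieldEnergy ω c) * n c +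
      2 * inner ℝ (P' - P) (n c • (P - fieldMomentum c))) (configMeasure d) := hdom.add hin
  rw [e, integral_add hsum (hni.const_mul _), integral_add hdom hin, integral_const_mul,
    integral_const_mul]
  ring

theorem DefinesHamiltonian.totalForm_tensor (hH : DefinesHamiltonian v ω) {R : ℝ}
    {g : Lp ℂ 2 (volume : Measure (E d))} (hg : ∀ᵐ p, R ≤ ‖p‖ → g p = 0) {Φ : Fock d}
    (hΦ : HasMoments ω Φ) :
    Integrable (fun P => ‖g P‖ ^ 2 * (fiberForm v ω P Φ Φ).re) ∧
    (totalForm v ω 0 (tensor g Φ) (tensor g Φ)).re =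
      ∫ P, ‖g P‖ ^ 2 * (fiberForm v ω P Φ Φ).re := by
  have h := (isFiber_tensor g Φ).integral_fiberForm hH
    (tensor_mem_totalDomain hH.measurable_ω hg hΦ)
  have e : ∀ P, (fiberForm v ω P (g P • Φ) (g P • Φ)).re = ‖g P‖ ^ 2 * (fiberForm v ω P Φ Φ).re :=
    fun P => hH.fiberForm_smul hΦ (g P)
  exact ⟨h.1.congr (Eventually.of_forall e), h.2.trans (integral_congr_ae (Eventually.of_forall e))⟩

theorem norm_sq_tensor (g : Lp ℂ 2 (volume : Measure (E d))) (Φ : Fock d) :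
    ‖tensor g Φ‖ ^ 2 = ‖g‖ ^ 2 * ‖Φ‖ ^ 2 := by
  rw [(isFiber_tensor g Φ).norm_sq.2, norm_sq_eq_integral g, ← integral_mul_const]
  congr 1; funext P
  rw [norm_smul, mul_pow]

/-- The fibers are bounded from below. -/
theorem DefinesHamiltonian.fiber_bounded_below (hH : DefinesHamiltonian v ω) {C : ℝ}
    (hC : ∀ Ψ ∈ totalDomain ω, C * ‖Ψ‖ ^ 2 ≤ (totalForm v ω 0 Ψ Ψ).re) {Φ : Fock d}
    (hΦ : HasMoments ω Φ) (P : E d) : C * ‖Φ‖ ^ 2 ≤ (fiberForm v ω P Φ Φ).re := by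
  obtain ⟨w, hw⟩ := hΦ.exists_fiberForm_eq (v := v) P
  have hcont : Continuous fun P' => (fiberForm v ω P' Φ Φ).re := by
    rw [funext hw]; fun_prop
  -- The bound for `H` only controls averages over `P`. Since the form is continuous in `P`, a
  -- violation at one momentum persists on a ball, and the product state over that ball contradicts
  -- the bound.
  by_contra! hlt
  obtain ⟨b, hb1, hb2⟩ := exists_between hlt
  obtain ⟨r, hr, hball⟩ := Metric.eventually_nhds_iff_ball.1
    (hcont.continuousAt.eventually (gt_mem_nhds hb1))
  set g := ballIndicator P r with hg
  have hsupp := ballIndicator_support P r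
  have h1 := hC _ (tensor_mem_totalDomain hH.measurable_ω hsupp hΦ)
  obtain ⟨h2, h3⟩ := hH.totalForm_tensor hsupp hΦ
  rw [h3, norm_sq_tensor, norm_sq_eq_integral] at h1
  have h4 : ∫ P', ‖g P'‖ ^ 2 * (fiberForm v ω P' Φ Φ).re ≤ ∫ P', ‖g P'‖ ^ 2 * b := by
    refine integral_mono_ae h2 ((integrable_norm_sq g).mul_const b) ?_
    filter_upwards [coeFn_ballIndicator P r] with P' hP'
    rw [← hg] at hP'
    by_cases h : P' ∈ Metric.ball P r
    · exact mul_le_mul_of_nonneg_left (hball P' h).le (sq_nonneg _)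
    · rw [hP', Set.indicator_of_notMem h]; simp
  rw [integral_mul_const] at h4
  have h5 : 0 < ∫ P', ‖g P'‖ ^ 2 := by
    have e : (fun P' => ‖g P'‖ ^ 2) =ᵐ[volume] (Metric.ball P r).indicator fun _ => (1 : ℝ) := by
      filter_upwards [coeFn_ballIndicator P r] with P' hP'
      rw [← hg] at hP'
      rw [hP']
      by_cases h : P' ∈ Metric.ball P r <;> simp [h]
    rw [integral_congr_ae e, integral_indicator_const _ measurableSet_ball]
    have := ENNReal.toReal_pos (Metric.measure_ball_pos volume P hr).ne' measure_ball_lt_top.ne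
    simpa [Measure.real] using this
  nlinarith

/-- The variational characterization of `E(P)`. -/
theorem DefinesHamiltonian.fiberEnergy_isGreatest (hH : DefinesHamiltonian v ω) {Φ₀ : Fock d}
    (h0 : Φ₀ ≠ 0) (hΦ₀ : HasMoments ω Φ₀) (P : E d) :
    IsGreatest {b : ℝ | ∀ Φ ∈ fiberDomain ω P, b * ‖Φ‖ ^ 2 ≤ (fiberForm v ω P Φ Φ).re}
      (fiberEnergy v ω P) := by
  obtain ⟨C, hC⟩ := hH.bounded_below
  exact (hH.isHermitianForm_fiber P).infSpec_isGreatest (hH.selfAdjoint_fiber P).containsAdjoint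
    ⟨C, fun Φ hΦ => hH.fiber_bounded_below hC (hH.hasMoments (P := P) hΦ) P⟩
    ⟨Φ₀, hΦ₀.mem_fiberDomain P, h0⟩

end Fibers

/-! ### Lower bound on the energy in the external potential. -/

section LowerBound

variable {d : ℕ} {v : E d → ℂ} {ω : E d → ℝ} {V : E d → ℝ} {W : E d → ℂ}

/-- The variational characterization of the ground state energy in a scaled external potential. -/
theorem HasFourier.infSpec_hamiltonian_isGreatest (h : HasFourier V W)
    (hH : DefinesHamiltonian v ω) {Φ₀ : Fock d} (h0 : Φ₀ ≠ 0) (hΦ₀ : HasMoments ω Φ₀)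
    {s : ℝ} (hs : 0 < s) :
    IsGreatest {b : ℝ | ∀ Ψ ∈ totalDomain ω,
      b * ‖Ψ‖ ^ 2 ≤ (totalForm v ω 0 Ψ Ψ).re + (totalPot W s Ψ Ψ).re}
      (infSpec (hamiltonian v ω fun x => s ^ 2 * V (s • x))) := by
  unfold hamiltonian
  rw [h.totalForm_eq v ω hs.ne']
  have hP := h.isHermitianForm_totalPot hs.ne'
  obtain ⟨C, hC⟩ := hH.bounded_below
  have hq := hH.isHermitianForm.add (hP.mono le_top)
  have hne : ∃ Ψ ∈ totalSubmodule hH.measurable_ω, Ψ ≠ 0 := by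
    refine ⟨tensor (ballIndicator 0 1) Φ₀,
      tensor_mem_totalDomain hH.measurable_ω (ballIndicator_support 0 1) hΦ₀, fun hz => ?_⟩
    have h1 := norm_sq_tensor (ballIndicator (0 : E d) 1) Φ₀
    rw [hz, norm_zero, zero_pow two_ne_zero] at h1
    have h2 : ‖ballIndicator (0 : E d) 1‖ ≠ 0 := by
      unfold ballIndicator
      rw [norm_indicatorConstLp two_ne_zero ENNReal.ofNat_ne_top]
      have h3 : 0 < (volume : Measure (E d)).real (Metric.ball 0 1) :=
        ENNReal.toReal_pos (Metric.measure_ball_pos volume (0 : E d) one_pos).ne'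
          measure_ball_lt_top.ne
      have := Real.rpow_pos_of_pos h3 (1 / (2 : ℝ≥0∞).toReal)
      simpa using this.ne'
    have h3 : ‖Φ₀‖ ≠ 0 := norm_ne_zero_iff.2 h0
    exact mul_ne_zero (pow_ne_zero 2 h2) (pow_ne_zero 2 h3) h1.symm
  have hG := hq.infSpec_isGreatest
    (hH.selfAdjoint.containsAdjoint.add_bounded hP (h.norm_totalPot_le s))
    ⟨C - s ^ 2 * ∫ ξ, ‖W ξ‖, fun Ψ hΨ => ?_⟩ hne
  · simp only [Complex.add_re] at hG
    exact hG
  · have h1 := hC Ψ hΨ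
    have h2 := (Complex.abs_re_le_norm _).trans (h.norm_totalPot_le s Ψ Ψ)
    have h3 := neg_abs_le (totalPot W s Ψ Ψ).re
    rw [Complex.add_re]
    nlinarith

/-- The form of the potential in terms of the total momentum. -/
theorem shiftForm_comp_shear (s : ℝ) (χ Ψ χ' Ψ' : Lp ℂ 2 (totalMeasure d))
    (hχ : χ' =ᵐ[totalMeasure d] fun z => χ (shear z))
    (hΨ : Ψ' =ᵐ[totalMeasure d] fun z => Ψ (shear z)) :
    shiftForm W (totalShift s) (totalMeasure d) χ' Ψ' =
      shiftForm W (totalShift s) (totalMeasure d) χ Ψ := by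
  rw [shiftForm_congr (isShift_totalShift s) hχ hΨ]
  unfold shiftForm
  congr 1; funext ξ; congr 1
  refine Eq.trans ?_ (measurePreserving_shear.integral_comp (shearEquiv d).measurableEmbedding
    fun z => conj (χ z) * Ψ (totalShift s ξ z))
  congr 1; funext z
  have : shear (totalShift s ξ z) = totalShift s ξ (shear z) := by
    simp only [shear, totalShift, Prod.mk.injEq, and_true]; abel
  beta_reduce
  rw [this]

/-- In the coordinates `(P, c)` the potential translates `P` at fixed `c`. So the one-particle bound
holds for each slice of fixed boson momenta, and integration over `c` gives the claim. -/
theorem HasFourier.exists_scaled_lower_bound_total (h : HasFourier V W) (m : ℝ≥0∞)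
    (hne : ∃ f ∈ schrodingerDomain d m, f ≠ 0) {C : ℝ} (hC : 0 < C) {η : ℝ} (hη : 0 < η) :
    ∃ s₀ : ℝ, 0 < s₀ ∧ ∀ s : ℝ, 0 < s → s ≤ s₀ → ∀ (Ψ : Total d) (F : E d → Fock d),
      IsFiber F Ψ →
      Integrable (fun P => invTwoMass m * (‖P‖ ^ 2 / (1 + C * ‖P‖ ^ 2)) * ‖F P‖ ^ 2) ∧
      s ^ 2 * (schrodingerEnergy V m - η) * ‖Ψ‖ ^ 2 ≤
        (∫ P, invTwoMass m * (‖P‖ ^ 2 / (1 + C * ‖P‖ ^ 2)) * ‖F P‖ ^ 2)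
          + (totalPot W s Ψ Ψ).re := by
  obtain ⟨s₀, hs₀, hlow⟩ := h.exists_scaled_lower_bound m hne hC hη
  refine ⟨s₀, hs₀, fun s hs hss Ψ F hF => ?_⟩
  set T : E d → ℝ := fun P => invTwoMass m * (‖P‖ ^ 2 / (1 + C * ‖P‖ ^ 2)) with hT
  have hm0 := invTwoMass_nonneg m
  have hTm : Measurable T := by fun_prop
  have hT0 : ∀ P, 0 ≤ T P := fun P => by positivity
  have hTb : ∀ P, T P ≤ invTwoMass m * (1 / C) := fun P => by
    refine mul_le_mul_of_nonneg_left ?_ hm0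
    rw [div_le_div_iff₀ (by positivity) hC]
    nlinarith
  set Ψ' : Lp ℂ 2 (totalMeasure d) := (memLp_shear Ψ).toLp _ with hΨ'
  have hco : Ψ' =ᵐ[totalMeasure d] fun z => (Ψ : Lp ℂ 2 (totalMeasure d)) (shear z) :=
    (memLp_shear Ψ).coeFn_toLp
  have hw : Integrable (fun z => T (unshear z).1 * ‖(Ψ : Lp ℂ 2 (totalMeasure d)) z‖ ^ 2)
      (totalMeasure d) := by
    refine Integrable.mono' ((integrable_norm_sq (Ψ : Lp ℂ 2 (totalMeasure d))).const_mul
      (invTwoMass m * (1 / C))) (AEStronglyMeasurable.mul ?_ (integrable_norm_sq _).1)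
      (Eventually.of_forall fun z => ?_)
    · exact (hTm.comp (measurable_fst.comp
        measurePreserving_unshear.measurable)).aestronglyMeasurable
    · rw [Real.norm_of_nonneg (mul_nonneg (hT0 _) (sq_nonneg _))]
      exact mul_le_mul_of_nonneg_right (hTb _) (sq_nonneg _)
  obtain ⟨hi, he⟩ := hF.integral_weight_fst hw
  refine ⟨hi, ?_⟩
  have hw' : Integrable (fun z : E d × Config d => T z.1 * ‖Ψ' z‖ ^ 2)
      ((volume : Measure (E d)).prod (configMeasure d)) := by
    refine (integrable_comp_shear hw).congr ?_
    filter_upwards [hco] with z hz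
    rw [hz, unshear_shear]
  have he' : ∫ P, T P * ‖F P‖ ^ 2 = ∫ c, (∫ p, T p * ‖Ψ' (p, c)‖ ^ 2) ∂(configMeasure d) := by
    rw [he, ← integral_comp_shear]
    refine Eq.trans ?_ (integral_prod_symm _ hw')
    refine integral_congr_ae ?_
    filter_upwards [hco] with z hz
    rw [hz, unshear_shear]
  have hn' : Integrable (fun z : E d × Config d => ‖Ψ' z‖ ^ 2)
      ((volume : Measure (E d)).prod (configMeasure d)) := integrable_norm_sq Ψ'
  have hnorm : ‖Ψ‖ ^ 2 = ∫ c, (∫ p, ‖Ψ' (p, c)‖ ^ 2) ∂(configMeasure d) := by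
    rw [norm_sq_Total, ← integral_comp_shear]
    refine Eq.trans ?_ (integral_prod_symm _ hn')
    refine integral_congr_ae ?_
    filter_upwards [hco] with z hz
    rw [hz]
  obtain ⟨hpi, hpe⟩ := integral_shiftForm_fiber h.integrable s Ψ' Ψ'
  have hpot : (totalPot W s Ψ Ψ).re = s ^ 2 * ∫ c, (shiftForm W
      (fun ξ p => p - (2 * Real.pi * s) • ξ) volume (fun p => Ψ' (p, c)) (fun p => Ψ' (p, c))).re
      ∂(configMeasure d) := by
    unfold totalPot
    rw [Complex.re_ofReal_mul, ← shiftForm_comp_shear s _ _ Ψ' Ψ' hco hco, ← hpe]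
    congr 1
    exact (integral_re hpi).symm
  have hpi' : Integrable (fun c => s ^ 2 * (shiftForm W (fun ξ p => p - (2 * Real.pi * s) • ξ)
      volume (fun p => Ψ' (p, c)) (fun p => Ψ' (p, c))).re) (configMeasure d) :=
    hpi.re.const_mul _
  have hwi : Integrable (fun c => ∫ p, T p * ‖Ψ' (p, c)‖ ^ 2) (configMeasure d) :=
    hw'.integral_prod_right
  rw [hnorm, hpot, he', ← integral_const_mul, ← integral_const_mul, ← integral_add hwi hpi']
  refine integral_mono_ae (hn'.integral_prod_right.const_mul _) (hwi.add hpi') ?_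
  filter_upwards [ae_memLp_snd (Lp.memLp Ψ')] with c hc
  have hb := hlow s hs hss (hc.toLp _)
  rw [norm_sq_eq_integral] at hb
  have e1 : ∀ w : E d → ℝ, ∫ p, w p * ‖hc.toLp _ p‖ ^ 2 = ∫ p, w p * ‖Ψ' (p, c)‖ ^ 2 := fun w => by
    refine integral_congr_ae ?_
    filter_upwards [hc.coeFn_toLp] with p hp
    rw [hp]
  have e2 := e1 fun _ => 1
  simp only [one_mul] at e2
  rw [e1, e2] at hb
  unfold potScaled at hb
  rw [shiftForm_congr (isShift_translate _) hc.coeFn_toLp hc.coeFn_toLp] at hb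
  exact hb

/-- The energy of a localized particle is at least that of a Schrödinger particle with the
dynamic effective mass. -/
theorem HasFourier.exists_le_infSpec_hamiltonian (h : HasFourier V W)
    (hH : DefinesHamiltonian v ω) {Φ₀ : Fock d} (h0 : Φ₀ ≠ 0) (hΦ₀ : HasMoments ω Φ₀) (m : ℝ≥0∞)
    (hne : ∃ f ∈ schrodingerDomain d m, f ≠ 0) {C : ℝ} (hC : 0 < C)
    (hbound : ∀ P : E d, fiberEnergy v ω 0 + invTwoMass m * (‖P‖ ^ 2 / (1 + C * ‖P‖ ^ 2))
      ≤ fiberEnergy v ω P) {η : ℝ} (hη : 0 < η) :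
    ∃ s₀ : ℝ, 0 < s₀ ∧ ∀ s : ℝ, 0 < s → s ≤ s₀ →
      fiberEnergy v ω 0 + s ^ 2 * (schrodingerEnergy V m - η) ≤
        infSpec (hamiltonian v ω fun x => s ^ 2 * V (s • x)) := by
  obtain ⟨s₀, hs₀, hlow⟩ := h.exists_scaled_lower_bound_total m hne hC hη
  refine ⟨s₀, hs₀, fun s hs hss => ?_⟩
  refine (h.infSpec_hamiltonian_isGreatest hH h0 hΦ₀ hs).2 fun Ψ hΨ => ?_
  obtain ⟨F, hF⟩ := exists_isFiber Ψ
  obtain ⟨hi, hle⟩ := hlow s hs hss Ψ F hF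
  obtain ⟨hq, hqe⟩ := hF.integral_fiberForm hH hΨ
  obtain ⟨hn, hne⟩ := hF.norm_sq
  have key : ∫ P, (fiberEnergy v ω 0 * ‖F P‖ ^ 2 +
      invTwoMass m * (‖P‖ ^ 2 / (1 + C * ‖P‖ ^ 2)) * ‖F P‖ ^ 2) ≤
      ∫ P, (fiberForm v ω P (F P) (F P)).re := by
    refine integral_mono_ae ((hn.const_mul _).add hi) hq ?_
    filter_upwards [hF.ae_mem_fiberDomain hΨ] with P hP
    have h1 := (hH.fiberEnergy_isGreatest h0 hΦ₀ P).1 (F P) hP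
    have h2 := mul_le_mul_of_nonneg_right (hbound P) (sq_nonneg ‖F P‖)
    linarith
  rw [integral_add (hn.const_mul _) hi, integral_const_mul, ← hne, ← hqe] at key
  linarith

end LowerBound

/-! ### Trial states and their energy. -/

section TrialStates

variable {d : ℕ} {v : E d → ℂ} {ω : E d → ℝ} {V : E d → ℝ} {W : E d → ℂ}

/-- The state with fibers `g(P) S(P)`, for a simple function `S`. -/
noncomputable def simpleState (S : SimpleFunc (E d) (Fock d))
    (g : Lp ℂ 2 (volume : Measure (E d))) : Total d :=
  ∑ φ ∈ S.range, tensor (cut (S.measurableSet_fiber φ) g) φ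

theorem isFiber_simpleState (S : SimpleFunc (E d) (Fock d))
    (g : Lp ℂ 2 (volume : Measure (E d))) :
    IsFiber (fun P => g P • S P) (simpleState S g) := by
  classical
  refine (IsFiber.sum S.range fun φ _ => isFiber_tensor _ φ).congr ?_
  have h : ∀ᵐ P : E d, ∀ φ ∈ S.range,
      cut (S.measurableSet_fiber φ) g P = (S ⁻¹' {φ}).indicator g P := by
    rw [Filter.eventually_all_finset]
    exact fun φ _ => coeFn_cut (S.measurableSet_fiber φ) g
  filter_upwards [h] with P hP
  rw [Finset.sum_eq_single_of_mem (S P) (S.mem_range_self P)]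
  · rw [hP _ (S.mem_range_self P), Set.indicator_of_mem (show P ∈ S ⁻¹' {S P} from rfl)]
  · intro φ hφ hne
    rw [hP φ hφ, Set.indicator_of_notMem (fun hc => hne hc.symm), zero_smul]

theorem simpleState_mem_totalDomain (hω : Measurable ω) {S : SimpleFunc (E d) (Fock d)}
    (hS : ∀ P, HasMoments ω (S P)) {R : ℝ} {g : Lp ℂ 2 (volume : Measure (E d))}
    (hg : ∀ᵐ p, R ≤ ‖p‖ → g p = 0) : simpleState S g ∈ totalDomain ω := by
  refine (totalSubmodule hω).sum_mem fun φ hφ => ?_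
  obtain ⟨P, rfl⟩ := SimpleFunc.mem_range.1 hφ
  refine tensor_mem_totalDomain hω (R := R) ?_ (hS P)
  filter_upwards [coeFn_cut (S.measurableSet_fiber (S P)) g, hg] with p h1 h2 h3
  rw [h1, Set.indicator_apply_eq_zero]
  exact fun _ => h2 h3

theorem DefinesHamiltonian.totalForm_simpleState (hH : DefinesHamiltonian v ω)
    {S : SimpleFunc (E d) (Fock d)} (hS : ∀ P, HasMoments ω (S P)) {R : ℝ}
    {g : Lp ℂ 2 (volume : Measure (E d))} (hg : ∀ᵐ p, R ≤ ‖p‖ → g p = 0) :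
    Integrable (fun P => ‖g P‖ ^ 2 * (fiberForm v ω P (S P) (S P)).re) ∧
    (totalForm v ω 0 (simpleState S g) (simpleState S g)).re =
      ∫ P, ‖g P‖ ^ 2 * (fiberForm v ω P (S P) (S P)).re := by
  have h := (isFiber_simpleState S g).integral_fiberForm hH
    (simpleState_mem_totalDomain hH.measurable_ω hS hg)
  have e : ∀ P, (fiberForm v ω P (g P • S P) (g P • S P)).re =
      ‖g P‖ ^ 2 * (fiberForm v ω P (S P) (S P)).re := fun P => hH.fiberForm_smul (hS P) (g P)
  exact ⟨h.1.congr (Eventually.of_forall e), h.2.trans (integral_congr_ae (Eventually.of_forall e))⟩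

theorem norm_simpleState {S : SimpleFunc (E d) (Fock d)} (hS : ∀ P, ‖S P‖ = 1)
    (g : Lp ℂ 2 (volume : Measure (E d))) : ‖simpleState S g‖ = ‖g‖ := by
  have h : ‖simpleState S g‖ ^ 2 = ‖g‖ ^ 2 := by
    rw [(isFiber_simpleState S g).norm_sq.2, norm_sq_eq_integral]
    congr 1; funext P
    rw [norm_smul, hS P, mul_one]
  exact (sq_eq_sq₀ (norm_nonneg _) (norm_nonneg _)).1 h

theorem norm_simpleState_sub_tensor_le {S : SimpleFunc (E d) (Fock d)} {Φ : Fock d} {ζ : ℝ}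
    (hζ : 0 ≤ ζ) (hS : ∀ P, ‖S P - Φ‖ ≤ ζ) (g : Lp ℂ 2 (volume : Measure (E d))) :
    ‖simpleState S g - tensor g Φ‖ ≤ ζ * ‖g‖ := by
  refine abs_le_of_sq_le_sq' ?_ (by positivity) |>.2
  obtain ⟨h1, h2⟩ := ((isFiber_simpleState S g).sub (isFiber_tensor g Φ)).norm_sq
  rw [h2, mul_pow, norm_sq_eq_integral, ← integral_const_mul]
  refine integral_mono_ae h1 ((integrable_norm_sq g).const_mul _) (Eventually.of_forall fun P => ?_)
  simp only
  rw [← smul_sub, norm_smul, mul_pow, mul_comm]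
  gcongr
  exact hS P

/-- In the coordinates `(P, c)` the state is the product `g(P) Φ(c)`, and the potential acts on the
first factor only. -/
theorem totalPot_tensor (hW : Integrable W) (s : ℝ) (g : Lp ℂ 2 (volume : Measure (E d)))
    (Φ : Fock d) : totalPot W s (tensor g Φ) (tensor g Φ) =
      ((s ^ 2 * ‖Φ‖ ^ 2 : ℝ) : ℂ) * potScaled W s g g := by
  have hco := (memLp_shear (tensor g Φ)).coeFn_toLp
  set Ψ' : Lp ℂ 2 (totalMeasure d) := (memLp_shear (tensor g Φ)).toLp _
  have hae : ∀ᵐ z ∂((volume : Measure (E d)).prod (configMeasure d)),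
      Ψ' z = g z.1 * (Φ : Lp ℂ 2 (configMeasure d)) z.2 := by
    filter_upwards [hco,
      measurePreserving_shear.quasiMeasurePreserving.ae (coeFn_tensor g Φ)] with z h1 h2
    exact h1.trans (by rw [h2, unshear_shear])
  have hslice : ∀ᵐ c ∂(configMeasure d), ∀ᵐ p : E d,
      Ψ' (p, c) = g p * (Φ : Lp ℂ 2 (configMeasure d)) c :=
    Measure.ae_ae_of_ae_prod (Measure.measurePreserving_swap.quasiMeasurePreserving.ae hae)
  unfold totalPot
  rw [← shiftForm_comp_shear s _ _ Ψ' Ψ' hco hco, ← (integral_shiftForm_fiber hW s Ψ' Ψ').2,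
    Complex.ofReal_mul, mul_assoc ((s ^ 2 : ℝ) : ℂ)]
  congr 1
  rw [norm_sq_Fock, ← integral_complex_ofReal, ← integral_mul_const]
  refine integral_congr_ae ?_
  filter_upwards [hslice] with c hc
  rw [shiftForm_congr (isShift_translate _) hc hc]
  unfold potScaled shiftForm
  rw [← integral_const_mul]
  congr 1; funext ξ
  rw [← conj_mul_self_eq, mul_left_comm]
  congr 1
  rw [← integral_const_mul]
  congr 1; funext p
  rw [map_mul]; ring

/-- The cross terms contribute `2ζ` and the quadratic one `ζ² ≤ ζ`, which explains the factor `3ζ`.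
-/
theorem HasFourier.totalPot_re_le (h : HasFourier V W) {s : ℝ} (hs : s ≠ 0) {Ψ Ψ₀ : Total d}
    {ζ G : ℝ} (hζ : ζ ≤ 1) (h0 : ‖Ψ₀‖ ≤ G) (h1 : ‖Ψ - Ψ₀‖ ≤ ζ * G) :
    (totalPot W s Ψ Ψ).re ≤ (totalPot W s Ψ₀ Ψ₀).re + s ^ 2 * (∫ ξ, ‖W ξ‖) * (3 * ζ) * G ^ 2 := by
  have hq := h.isHermitianForm_totalPot hs
  have e := hq.re_self_add_smul (χ := Ψ₀) (Ψ := Ψ - Ψ₀) trivial trivial 1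
  simp only [Complex.ofReal_one, one_smul, add_sub_cancel] at e
  have h2 := (Complex.abs_re_le_norm _).trans (h.norm_totalPot_le s Ψ₀ (Ψ - Ψ₀))
  have h3 := (Complex.abs_re_le_norm _).trans (h.norm_totalPot_le s (Ψ - Ψ₀) (Ψ - Ψ₀))
  have h4 := le_abs_self (totalPot W s Ψ₀ (Ψ - Ψ₀)).re
  have h5 := le_abs_self (totalPot W s (Ψ - Ψ₀) (Ψ - Ψ₀)).re
  have hN : 0 ≤ s ^ 2 * ∫ ξ, ‖W ξ‖ := mul_nonneg (sq_nonneg s) (integral_norm_nonneg W)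
  set N := s ^ 2 * ∫ ξ, ‖W ξ‖
  have hG : 0 ≤ G := (norm_nonneg _).trans h0
  have h6 : N * ‖Ψ₀‖ * ‖Ψ - Ψ₀‖ ≤ N * G * (ζ * G) := by gcongr
  have h7 : N * ‖Ψ - Ψ₀‖ * ‖Ψ - Ψ₀‖ ≤ N * (1 * G) * (ζ * G) := by
    gcongr
    exact h1.trans (by gcongr)
  rw [e]
  nlinarith

/-- The energy of a trial state in the scaled external potential. -/
theorem HasFourier.infSpec_hamiltonian_le (h : HasFourier V W)
    (hH : DefinesHamiltonian v ω) {Φ₀ : Fock d} (h0 : ‖Φ₀‖ = 1) (hΦ₀ : HasMoments ω Φ₀)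
    {s : ℝ} (hs : 0 < s) {S : SimpleFunc (E d) (Fock d)} (hSm : ∀ P, HasMoments ω (S P))
    (hS1 : ∀ P, ‖S P‖ = 1) {ζ : ℝ} (hζ0 : 0 ≤ ζ) (hζ : ζ ≤ 1) (hSζ : ∀ P, ‖S P - Φ₀‖ ≤ ζ)
    {R : ℝ} {g : Lp ℂ 2 (volume : Measure (E d))} (hg : ∀ᵐ p, R ≤ ‖p‖ → g p = 0)
    {e a η : ℝ} (hSe : ∀ P, ‖P‖ < s * R →
      (fiberForm v ω P (S P) (S P)).re ≤ e + s ^ 2 * (a * ‖s⁻¹ • P‖ ^ 2 + η)) :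
    infSpec (hamiltonian v ω fun x => s ^ 2 * V (s • x)) * ‖g‖ ^ 2 ≤
      (e + s ^ 2 * (η + 3 * ζ * ∫ ξ, ‖W ξ‖)) * ‖g‖ ^ 2 +
        s ^ 2 * (a * kin g + (pot W g g).re) := by
  -- This is `f(P) = g(P / s)`, concentrated at momenta of order `s`, where the potential of length
  -- scale `1 / s` acts.
  set f := dilate (inv_pos.2 hs) g with hf
  have hJ := jac_pos (d := d) hs
  have hfg : dilate hs f = g := dilate_dilate_inv hs g
  have hnorm : ‖g‖ ^ 2 = jac d s * ‖f‖ ^ 2 := by rw [← hfg, norm_sq_dilate]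
  have hkin : kin g = jac d s * ∫ P, ‖s⁻¹ • P‖ ^ 2 * ‖f P‖ ^ 2 := by
    rw [← integral_dilate hs f fun p => ‖p‖ ^ 2, hfg]; rfl
  have hpot : (pot W g g).re = jac d s * (potScaled W s f f).re := by
    rw [← Complex.re_ofReal_mul, ← pot_dilate hs, hfg]
  have hfs : ∀ᵐ P, s * R ≤ ‖P‖ → f P = 0 := by
    have hq := Measure.quasiMeasurePreserving_smul (volume : Measure (E d)) (inv_pos.2 hs).ne'
    filter_upwards [coeFn_dilate (inv_pos.2 hs) g, hq.ae hg] with P h1 h2 h3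
    rw [h1]
    refine h2 ?_
    rw [norm_smul, Real.norm_of_nonneg (inv_pos.2 hs).le, le_inv_mul_iff₀ hs]
    exact h3
  have hE := (h.infSpec_hamiltonian_isGreatest hH (norm_ne_zero_iff.1 (h0.trans_ne one_ne_zero))
    hΦ₀ hs).1 _ (simpleState_mem_totalDomain hH.measurable_ω hSm hfs)
  rw [norm_simpleState hS1] at hE
  have hT : (totalForm v ω 0 (simpleState S f) (simpleState S f)).re ≤
      (e + s ^ 2 * η) * ‖f‖ ^ 2 + s ^ 2 * a * ∫ P, ‖s⁻¹ • P‖ ^ 2 * ‖f P‖ ^ 2 := by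
    obtain ⟨hi, he⟩ := hH.totalForm_simpleState hSm hfs
    have hk : Integrable fun P => ‖s⁻¹ • P‖ ^ 2 * ‖f P‖ ^ 2 := by
      refine ((integrable_kin_of_bounded_support hfs).const_mul (s⁻¹ ^ 2)).congr
        (Eventually.of_forall fun P => ?_)
      simp only [norm_smul, mul_pow, norm_inv, Real.norm_of_nonneg hs.le]
      ring
    rw [he, norm_sq_eq_integral, ← integral_const_mul, ← integral_const_mul,
      ← integral_add ((integrable_norm_sq f).const_mul _) (hk.const_mul _)]
    refine integral_mono_ae hi (((integrable_norm_sq f).const_mul _).add (hk.const_mul _)) ?_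
    filter_upwards [hfs] with P hP
    by_cases hPR : ‖P‖ < s * R
    · have := mul_le_mul_of_nonneg_left (hSe P hPR) (sq_nonneg ‖f P‖)
      linarith
    · simp [hP (not_lt.1 hPR)]
  have hV := h.totalPot_re_le hs.ne' hζ (Ψ := simpleState S f) (Ψ₀ := tensor f Φ₀) (G := ‖f‖)
    (by
      have := norm_sq_tensor f Φ₀
      rw [h0, one_pow, mul_one] at this
      exact ((sq_eq_sq₀ (norm_nonneg _) (norm_nonneg _)).1 this).le)
    (norm_simpleState_sub_tensor_le hζ0 hSζ f)
  rw [totalPot_tensor h.integrable, h0, one_pow, mul_one, Complex.re_ofReal_mul] at hV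
  rw [hnorm, hkin, hpot]
  have hall := mul_le_mul_of_nonneg_left (hE.trans (add_le_add hT hV)) hJ.le
  linarith

end TrialStates

/-! ### Ground states as trial states at other momenta; bounds from the dynamic mass. -/

section DynamicMass

variable {d : ℕ} {v : E d → ℂ} {ω : E d → ℝ}

theorem IsUniqueGroundState.mem_fiberDomain {P : E d} {Φ : Fock d}
    (h : IsUniqueGroundState v ω P Φ) : Φ ∈ fiberDomain ω P := h.2.1.1

theorem IsUniqueGroundState.fiberForm_re {P : E d} {Φ : Fock d}
    (h : IsUniqueGroundState v ω P Φ) : (fiberForm v ω P Φ Φ).re = fiberEnergy v ω P := by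
  have h1 : fiberForm v ω P Φ Φ = inner ℂ Φ ((fiberEnergy v ω P : ℂ) • Φ) :=
    h.2.1.2 Φ h.mem_fiberDomain
  have h2 : inner ℂ Φ ((fiberEnergy v ω P : ℂ) • Φ) = (fiberEnergy v ω P : ℂ) * inner ℂ Φ Φ := by
    rw [Submodule.coe_inner, Submodule.coe_inner, Submodule.coe_smul, inner_smul_right]
  have h3 : ‖(Φ : Lp ℂ 2 (configMeasure d))‖ = 1 := h.1
  rw [h1, h2, Submodule.coe_inner, inner_self_eq_norm_sq_to_K, h3]
  simp

theorem IsUniqueGroundState.hasMoments (hH : DefinesHamiltonian v ω) {P : E d} {Φ : Fock d}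
    (h : IsUniqueGroundState v ω P Φ) : HasMoments ω Φ := hH.hasMoments h.mem_fiberDomain

theorem IsUniqueGroundState.ne_zero {P : E d} {Φ : Fock d}
    (h : IsUniqueGroundState v ω P Φ) : Φ ≠ 0 := norm_ne_zero_iff.1 (h.1.trans_ne one_ne_zero)

/-- A ground state of `H_P` as a trial state for `H_{P'}`. -/
theorem IsUniqueGroundState.fiberForm_le (hH : DefinesHamiltonian v ω) {P : E d} {Φ : Fock d}
    (h : IsUniqueGroundState v ω P Φ) {e : ℝ} (he : ∀ P', e ≤ fiberEnergy v ω P') (P' : E d) :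
    (fiberForm v ω P' Φ Φ).re ≤ fiberEnergy v ω P +
      2 * ‖P' - P‖ * √(fiberEnergy v ω P - e) + ‖P' - P‖ ^ 2 := by
  have hm := h.hasMoments hH
  obtain ⟨w, hw⟩ := hm.exists_fiberForm_eq (v := v) P
  simp only [h.fiberForm_re, h.1, one_pow, mul_one] at hw
  -- The quadratic function `E(P) + 2⟨P' - P, w⟩ + ‖P' - P‖²` is smallest at `P' = P - w`, with
  -- value `E(P) - ‖w‖²`. As this must be at least `e`, the gradient satisfies `‖w‖² ≤ E(P) - e`.
  have h1 := (hH.fiberEnergy_isGreatest h.ne_zero hm (P - w)).1 Φ (hm.mem_fiberDomain _)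
  rw [h.1, hw, sub_sub_cancel_left, inner_neg_left, real_inner_self_eq_norm_sq, norm_neg] at h1
  have h2 : ‖w‖ ≤ √(fiberEnergy v ω P - e) := by
    refine Real.le_sqrt_of_sq_le ?_
    have := he (P - w)
    linarith
  rw [hw]
  have h3 := (real_inner_le_norm (P' - P) w).trans
    (mul_le_mul_of_nonneg_left h2 (norm_nonneg (P' - P)))
  linarith

/-- At the minimum `P = 0` the linear term vanishes, so the ground state of `H_0` gives the bare
kinetic energy as an upper bound. -/
theorem fiberEnergy_le_add_sq (hH : DefinesHamiltonian v ω) {Φ : Fock d}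
    (h : IsUniqueGroundState v ω 0 Φ) (he : ∀ P, fiberEnergy v ω 0 ≤ fiberEnergy v ω P) (P : E d) :
    fiberEnergy v ω P ≤ fiberEnergy v ω 0 + ‖P‖ ^ 2 := by
  have hm := h.hasMoments hH
  have h1 := (hH.fiberEnergy_isGreatest h.ne_zero hm P).1 Φ (hm.mem_fiberDomain _)
  have h2 := h.fiberForm_le hH he P
  rw [h.1] at h1
  simp only [sub_self, Real.sqrt_zero, sub_zero, mul_zero] at h2
  linarith

/-- The interaction can only increase the mass above its bare value: `E(P) - E(0) ≤ P²` forces `1 /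
M ≤ 2`. -/
theorem half_le_of_isDynamicMass (hd : 1 ≤ d) (hH : DefinesHamiltonian v ω) {M : ℝ≥0∞}
    (hM : IsDynamicMass v ω M) {Φ : Fock d} (h : IsUniqueGroundState v ω 0 Φ)
    (he : ∀ P, fiberEnergy v ω 0 ≤ fiberEnergy v ω P) : 1 / 2 ≤ M := by
  have : Nonempty (Fin d) := ⟨⟨0, hd⟩⟩
  have : (𝓝[≠] (0 : E d)).NeBot := inferInstance
  have hle : (M⁻¹).toReal ≤ 2 := by
    refine le_of_tendsto hM.2 (eventually_nhdsWithin_of_forall fun P hP => ?_)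
    have h1 : 0 < ‖P‖ ^ 2 := pow_pos (norm_pos_iff.2 hP) 2
    have h2 := fiberEnergy_le_add_sq hH h he P
    have h3 : (fiberEnergy v ω P - fiberEnergy v ω 0) / ‖P‖ ^ 2 ≤ 1 := by
      rw [div_le_one h1]; linarith
    linarith
  have h2 : M⁻¹ ≤ 2 := by
    rw [← ENNReal.toReal_le_toReal (ENNReal.inv_ne_top.2 hM.1.ne') (by norm_num)]
    simpa using hle
  rw [one_div]
  exact ENNReal.inv_le_iff_inv_le.1 h2

theorem invTwoMass_eq (M : ℝ≥0∞) : invTwoMass M = (M⁻¹).toReal / 2 := by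
  unfold invTwoMass
  rw [ENNReal.mul_inv (Or.inl two_ne_zero) (Or.inl ENNReal.ofNat_ne_top), ENNReal.toReal_mul]
  simp
  ring

theorem IsDynamicMass.exists_fiberEnergy_le {M : ℝ≥0∞} (hM : IsDynamicMass v ω M) {η : ℝ}
    (hη : 0 < η) : ∃ r : ℝ, 0 < r ∧ ∀ P : E d, ‖P‖ < r →
      fiberEnergy v ω P - fiberEnergy v ω 0 ≤ (invTwoMass M + η) * ‖P‖ ^ 2 := by
  have h1 := hM.2.eventually (gt_mem_nhds (show (M⁻¹).toReal < (M⁻¹).toReal + 2 * η by linarith))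
  obtain ⟨r, hr, hb⟩ := Metric.mem_nhdsWithin_iff.1 h1
  refine ⟨r, hr, fun P hP => ?_⟩
  by_cases hP0 : P = 0
  · simp [hP0]
  · have h2 : 2 * ((fiberEnergy v ω P - fiberEnergy v ω 0) / ‖P‖ ^ 2) < (M⁻¹).toReal + 2 * η :=
      hb ⟨mem_ball_zero_iff.2 hP, hP0⟩
    have h3 : 0 < ‖P‖ ^ 2 := pow_pos (norm_pos_iff.2 hP0) 2
    rw [invTwoMass_eq, ← div_le_iff₀ h3]
    linarith

end DynamicMass

/-! ### Upper bound on the energy in the external potential. -/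

section UpperBound

variable {d : ℕ} {v : E d → ℂ} {ω : E d → ℝ} {V : E d → ℝ} {W : E d → ℂ}

/-- The identity is uniformly approximated by simple functions on bounded sets. -/
theorem exists_simpleFunc_norm_sub_le (R : ℝ) {ε : ℝ} (hε : 0 < ε) :
    ∃ S : SimpleFunc (E d) (E d), ∀ p : E d, ‖p‖ < R → ‖S p - p‖ ≤ ε := by
  set u := TopologicalSpace.denseSeq (E d)
  have hcov : Metric.closedBall (0 : E d) R ⊆ ⋃ n, Metric.ball (u n) ε := fun p _ => by
    obtain ⟨n, hn⟩ := (TopologicalSpace.denseRange_denseSeq (E d)).exists_dist_lt p hε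
    exact Set.mem_iUnion.2 ⟨n, hn⟩
  obtain ⟨t, ht⟩ := (isCompact_closedBall (0 : E d) R).elim_finite_subcover _
    (fun n => Metric.isOpen_ball) hcov
  refine ⟨SimpleFunc.nearestPt u (t.sup id), fun p hp => ?_⟩
  obtain ⟨n, hn, hpn⟩ := Set.mem_iUnion₂.1 (ht (mem_closedBall_zero_iff.2 hp.le))
  have h := SimpleFunc.edist_nearestPt_le u p (Finset.le_sup (f := id) hn)
  rw [edist_dist, edist_dist, ENNReal.ofReal_le_ofReal_iff dist_nonneg] at h
  rw [← dist_eq_norm]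
  refine h.trans ?_
  rw [dist_comm]
  exact (Metric.mem_ball.1 hpn).le

/-- The left side is the error made when the ground state at a neighbor within distance `ε` is used,
in units of `s²`; it is continuous and vanishes at `ε = 0`. -/
theorem exists_pos_remainder_le (b R : ℝ) {η : ℝ} (hη : 0 < η) :
    ∃ ε : ℝ, 0 < ε ∧ b * (2 * R * ε + ε ^ 2) + 2 * ε * (√b * (R + ε)) + ε ^ 2 ≤ η := by
  have hc : Continuous fun ε : ℝ =>
      b * (2 * R * ε + ε ^ 2) + 2 * ε * (√b * (R + ε)) + ε ^ 2 := by fun_prop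
  have h0 : b * (2 * R * 0 + 0 ^ 2) + 2 * 0 * (√b * (R + 0)) + 0 ^ 2 < η := by simpa using hη
  have h := (hc.tendsto 0).eventually (gt_mem_nhds h0)
  obtain ⟨ε, h1, h2⟩ := ((h.filter_mono nhdsWithin_le_nhds).and
    (self_mem_nhdsWithin (s := Set.Ioi (0 : ℝ)))).exists
  exact ⟨ε, h2, h1.le⟩

/-- The energy of a ground state of `H_{s y}` as a trial state for `H_P`, `P` near `s y`. -/
theorem IsUniqueGroundState.fiberForm_le_of_near (hH : DefinesHamiltonian v ω) {s : ℝ} (hs : 0 < s)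
    {y p : E d} {Φ : Fock d} (h : IsUniqueGroundState v ω (s • y) Φ)
    (he : ∀ P, fiberEnergy v ω 0 ≤ fiberEnergy v ω P) {b R ε η : ℝ} (hb : 0 ≤ b)
    (hE : fiberEnergy v ω (s • y) - fiberEnergy v ω 0 ≤ b * ‖s • y‖ ^ 2) (hp : ‖p‖ < R)
    (hyp : ‖y - p‖ ≤ ε)
    (hη : b * (2 * R * ε + ε ^ 2) + 2 * ε * (√b * (R + ε)) + ε ^ 2 ≤ η) :
    (fiberForm v ω (s • p) Φ Φ).re ≤ fiberEnergy v ω 0 + s ^ 2 * (b * ‖p‖ ^ 2 + η) := by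
  have h1 := h.fiberForm_le hH he (s • p)
  rw [norm_smul, Real.norm_of_nonneg hs.le] at hE
  rw [← smul_sub, norm_smul, Real.norm_of_nonneg hs.le, norm_sub_rev] at h1
  have hε : 0 ≤ ε := (norm_nonneg _).trans hyp
  have hy : ‖y‖ ≤ ‖p‖ + ε := by
    have := norm_le_norm_add_norm_sub' y p
    linarith
  have hp0 := norm_nonneg p
  have hy2 : ‖y‖ ^ 2 ≤ ‖p‖ ^ 2 + (2 * R * ε + ε ^ 2) := by
    have : ‖y‖ ^ 2 ≤ (‖p‖ + ε) ^ 2 := by gcongr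
    have : ‖p‖ * ε ≤ R * ε := by gcongr
    linarith
  -- The gradient is of order `s` and the displacement of order `s ε`, so the linear error is of
  -- order `s² ε`, small on the relevant scale `s²`.
  have hsq : √(fiberEnergy v ω (s • y) - fiberEnergy v ω 0) ≤ s * (√b * (R + ε)) := by
    have h2 : √(b * (s * ‖y‖) ^ 2) = √b * (s * ‖y‖) := by
      rw [Real.sqrt_mul hb, Real.sqrt_sq (by positivity)]
    calc _ ≤ √(b * (s * ‖y‖) ^ 2) := Real.sqrt_le_sqrt hE
      _ = s * (√b * ‖y‖) := by rw [h2]; ring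
      _ ≤ _ := by gcongr; linarith
  have h3 : 2 * (s * ‖y - p‖) * √(fiberEnergy v ω (s • y) - fiberEnergy v ω 0) ≤
      2 * (s * ε) * (s * (√b * (R + ε))) := by gcongr
  have h4 : (s * ‖y - p‖) ^ 2 ≤ (s * ε) ^ 2 := by gcongr
  have h5 : b * ‖y‖ ^ 2 ≤ b * (‖p‖ ^ 2 + (2 * R * ε + ε ^ 2)) := by gcongr
  have h6 := mul_le_mul_of_nonneg_left h5 (sq_nonneg s)
  have h7 := mul_le_mul_of_nonneg_left hη (sq_nonneg s)
  linarith

/-- The energy of a localized particle is at most that of a Schrödinger particle with the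
dynamic effective mass. -/
theorem HasFourier.exists_infSpec_hamiltonian_le (h : HasFourier V W)
    (hH : DefinesHamiltonian v ω) {M : ℝ≥0∞} (hM : IsDynamicMass v ω M)
    (he : ∀ P, fiberEnergy v ω 0 ≤ fiberEnergy v ω P) {Pc : ℝ} (hPc : 0 < Pc)
    {Φ : E d → Fock d} (hΦ : ContinuousOn Φ (Metric.ball 0 Pc))
    (hgs : ∀ P ∈ Metric.ball (0 : E d) Pc, IsUniqueGroundState v ω P (Φ P))
    (hne : ∃ f ∈ schrodingerDomain d M, f ≠ 0) {η : ℝ} (hη : 0 < η) :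
    ∃ s₀ : ℝ, 0 < s₀ ∧ ∀ s : ℝ, 0 < s → s ≤ s₀ →
      infSpec (hamiltonian v ω fun x => s ^ 2 * V (s • x)) ≤
        fiberEnergy v ω 0 + s ^ 2 * (schrodingerEnergy V M + η) := by
  have hN := integral_norm_nonneg W
  set N := ∫ ξ, ‖W ξ‖ with hNdef
  obtain ⟨R, g, hR, hgR, hg⟩ := h.exists_approx_minimizer M hne (η := η / 4) (by positivity)
  -- The error `η` is shared equally by four sources: the choice of `g`, the distance `ζ` of the
  -- ground states from the one at zero, the expansion of `E` with error `η'`, and the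
  -- discretization `ε`.
  set ζ := min 1 (η / 4 / (3 * N + 1)) with hζ
  have hζ0 : 0 < ζ := lt_min one_pos (by positivity)
  have hζN : 3 * ζ * N ≤ η / 4 := by
    have h1 : ζ * (3 * N + 1) ≤ η / 4 := (le_div_iff₀ (by positivity)).1 (min_le_right _ _)
    linarith
  set η' := η / 4 / R ^ 2 with hη'
  have hη'0 : 0 < η' := by positivity
  have ha := invTwoMass_nonneg M
  obtain ⟨ε, hε, hεη⟩ := exists_pos_remainder_le (invTwoMass M + η') R (η := η / 4) (by positivity)
  obtain ⟨S, hS⟩ := exists_simpleFunc_norm_sub_le (d := d) R hε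
  obtain ⟨B, hB⟩ := S.exists_forall_norm_le
  obtain ⟨r, hr, hrE⟩ := hM.exists_fiberEnergy_le hη'0
  obtain ⟨ρ, hρ, hρΦ⟩ := Metric.continuousAt_iff.1
    (hΦ.continuousAt (Metric.ball_mem_nhds (0 : E d) hPc)) ζ hζ0
  have hB0 : 0 ≤ B := (norm_nonneg _).trans (hB 0)
  have hρ' : 0 < min Pc (min r ρ) := lt_min hPc (lt_min hr hρ)
  -- The values of `S` are bounded by `B`, so for such `s` every `s • S p` lies in the region where
  -- ground states exist, where `E` is expanded, and where `Φ` is within `ζ` of `Φ 0`.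
  refine ⟨min Pc (min r ρ) / (B + 1), by positivity, fun s hs hss => ?_⟩
  have hy : ∀ p, ‖s • S p‖ < min Pc (min r ρ) := fun p => by
    rw [le_div_iff₀ (by positivity)] at hss
    rw [norm_smul, Real.norm_of_nonneg hs.le]
    have := mul_le_mul_of_nonneg_left (hB p) hs.le
    linarith
  -- The ground state at momentum `P` is replaced by the one at the rounded momentum `s S(P / s)`.
  -- Only finitely many ground states occur, so the trial state is a finite sum of product states.
  set T : SimpleFunc (E d) (Fock d) :=
    (S.comp (fun P : E d => s⁻¹ • P) (measurable_const_smul _)).map fun y => Φ (s • y) with hT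
  have hTP : ∀ P, T P = Φ (s • S (s⁻¹ • P)) := fun P => rfl
  have hTg : ∀ P, IsUniqueGroundState v ω (s • S (s⁻¹ • P)) (T P) := fun P =>
    hgs _ (mem_ball_zero_iff.2 ((hy _).trans_le (min_le_left _ _)))
  have hg0 := hgs 0 (Metric.mem_ball_self hPc)
  have hmain := h.infSpec_hamiltonian_le hH hg0.1 (hg0.hasMoments hH) hs
    (S := T) (fun P => (hTg P).hasMoments hH) (fun P => (hTg P).1) hζ0.le (min_le_left _ _)
    (fun P => by
      rw [← dist_eq_norm, hTP]
      refine (hρΦ ?_).le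
      rw [dist_zero_right]
      exact (hy _).trans_le ((min_le_right _ _).trans (min_le_right _ _)))
    hgR (e := fiberEnergy v ω 0) (a := invTwoMass M) (η := η / 2) (fun P hP => by
      have hp : ‖s⁻¹ • P‖ < R := by
        rwa [norm_smul, norm_inv, Real.norm_of_nonneg hs.le, inv_mul_lt_iff₀ hs]
      have h1 := (hTg P).fiberForm_le_of_near hH hs he (by positivity)
        (hrE _ ((hy _).trans_le ((min_le_right _ _).trans (min_le_left _ _)))) hp (hS _ hp) hεη
      rw [smul_smul, mul_inv_cancel₀ hs.ne', one_smul] at h1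
      refine h1.trans ?_
      have h2 : η' * ‖s⁻¹ • P‖ ^ 2 ≤ η / 4 := by
        calc η' * ‖s⁻¹ • P‖ ^ 2 ≤ η' * R ^ 2 := by gcongr
          _ = η / 4 := by rw [hη']; field_simp
      have h3 := mul_le_mul_of_nonneg_left h2 (sq_nonneg s)
      linarith)
  -- The inequality that defines an approximate minimizer is strict, hence excludes `g = 0`.
  have hgpos : 0 < ‖g‖ ^ 2 := by
    refine pow_pos (lt_of_le_of_ne (norm_nonneg g) fun hzero => ?_) 2
    have h1 := h.abs_pot_re_le g g
    have h2 := mul_nonneg ha (kin_nonneg g)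
    rw [← hzero] at h1 hg
    simp only [mul_zero, abs_nonpos_iff] at h1
    rw [h1] at hg
    simp at hg
    linarith
  refine le_of_mul_le_mul_right ?_ hgpos
  have h3 := mul_le_mul_of_nonneg_left hg.le (sq_nonneg s)
  have h4 := mul_le_mul_of_nonneg_right
    (mul_le_mul_of_nonneg_left hζN (sq_nonneg s)) hgpos.le
  linarith

end UpperBound

/-! ### The limit of the scaled energy. -/

section EffectiveMass

variable {d : ℕ} {V : E d → ℝ} {W : E d → ℂ}

/-- A bound state yields a function with negative energy. -/
theorem IsBindingPotential.exists_negative (hV : IsBindingPotential V) (h : HasFourier V W) :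
    ∃ e < 0, ∃ f ∈ schrodingerDomain d (1 / 2), f ≠ 0 ∧ kin f + (pot W f f).re ≤ e * ‖f‖ ^ 2 := by
  obtain ⟨e, he, f, hf, hdom, hform⟩ := hV.bound_state
  refine ⟨e, he, f, hdom, hf, ?_⟩
  have h1 := h.schrodingerForm_self (1 / 2) f
  have h2 := hform f hdom
  simp only at h2
  rw [h2, invTwoMass_half, one_mul, inner_smul_right, inner_self_eq_norm_sq_to_K] at h1
  rw [← h1, Complex.re_ofReal_mul]
  simp [← Complex.ofReal_pow]

/-- The scaled energy in the external potential tends to that of a Schrödinger particle with the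
dynamic effective mass. -/
theorem HasFourier.tendsto_scaled_energy (h : HasFourier V W) {v : E d → ℂ} {ω : E d → ℝ}
    (hH : DefinesHamiltonian v ω) {M : ℝ≥0∞} (hM : IsDynamicMass v ω M) {C : ℝ} (hC : 0 < C)
    (hbound : ∀ P : E d, fiberEnergy v ω 0 + invTwoMass M * (‖P‖ ^ 2 / (1 + C * ‖P‖ ^ 2))
      ≤ fiberEnergy v ω P)
    (he : ∀ P, fiberEnergy v ω 0 ≤ fiberEnergy v ω P) {Pc : ℝ} (hPc : 0 < Pc)
    {Φ : E d → Fock d} (hΦ : ContinuousOn Φ (Metric.ball 0 Pc))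
    (hgs : ∀ P ∈ Metric.ball (0 : E d) Pc, IsUniqueGroundState v ω P (Φ P))
    (hne : ∃ f ∈ schrodingerDomain d M, f ≠ 0) :
    Tendsto (fun lam : ℝ =>
      (infSpec (hamiltonian v ω fun x => lam ^ 2 * V (lam • x)) - fiberEnergy v ω 0) / lam ^ 2)
      (𝓝[>] 0) (𝓝 (schrodingerEnergy V M)) := by
  have hg0 := hgs 0 (Metric.mem_ball_self hPc)
  refine Metric.tendsto_nhds.2 fun η hη => ?_
  obtain ⟨s₁, hs₁, hlow⟩ := h.exists_le_infSpec_hamiltonian hH hg0.ne_zero (hg0.hasMoments hH) M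
    hne hC hbound (half_pos hη)
  obtain ⟨s₂, hs₂, hup⟩ := h.exists_infSpec_hamiltonian_le hH hM he hPc hΦ hgs hne
    (half_pos hη)
  filter_upwards [Ioc_mem_nhdsGT (lt_min hs₁ hs₂)] with s hs
  have h1 := hlow s hs.1 (hs.2.trans (min_le_left _ _))
  have h2 := hup s hs.1 (hs.2.trans (min_le_right _ _))
  have hs2 : 0 < s ^ 2 := pow_pos hs.1 2
  have h3 : schrodingerEnergy V M - η / 2 ≤
      (infSpec (hamiltonian v ω fun x => s ^ 2 * V (s • x)) - fiberEnergy v ω 0) / s ^ 2 := by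
    rw [le_div_iff₀ hs2]; linarith
  have h4 : (infSpec (hamiltonian v ω fun x => s ^ 2 * V (s • x)) - fiberEnergy v ω 0) / s ^ 2 ≤
      schrodingerEnergy V M + η / 2 := by
    rw [div_le_iff₀ hs2]; linarith
  rw [Real.dist_eq, abs_lt]
  constructor <;> linarith

end EffectiveMass

end Polaron

theorem theorem1 (d : ℕ) (hd : 1 ≤ d) (v : Polaron.E d → ℂ) (ω : Polaron.E d → ℝ)
    (hH : Polaron.DefinesHamiltonian v ω)
    (M : ℝ≥0∞) (hM : Polaron.IsDynamicMass v ω M)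
    (hbound : ∃ C : ℝ, 0 < C ∧ ∀ P : Polaron.E d,
      Polaron.fiberEnergy v ω 0 + Polaron.invTwoMass M * (‖P‖ ^ 2 / (1 + C * ‖P‖ ^ 2))
        ≤ Polaron.fiberEnergy v ω P)
    (hground : ∃ Pc : ℝ, 0 < Pc ∧ ∃ Φ : Polaron.E d → Polaron.Fock d,
      ContinuousOn Φ (Metric.ball 0 Pc) ∧
      ∀ P ∈ Metric.ball (0 : Polaron.E d) Pc, Polaron.IsUniqueGroundState v ω P (Φ P))
    (V : Polaron.E d → ℝ) (hV : Polaron.IsBindingPotential V) (m : ℝ≥0∞) :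
    Polaron.IsStaticMass v ω V m ↔ m = M := by
  obtain ⟨W, hW, hWV⟩ := hV.fourier_integrable
  have h : Polaron.HasFourier V W := ⟨hW, hWV⟩
  obtain ⟨C, hC, hbound⟩ := hbound
  obtain ⟨Pc, hPc, Φ, hΦ, hgs⟩ := hground
  have hneg := hV.exists_negative h
  have hne : ∀ m, ∃ f ∈ Polaron.schrodingerDomain d m, f ≠ 0 := fun m => by
    obtain ⟨e, -, f, hf, hf0, -⟩ := hneg
    exact ⟨f, Polaron.mem_schrodingerDomain m (Polaron.integrable_of_mem_schrodingerDomain hf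
      (by rw [Polaron.invTwoMass_half]; exact one_ne_zero)), hf0⟩
  have he : ∀ P, Polaron.fiberEnergy v ω 0 ≤ Polaron.fiberEnergy v ω P := fun P => by
    have h1 := hbound P
    have h2 : 0 ≤ Polaron.invTwoMass M * (‖P‖ ^ 2 / (1 + C * ‖P‖ ^ 2)) :=
      mul_nonneg (Polaron.invTwoMass_nonneg M) (by positivity)
    linarith
  have hg0 := hgs 0 (Metric.mem_ball_self hPc)
  have hhalf := Polaron.half_le_of_isDynamicMass hd hH hM hg0 he
  have hlim := h.tendsto_scaled_energy hH hM hC hbound he hPc hΦ hgs (hne M)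
  constructor
  · rintro ⟨hm, hlim'⟩
    have heq := tendsto_nhds_unique hlim' hlim
    -- Strict monotonicity requires the smaller of the two masses to be at least `1/2`. This holds
    -- for `m` by definition of the static mass and for `M` by `Polaron.half_le_of_isDynamicMass`.
    rcases lt_trichotomy m M with hlt | heq' | hlt
    · exact absurd heq (h.schrodingerEnergy_lt hd hneg hm hlt).ne'
    · exact heq'
    · exact absurd heq (h.schrodingerEnergy_lt hd hneg hhalf hlt).ne
  · rintro rfl
    exact ⟨hhalf, hlim⟩
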